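/- Fix a database schema (finitely many relation symbols $R$, each with a finite list of attributes), an infinite domain of values represented by binary strings, and a set $\Delta$ of functional dependencies (FDs) $R:X\to Y$, where $X,Y$ are sets of attributes of $R$. A database is a finite set of facts $R(c_1,\dots,c_k)$; it satisfies $R:X\to Y$ if any two of its $R$-facts that agree on $X$ agree on $Y$, and two sets of FDs are equivalent if the same databases satisfy them. A set of FDs has a left-hand-side chain if for every two of its FDs $X\to Y$ and $X'\to Y'$ over the same relation symbol, $X\subseteq X'$ or $X'\subseteq X$. For a database $D$ let $$\mathcal I_{\mathsf R}(D,\Delta)=\min\{|E| : E\subseteq D,\ D\setminus E\models\Delta\},$$ and for $f\in D$ let $$\mathrm{Shapley}(D,\Delta,\mathcal I_{\mathsf R},f)=\frac1{|D|!}\sum_{\pi}\bigl(\mathcal I_{\mathsf R}(\pi_f\cup\{f\},\Delta)-\mathcal I_{\mathsf R}(\pi_f,\Delta)\bigr),$$ where $\pi$ ranges over all permutations of $D$ and $\pi_f$ is the set of facts that precede $f$ in $\pi$. Theorem. If $\Delta$ is equivalent to a set of FDs with a left-hand-side chain, then the problem of computing $\mathrm{Shapley}(D,\Delta,\mathcal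 I_{\mathsf R},f)$, given a database $D$ (as a list of its facts) and a fact $f\in D$, is in $\mathrm{FP}$: there is a Turing machine that, in time polynomial in the length of the input, outputs integers $n$ and $d\neq 0$ in binary with $\mathrm{Shapley}(D,\Delta,\mathcal I_{\mathsf R},f)=n/d$. (The schema and $\Delta$ are fixed and not part of the input.) -/

import Mathlib

namespace FDShapley

/-- A database schema: finitely many relation symbols, each with a finite signature.
The attributes of `R` are its positions `0, …, arity R - 1`. -/
structure Schema where
  Rel : Type
  [finRel : Fintype Rel]
  arity : Rel → ℕ

/-- The facts `R(c₁, …, c_k)` over the schema `S` with values in `Val`. -/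
structure Fact (S : Schema) (Val : Type) where
  rel : S.Rel
  val : Fin (S.arity rel) → Val

/-- A database is a finite set of facts. -/
abbrev Database (S : Schema) (Val : Type) : Type := Finset (Fact S Val)

/-- A functional dependency `rel : lhs → rhs`. -/
structure FD (S : Schema) where
  rel : S.Rel
  lhs : Finset (Fin (S.arity rel))
  rhs : Finset (Fin (S.arity rel))

/-- Any two `R`-facts of `D` that agree on the left-hand side agree on the right-hand side. -/
def FD.Holds {S : Schema} {Val : Type} (φ : FD S) (D : Database S Val) : Prop :=
  ∀ v w : Fin (S.arity φ.rel) → Val, Fact.mk φ.rel v ∈ D → Fact.mk φ.rel w ∈ D →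
    (∀ i ∈ φ.lhs, v i = w i) → ∀ i ∈ φ.rhs, v i = w i

/-- `D ⊨ Δ`. -/
def Satisfies {S : Schema} {Val : Type} (D : Database S Val) (Δ : Set (FD S)) : Prop :=
  ∀ φ ∈ Δ, φ.Holds D

/-- The same databases (with values in `Val`) satisfy `Δ` and `Δ'`. -/
def EquivalentFDs {S : Schema} (Val : Type) (Δ Δ' : Set (FD S)) : Prop :=
  ∀ D : Database S Val, Satisfies D Δ ↔ Satisfies D Δ'

/-- For every relation symbol, the left-hand sides of its FDs are pairwise comparable. -/
def HasLhsChain {S : Schema} (Δ : Set (FD S)) : Prop :=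
  ∀ (R : S.Rel) (X Y X' Y' : Finset (Fin (S.arity R))),
    FD.mk R X Y ∈ Δ → FD.mk R X' Y' ∈ Δ → X ⊆ X' ∨ X' ⊆ X

section Measure

open scoped Classical in
/-- The minimum number of facts to delete from `D` in order to satisfy `Δ`
(deleting all facts always works, so the minimum is over a nonempty set). -/
noncomputable def repairMeasure {S : Schema} {Val : Type} (D : Database S Val)
    (Δ : Set (FD S)) : ℕ :=
  sInf {n | ∃ E : Database S Val, E ⊆ D ∧ Satisfies (D \ E) Δ ∧ E.card = n}

/-- The players of `L` that come strictly before `a` in the permutation `π` of `L`, which is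
given by the place `π b` of every player `b`. -/
noncomputable def playersBefore {α : Type} (L : Finset α) (π : L ≃ Fin L.card) (a : L) :
    Finset α :=
  (Finset.univ.filter fun b : L => π b < π a).map (Function.Embedding.subtype _)

open scoped Classical in
/-- The Shapley value of the player `a` in the cooperative game `G` on the set `L` of players. -/
noncomputable def shapley {α : Type} (L : Finset α) (G : Finset α → ℝ) (a : L) : ℝ :=
  1 / (L.card.factorial : ℝ) * ∑ π : L ≃ Fin L.card,
    (G (insert (a : α) (playersBefore L π a)) - G (playersBefore L π a))

end Measure

/-- An input of the computational problem: a database, listed without repetitions in an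
arbitrary order, and one of its facts. -/
structure Input (S : Schema) (Val : Type) where
  facts : List (Fact S Val)
  nodup : facts.Nodup
  fact : Fact S Val
  mem : fact ∈ facts

/-- The database of an input. -/
def Input.db {S : Schema} {Val : Type} (x : Input S Val) : Database S Val :=
  ⟨x.facts, x.nodup⟩

/-- The Shapley value of the given fact of the given database with respect to `Δ` and the
repair measure. All facts of the database are players. -/
noncomputable def shapleyRepair {S : Schema} {Val : Type} (Δ : Set (FD S))
    (x : Input S Val) : ℝ :=
  shapley x.db (fun D => (repairMeasure D Δ : ℝ)) ⟨x.fact, x.mem⟩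

/-- The input alphabet over a schema with relation symbols `ρ`: a letter for every relation
symbol, the two bits, and an end marker for values. -/
inductive Letter (ρ : Type) where
  | rel (R : ρ)
  | bit (b : Bool)
  | endMark

/-- `R(c₁, …, c_k)` is written as `R` followed by the binary codes of `c₁, …, c_k`, each
followed by an end marker. -/
def encodeFact {S : Schema} {Val : Type} (code : Val → List Bool) (f : Fact S Val) :
    List (Letter S.Rel) :=
  Letter.rel f.rel ::
    (List.finRange (S.arity f.rel)).flatMap fun i => (code (f.val i)).map Letter.bit ++ [Letter.endMark]

/-- The input is written as the distinguished fact followed by the list of all facts. -/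
def encodeInput {S : Schema} {Val : Type} (code : Val → List Bool) (x : Input S Val) :
    List (Letter S.Rel) :=
  encodeFact code x.fact ++ x.facts.flatMap (encodeFact code)

/-- Integers in binary: a sign bit followed by the absolute value. -/
def encodingInt : Computability.Encoding ℤ Bool where
  encode z := decide (z < 0) :: Computability.encodeNat z.natAbs
  decode
    | [] => none
    | s :: l => some (if s then -(Computability.decodeNat l : ℤ) else (Computability.decodeNat l : ℤ))
  decode_encode z := by
    by_cases h : z < 0
    · simp [h, abs_of_neg h]
    · simp [h, abs_of_nonneg (not_lt.1 h)]

/-- Fractions `(n, d)`, numerator and denominator being written in binary. -/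
def encodingFraction : Computability.Encoding (ℤ × ℕ) (Bool ⊕ Bool) :=
  Computability.encodingProd encodingInt Computability.encodingNatBool

/-- The numerical function `F` is in FP, where its inputs are written by `enc`: some Turing
machine computes, in time polynomial in the length of the written input `x`, a numerator and a
nonzero denominator, in binary, of the number `F x`. -/
def InFP {α A : Type} (enc : α → List A) (F : α → ℝ) : Prop :=
  ∃ g : α → ℤ × ℕ,
    (∀ x, (g x).2 ≠ 0 ∧ F x = ((g x).1 : ℝ) / ((g x).2 : ℝ)) ∧
      Nonempty (Turing.TM2ComputableInPolyTime enc encodingFraction.encode g)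

end FDShapley

/-! Combinatorics. Collecting the permutations by the set `B` of facts that precede `f`, the Shapley
value is the sum over `B ⊆ D \ {f}` of `|B|! (|D| - 1 - |B|)!` times the marginal contribution of
`f` to `B`, divided by `|D|!` (`shapley_eq`). Let `v B` be the size of a largest consistent subset
of `B`; the repair measure is `|B| - v B`. Adding a fact raises `v` by 0 or 1, so the marginal
contribution is 1 if `v (B ∪ {f}) = v B` and 0 otherwise. Hence it suffices to know, for every
triple of numbers, how many sets `B` have that triple as `(|B|, v B, v (B ∪ {f}))`.

The chain gives a recursion for `v` (`isMax_chainValue`). Let `X → Y` be the dependency with the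
smallest left-hand side. Facts that conflict in any dependency agree on `X`, so the groups of facts
with equal `X`-values are independent and their values add up. Inside such a group, a consistent set
has constant `Y`-value, so the value is the maximum over the subgroups with equal `Y`-values; there
the remaining dependencies are treated in the same way. Different relation symbols are treated
simultaneously: level `j` uses the `j`-th dependency of each of them, and a group never mixes
relation symbols.

The counts follow the same recursion. For disjoint groups, sizes add and values are combined by sum
or maximum, so the histogram of a union is a convolution of the histograms of its groups
(`represents_combineAll`). Histograms remain small: for `n` facts there are at most `(n + 1) ^ 3`
keys, and the total multiplicity is at most `2 ^ n` (`good_chainHist`). The number of levels depends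
only on the dependencies, so the whole computation is polynomial.

Machines. Structured stack programs are compiled to `TM2` machines (`exec_code`). Data are trees
written in prefix code on a stack, and `PolyFn` is the class of functions computed on such codes in
polynomial time. It is closed under composition, pairing, case distinction and folds with
polynomially bounded intermediate results, which reduces the complexity claim to size bounds for the
functional form of the algorithm. Loops that parse the input and print the fraction connect this
with the prescribed encodings. -/

namespace FDShapley

open Turing Function

/-! ### Structured stack programs and their compilation to `TM2` machines -/

/-- Structured programs over stacks `k : K` with alphabets `Γ k`. -/
inductive Prog {K : Type} (Γ : K → Type) : Type
  | skip
  | push (k : K) (x : Γ k)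
  | pop (k : K)
  | seq (p q : Prog Γ)
  | ite (k : K) (P : Option (Γ k) → Bool) (p q : Prog Γ)
  | loop (k : K) (P : Option (Γ k) → Bool) (p : Prog Γ)

namespace Prog

variable {K : Type} {Γ : K → Type}

section Exec

variable [DecidableEq K]

/-- `Exec p S t S'`: started with stacks `S`, the program `p` stops after `t` steps with `S'`. -/
inductive Exec : Prog Γ → (∀ k, List (Γ k)) → ℕ → (∀ k, List (Γ k)) → Prop
  | skip (S) : Exec skip S 1 S
  | push (S k x) : Exec (push k x) S 1 (update S k (x :: S k))
  | pop (S k) : Exec (pop k) S 1 (update S k (S k).tail)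
  | seq {p q S t S' t' S''} : Exec p S t S' → Exec q S' t' S'' → Exec (seq p q) S (t + t') S''
  | ite_true {k P p q S t S'} : P (S k).head? = true → Exec p S t S' →
      Exec (ite k P p q) S (1 + t) S'
  | ite_false {k P p q S t S'} : P (S k).head? = false → Exec q S t S' →
      Exec (ite k P p q) S (1 + t) S'
  | loop_done {k P p S} : P (S k).head? = false → Exec (loop k P p) S 1 S
  | loop_step {k P p S t S' t' S''} : P (S k).head? = true → Exec p S t S' →
      Exec (loop k P p) S' t' S'' → Exec (loop k P p) S (1 + t + t') S''

/-- A step pushes at most one letter. Thus running time bounds output length, which is how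
`PolyFn.polyBound_size` gets its bound. -/
theorem Exec.length_le {p : Prog Γ} {S S' : ∀ k, List (Γ k)} {t : ℕ} (h : Exec p S t S') (k : K) :
    (S' k).length ≤ (S k).length + t := by
  induction h with
  | skip => omega
  | push S j x =>
    by_cases hk : k = j
    · subst hk; simp
    · simp [hk]
  | pop S j =>
    by_cases hk : k = j
    · subst hk; simp; omega
    · simp [hk]
  | seq _ _ ih ih' => omega
  | ite_true _ _ ih => omega
  | ite_false _ _ ih => omega
  | loop_done => omega
  | loop_step _ _ _ ih ih' => omega

end Exec

/-- The labels of the machine code of a program. -/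
def Lab : Prog Γ → Type
  | skip => Unit
  | push _ _ => Unit
  | pop _ => Unit
  | seq p q => Lab p ⊕ Lab q
  | ite _ _ p q => Option (Lab p ⊕ Lab q)
  | loop _ _ p => Option (Lab p)

theorem finite_lab (p : Prog Γ) : Finite (Lab p) := by
  induction p with
  | skip => exact inferInstanceAs (Finite Unit)
  | push => exact inferInstanceAs (Finite Unit)
  | pop => exact inferInstanceAs (Finite Unit)
  | seq p q ihp ihq => exact inferInstanceAs (Finite (Lab p ⊕ Lab q))
  | ite k P p q ihp ihq => exact inferInstanceAs (Finite (Option (Lab p ⊕ Lab q)))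
  | loop k P p ihp => exact inferInstanceAs (Finite (Option (Lab p)))

/-- The first label of a program. -/
def entry : (p : Prog Γ) → Lab p
  | skip => ()
  | push _ _ => ()
  | pop _ => ()
  | seq p _ => Sum.inl (entry p)
  | ite _ _ _ _ => (none : Option _)
  | loop _ _ _ => (none : Option _)

/-- The machine code of a program, which is left by jumping to `exit`. -/
def code {L : Type} : (p : Prog Γ) → (Lab p → L) → L → Lab p → TM2.Stmt Γ L Bool
  | skip, _, exit, _ => .goto fun _ => exit
  | push k x, _, exit, _ => .push k (fun _ => x) (.goto fun _ => exit)
  | pop k, _, exit, _ => .pop k (fun v _ => v) (.goto fun _ => exit)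
  | seq p q, emb, exit, l =>
    match l with
    | Sum.inl l => code p (fun l => emb (Sum.inl l)) (emb (Sum.inr (entry q))) l
    | Sum.inr l => code q (fun l => emb (Sum.inr l)) exit l
  | ite k P p q, emb, exit, l =>
    match l with
    | none => .peek k (fun _ o => P o) (.branch id
        (.goto fun _ => emb (some (Sum.inl (entry p)))) (.goto fun _ => emb (some (Sum.inr (entry q)))))
    | some (Sum.inl l) => code p (fun l => emb (some (Sum.inl l))) exit l
    | some (Sum.inr l) => code q (fun l => emb (some (Sum.inr l))) exit l
  | loop k P p, emb, exit, l =>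
    match l with
    | none => .peek k (fun _ o => P o) (.branch id
        (.goto fun _ => emb (some (entry p))) (.goto fun _ => exit))
    | some l => code p (fun l => emb (some l)) (emb none) l

theorem iterate_bind_trans {σ : Type} {f : σ → Option σ} {a b : σ} {c : Option σ} {m n : ℕ}
    (h : (flip bind f)^[m] (some a) = some b) (h' : (flip bind f)^[n] (some b) = c) :
    (flip bind f)^[m + n] (some a) = c := by
  rw [Nat.add_comm, Function.iterate_add_apply, h, h']

/-- Induction over the execution. The embedding `emb` of labels and the label `exit` are arbitrary,
so that the code of a subprogram can be recognised inside the code of a larger one. The Boolean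
register only carries the outcome of the latest test, hence its final value is left open. -/
theorem exec_code [DecidableEq K] {p : Prog Γ} {S S' : ∀ k, List (Γ k)} {t : ℕ} (h : Exec p S t S') {L : Type}
    (m : L → TM2.Stmt Γ L Bool) (emb : Lab p → L) (exit : L)
    (hm : ∀ l, m (emb l) = code p emb exit l) (v : Bool) :
    ∃ v', (flip bind (TM2.step m))^[t] (some ⟨some (emb (entry p)), v, S⟩) =
      some ⟨some exit, v', S'⟩ := by
  induction h generalizing exit v with
  | skip S =>
    refine ⟨v, ?_⟩
    simp [flip, TM2.step, hm, code]
  | push S k x =>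
    refine ⟨v, ?_⟩
    simp [flip, TM2.step, hm, code]
  | pop S k =>
    refine ⟨v, ?_⟩
    simp [flip, TM2.step, hm, code]
  | @seq p q S t S' t' S'' h h' ih ih' =>
    obtain ⟨v₁, h₁⟩ := ih (fun l => emb (Sum.inl l)) (emb (Sum.inr (entry q)))
      (fun l => hm _) v
    obtain ⟨v₂, h₂⟩ := ih' (fun l => emb (Sum.inr l)) exit (fun l => hm _) v₁
    exact ⟨v₂, iterate_bind_trans h₁ h₂⟩
  | @ite_true k P p q S t S' hP h ih =>
    obtain ⟨v₁, h₁⟩ := ih (fun l => emb (some (Sum.inl l))) exit (fun l => hm _) true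
    refine ⟨v₁, iterate_bind_trans (m := 1) ?_ h₁⟩
    have h0 := hm (none : Option _)
    change (flip bind (TM2.step m))^[1] (some ⟨some (emb (none : Option _)), v, S⟩) = _
    simp only [code] at h0
    simp [flip, TM2.step, h0, hP]
  | @ite_false k P p q S t S' hP h ih =>
    obtain ⟨v₁, h₁⟩ := ih (fun l => emb (some (Sum.inr l))) exit (fun l => hm _) false
    refine ⟨v₁, iterate_bind_trans (m := 1) ?_ h₁⟩
    have h0 := hm (none : Option _)
    change (flip bind (TM2.step m))^[1] (some ⟨some (emb (none : Option _)), v, S⟩) = _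
    simp only [code] at h0
    simp [flip, TM2.step, h0, hP]
  | @loop_done k P p S hP =>
    refine ⟨false, ?_⟩
    have h0 := hm (none : Option _)
    change (flip bind (TM2.step m))^[1] (some ⟨some (emb (none : Option _)), v, S⟩) = _
    simp only [code] at h0
    simp [flip, TM2.step, h0, hP]
  | @loop_step k P p S t S' t' S'' hP h h' ih ih' =>
    obtain ⟨v₁, h₁⟩ := ih (fun l => emb (some l)) (emb none) (fun l => hm _) true
    obtain ⟨v₂, h₂⟩ := ih' emb exit hm v₁
    refine ⟨v₂, iterate_bind_trans (iterate_bind_trans (m := 1) ?_ h₁) h₂⟩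
    have h0 := hm (none : Option _)
    change (flip bind (TM2.step m))^[1] (some ⟨some (emb (none : Option _)), v, S⟩) = _
    simp only [code] at h0
    simp [flip, TM2.step, h0, hP]

/-- The machine of a program. -/
noncomputable def machine [DecidableEq K] [Fintype K] [∀ k, Fintype (Γ k)] (p : Prog Γ) (k₀ k₁ : K) : FinTM2 :=
  haveI := finite_lab p
  { K := K
    k₀ := k₀
    k₁ := k₁
    Γ := Γ
    Λ := Option (Lab p)
    main := some (entry p)
    ΛFin := Fintype.ofFinite _
    σ := Bool
    initialState := false
    m := fun l => match l with
      -- The register is reset because `haltList` demands the initial internal state.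
      | none => .load (fun _ => false) .halt
      | some l => code p some none l }

theorem dite_eq_update [DecidableEq K] (k₀ : K) (s : List (Γ k₀)) (k : K) :
    (@dite (List (Γ k)) (k = k₀) _ (fun h => by rw [h]; exact s) fun _ => []) =
      update (fun _ => []) k₀ s k := by
  by_cases hk : k = k₀
  · subst hk; simp
  · simp [hk]

/-- A program that maps the written inputs to the written outputs in polynomial time gives a
polynomial time machine. -/
theorem nonempty_tm2ComputableInPolyTime [DecidableEq K] [Fintype K] [∀ k, Fintype (Γ k)] {α β : Type}
    (k₀ k₁ : K) {ea : α → List (Γ k₀)} {eb : β → List (Γ k₁)} {f : α → β} (p : Prog Γ)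
    (P : Polynomial ℕ)
    (h : ∀ x, ∃ t ≤ P.eval (ea x).length,
      Exec p (update (fun _ => []) k₀ (ea x)) t (update (fun _ => []) k₁ (eb (f x)))) :
    Nonempty (TM2ComputableInPolyTime ea eb f) := by
  -- The additional step executes the halting statement at the label `none`.
  have key : ∀ x, ∃ t ≤ (P + 1).eval (ea x).length,
      (flip bind (machine p k₀ k₁).step)^[t] (some (initList (machine p k₀ k₁) (ea x))) =
        some (haltList (machine p k₀ k₁) (eb (f x))) := by
    intro x
    obtain ⟨t, ht, h⟩ := h x
    obtain ⟨v, hv⟩ := exec_code h (machine p k₀ k₁).m some none (fun l => rfl) false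
    refine ⟨t + 1, by simpa using ht, ?_⟩
    have h0 : initList (machine p k₀ k₁) (ea x) =
        ⟨some (some (entry p)), false, update (fun _ => []) k₀ (ea x)⟩ := by
      refine congrArg (TM2.Cfg.mk _ _) (funext fun k => ?_)
      exact dite_eq_update k₀ (ea x) k
    have h1 : haltList (machine p k₀ k₁) (eb (f x)) =
        ⟨none, false, update (fun _ => []) k₁ (eb (f x))⟩ := by
      refine congrArg (TM2.Cfg.mk _ _) (funext fun k => ?_)
      exact dite_eq_update k₁ (eb (f x)) k
    rw [h0, h1]
    refine iterate_bind_trans hv ?_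
    rfl
  choose t ht hev using key
  exact ⟨{
    tm := machine p k₀ k₁
    inputAlphabet := Equiv.refl _
    outputAlphabet := Equiv.refl _
    time := P + 1
    outputsFun := fun x => {
      steps := t x
      evals_in_steps := by
        have h2 : ∀ {A : Type} (l : List A), List.map (Equiv.refl A).invFun l = l := fun l => by simp
        exact (congrArg₂ (fun u w => (flip bind (machine p k₀ k₁).step)^[t x]
          (some (initList (machine p k₀ k₁) u)) = some (haltList (machine p k₀ k₁) w))
          (h2 _) (h2 _)).mpr (hev x)
      steps_le_m := ht x } }⟩

end Prog

end FDShapley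

namespace FDShapley

open Turing Function

/-! ### Binary trees on a stack -/

/-- The stacks: input, a copy of the input, output, and four working stacks. -/
inductive Stk
  | inp | tmp | out | a | b | c | d
  deriving DecidableEq

instance : Fintype Stk :=
  ⟨{.inp, .tmp, .out, .a, .b, .c, .d}, fun k => by cases k <;> decide⟩

/-- The alphabets of the stacks. -/
abbrev Alph (I O : Type) : Stk → Type
  | .inp => I
  | .tmp => I
  | .out => O
  | _ => Option Bool

instance (I O : Type) [Fintype I] [Fintype O] : ∀ k, Fintype (Alph I O k)
  | .inp => inferInstanceAs (Fintype I)
  | .tmp => inferInstanceAs (Fintype I)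
  | .out => inferInstanceAs (Fintype O)
  | .a => inferInstanceAs (Fintype (Option Bool))
  | .b => inferInstanceAs (Fintype (Option Bool))
  | .c => inferInstanceAs (Fintype (Option Bool))
  | .d => inferInstanceAs (Fintype (Option Bool))

/-- The contents of the input, copy and output stacks. -/
structure Frame (I O : Type) where
  inp : List I
  tmp : List I
  out : List O

/-- The contents of all stacks. -/
def st {I O : Type} (F : Frame I O) (a b c d : List (Option Bool)) : ∀ k, List (Alph I O k)
  | .inp => F.inp
  | .tmp => F.tmp
  | .out => F.out
  | .a => a
  | .b => b
  | .c => c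
  | .d => d

/-- Binary trees, the data on which programs operate. -/
inductive Tree
  | nil
  | node (l r : Tree)

/-- The prefix code of a tree. -/
def Tree.ser : Tree → List (Option Bool)
  | nil => [some false]
  | node l r => some true :: (l.ser ++ r.ser)

/-- This makes `none` usable as a marker that separates trees put aside on stack `b`. -/
theorem Tree.none_notMem_ser (t : Tree) : none ∉ t.ser := by
  induction t with
  | nil => simp [ser]
  | node l r ihl ihr => simp [ser, ihl, ihr]

namespace Prog

theorem Exec.of_eq {K : Type} [DecidableEq K] {Γ : K → Type} {p : Prog Γ}
    {S S' T T' : ∀ k, List (Γ k)} {m n : ℕ} (h : Exec p S m S') (h1 : S = T) (h2 : m = n)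
    (h3 : S' = T') : Exec p T n T' := by
  subst h1 h2 h3; exact h

section Basic

variable {I O : Type} (F : Frame I O) (a b c d : List (Option Bool)) (x : Option Bool)

theorem exec_push_a : Exec (push (Γ := Alph I O) .a x) (st F a b c d) 1 (st F (x :: a) b c d) := by
  have : st F (x :: a) b c d = update (st F a b c d) .a (x :: a) := by
    funext k; cases k <;> rfl
  rw [this]; exact Exec.push (Γ := Alph I O) _ .a x

theorem exec_push_b : Exec (push (Γ := Alph I O) .b x) (st F a b c d) 1 (st F a (x :: b) c d) := by
  have : st F a (x :: b) c d = update (st F a b c d) .b (x :: b) := by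
    funext k; cases k <;> rfl
  rw [this]; exact Exec.push (Γ := Alph I O) _ .b x

theorem exec_push_c : Exec (push (Γ := Alph I O) .c x) (st F a b c d) 1 (st F a b (x :: c) d) := by
  have : st F a b (x :: c) d = update (st F a b c d) .c (x :: c) := by
    funext k; cases k <;> rfl
  rw [this]; exact Exec.push (Γ := Alph I O) _ .c x

theorem exec_push_d : Exec (push (Γ := Alph I O) .d x) (st F a b c d) 1 (st F a b c (x :: d)) := by
  have : st F a b c (x :: d) = update (st F a b c d) .d (x :: d) := by
    funext k; cases k <;> rfl
  rw [this]; exact Exec.push (Γ := Alph I O) _ .d x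

theorem exec_pop_a : Exec (pop (Γ := Alph I O) .a) (st F (x :: a) b c d) 1 (st F a b c d) := by
  have : st F a b c d = update (st F (x :: a) b c d) .a a := by
    funext k; cases k <;> rfl
  rw [this]; exact Exec.pop (Γ := Alph I O) _ .a

theorem exec_pop_b : Exec (pop (Γ := Alph I O) .b) (st F a (x :: b) c d) 1 (st F a b c d) := by
  have : st F a b c d = update (st F a (x :: b) c d) .b b := by
    funext k; cases k <;> rfl
  rw [this]; exact Exec.pop (Γ := Alph I O) _ .b

theorem exec_pop_c : Exec (pop (Γ := Alph I O) .c) (st F a b (x :: c) d) 1 (st F a b c d) := by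
  have : st F a b c d = update (st F a b (x :: c) d) .c c := by
    funext k; cases k <;> rfl
  rw [this]; exact Exec.pop (Γ := Alph I O) _ .c

theorem exec_pop_d : Exec (pop (Γ := Alph I O) .d) (st F a b c (x :: d)) 1 (st F a b c d) := by
  have : st F a b c d = update (st F a b c (x :: d)) .d d := by
    funext k; cases k <;> rfl
  rw [this]; exact Exec.pop (Γ := Alph I O) _ .d

end Basic

/-! ### Moving, deleting and duplicating the top tree of a stack -/

section Macros

variable {I O : Type}

/-- Tests for the letter `true`. -/
def headTrue (o : Option (Option Bool)) : Bool := o == some (some true)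

/-- Tests for a letter other than the marker `none`. -/
def isLetter (o : Option (Option Bool)) : Bool := o.isSome && o != some none

/-- Move a tree from stack `a` to stack `b`, reversed; stack `c` counts the pending subtrees. -/
def moveLoop : Prog (Alph I O) :=
  loop .c Option.isSome (ite .a headTrue
    (seq (pop .a) (seq (push .c none) (push .b (some true))))
    (seq (pop .a) (seq (pop .c) (push .b (some false)))))

/-- Delete pending subtrees from stack `a`. -/
def dropLoop : Prog (Alph I O) :=
  loop .c Option.isSome (ite .a headTrue
    (seq (pop .a) (push .c none)) (seq (pop .a) (pop .c)))

/-- Move letters from stack `b` to stack `a` up to a marker. -/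
def backLoop : Prog (Alph I O) :=
  loop .b isLetter (ite .b headTrue
    (seq (pop .b) (push .a (some true))) (seq (pop .b) (push .a (some false))))

/-- Move letters from stack `b` to stacks `a` and `d` up to a marker. -/
def forkLoop : Prog (Alph I O) :=
  loop .b isLetter (ite .b headTrue
    (seq (pop .b) (seq (push .a (some true)) (push .d (some true))))
    (seq (pop .b) (seq (push .a (some false)) (push .d (some false)))))

/-- Move all letters from stack `d` to stack `a`. -/
def returnLoop : Prog (Alph I O) :=
  loop .d isLetter (ite .d headTrue
    (seq (pop .d) (push .b (some true))) (seq (pop .d) (push .b (some false))))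

/-- A prefix code is delimited by counting pending subtrees: a node adds one to the counter on stack
`c`, a leaf removes one. The statement is in continuation form (whatever the loop does after the
tree `t`), so that the two subtrees of a node can be processed one after the other in the induction.
-/
theorem exec_moveLoop (F : Frame I O) (t : Tree) : ∀ (x : Option Bool) (a b c d) (n : ℕ) (S),
    Exec moveLoop (st F a (t.ser.reverse ++ b) c d) n S →
    Exec moveLoop (st F (t.ser ++ a) b (x :: c) d) (5 * t.ser.length + n) S := by
  induction t with
  | nil =>
    intro x a b c d n S h
    have h1 : Exec _ _ _ _ := Exec.seq (exec_pop_a F a b (x :: c) d (some false))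
      (Exec.seq (exec_pop_c F a b c d x) (exec_push_b F a b c d (some false)))
    exact Exec.loop_step (Γ := Alph I O) (k := .c) rfl
      (Exec.ite_false (Γ := Alph I O) (k := .a) rfl h1) h
  | node l r ihl ihr =>
    intro x a b c d n S h
    have h1 : Exec _ _ _ _ := Exec.seq (exec_pop_a F (l.ser ++ (r.ser ++ a)) b (x :: c) d (some true))
      (Exec.seq (exec_push_c F _ b (x :: c) d none) (exec_push_b F _ b _ d (some true)))
    have h2 := ihl none (r.ser ++ a) (some true :: b) (x :: c) d _ S
      (ihr x a (l.ser.reverse ++ some true :: b) c d n S (by simpa [Tree.ser] using h))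
    have h3 : Exec _ _ _ _ := Exec.loop_step (Γ := Alph I O) (k := .c) rfl
      (Exec.ite_true (Γ := Alph I O) (k := .a) rfl h1) h2
    exact h3.of_eq (by simp [Tree.ser]) (by simp [Tree.ser]; ring) rfl

theorem exec_dropLoop (F : Frame I O) (t : Tree) : ∀ (x : Option Bool) (a b c d) (n : ℕ) (S),
    Exec dropLoop (st F a b c d) n S →
    Exec dropLoop (st F (t.ser ++ a) b (x :: c) d) (4 * t.ser.length + n) S := by
  induction t with
  | nil =>
    intro x a b c d n S h
    have h1 : Exec _ _ _ _ := Exec.seq (exec_pop_a F a b (x :: c) d (some false))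
      (exec_pop_c F a b c d x)
    exact Exec.loop_step (Γ := Alph I O) (k := .c) rfl
      (Exec.ite_false (Γ := Alph I O) (k := .a) rfl h1) h
  | node l r ihl ihr =>
    intro x a b c d n S h
    have h1 : Exec _ _ _ _ := Exec.seq (exec_pop_a F (l.ser ++ (r.ser ++ a)) b (x :: c) d (some true))
      (exec_push_c F _ b (x :: c) d none)
    have h2 := ihl none (r.ser ++ a) b (x :: c) d _ S (ihr x a b c d n S h)
    have h3 : Exec _ _ _ _ := Exec.loop_step (Γ := Alph I O) (k := .c) rfl
      (Exec.ite_true (Γ := Alph I O) (k := .a) rfl h1) h2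
    exact h3.of_eq (by simp [Tree.ser]) (by simp [Tree.ser]; ring) rfl

theorem exec_backLoop (F : Frame I O) (b c d) (w : List (Option Bool)) (hw : none ∉ w) :
    ∀ a, Exec backLoop (st F a (w ++ none :: b) c d) (4 * w.length + 1)
      (st F (w.reverse ++ a) (none :: b) c d) := by
  induction w with
  | nil => exact fun a => Exec.loop_done (Γ := Alph I O) (k := .b) rfl
  | cons x w ih =>
    intro a
    simp only [List.mem_cons, not_or] at hw
    have h2 := ih hw.2 (x :: a)
    obtain _ | _ | _ := x
    · exact absurd rfl hw.1
    · have h1 : Exec _ _ _ _ := Exec.seq (exec_pop_b F a (w ++ none :: b) c d (some false))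
        (exec_push_a F a (w ++ none :: b) c d (some false))
      have h3 : Exec _ _ _ _ := Exec.loop_step (Γ := Alph I O) (k := .b) rfl
        (Exec.ite_false (Γ := Alph I O) (k := .b) rfl h1) h2
      exact h3.of_eq rfl (by simp; ring) (by simp)
    · have h1 : Exec _ _ _ _ := Exec.seq (exec_pop_b F a (w ++ none :: b) c d (some true))
        (exec_push_a F a (w ++ none :: b) c d (some true))
      have h3 : Exec _ _ _ _ := Exec.loop_step (Γ := Alph I O) (k := .b) rfl
        (Exec.ite_true (Γ := Alph I O) (k := .b) rfl h1) h2
      exact h3.of_eq rfl (by simp; ring) (by simp)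

theorem exec_forkLoop (F : Frame I O) (b c) (w : List (Option Bool)) (hw : none ∉ w) :
    ∀ a d, Exec forkLoop (st F a (w ++ none :: b) c d) (5 * w.length + 1)
      (st F (w.reverse ++ a) (none :: b) c (w.reverse ++ d)) := by
  induction w with
  | nil => exact fun a d => Exec.loop_done (Γ := Alph I O) (k := .b) rfl
  | cons x w ih =>
    intro a d
    simp only [List.mem_cons, not_or] at hw
    have h2 := ih hw.2 (x :: a) (x :: d)
    obtain _ | _ | _ := x
    · exact absurd rfl hw.1
    · have h1 : Exec _ _ _ _ := Exec.seq (exec_pop_b F a (w ++ none :: b) c d (some false))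
        (Exec.seq (exec_push_a F a (w ++ none :: b) c d (some false))
          (exec_push_d F _ (w ++ none :: b) c d (some false)))
      have h3 : Exec _ _ _ _ := Exec.loop_step (Γ := Alph I O) (k := .b) rfl
        (Exec.ite_false (Γ := Alph I O) (k := .b) rfl h1) h2
      exact h3.of_eq rfl (by simp; ring) (by simp)
    · have h1 : Exec _ _ _ _ := Exec.seq (exec_pop_b F a (w ++ none :: b) c d (some true))
        (Exec.seq (exec_push_a F a (w ++ none :: b) c d (some true))
          (exec_push_d F _ (w ++ none :: b) c d (some true)))
      have h3 : Exec _ _ _ _ := Exec.loop_step (Γ := Alph I O) (k := .b) rfl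
        (Exec.ite_true (Γ := Alph I O) (k := .b) rfl h1) h2
      exact h3.of_eq rfl (by simp; ring) (by simp)

/-- The letters of stack `d` end up on stack `b`, in reversed order; this is the form in which
`unstash` expects a tree. -/
theorem exec_returnLoop (F : Frame I O) (a c) (w : List (Option Bool)) (hw : none ∉ w) :
    ∀ b, Exec returnLoop (st F a b c w) (4 * w.length + 1) (st F a (w.reverse ++ b) c []) := by
  induction w with
  | nil => exact fun a => Exec.loop_done (Γ := Alph I O) (k := .d) rfl
  | cons x w ih =>
    intro b
    simp only [List.mem_cons, not_or] at hw
    have h2 := ih hw.2 (x :: b)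
    obtain _ | _ | _ := x
    · exact absurd rfl hw.1
    · have h1 : Exec _ _ _ _ := Exec.seq (exec_pop_d F a b c w (some false))
        (exec_push_b F a b c w (some false))
      have h3 : Exec _ _ _ _ := Exec.loop_step (Γ := Alph I O) (k := .d) rfl
        (Exec.ite_false (Γ := Alph I O) (k := .d) rfl h1) h2
      exact h3.of_eq rfl (by simp; ring) (by simp)
    · have h1 : Exec _ _ _ _ := Exec.seq (exec_pop_d F a b c w (some true))
        (exec_push_b F a b c w (some true))
      have h3 : Exec _ _ _ _ := Exec.loop_step (Γ := Alph I O) (k := .d) rfl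
        (Exec.ite_true (Γ := Alph I O) (k := .d) rfl h1) h2
      exact h3.of_eq rfl (by simp; ring) (by simp)

/-- Put the top tree of stack `a` aside. -/
def stash : Prog (Alph I O) := seq (push .b none) (seq (push .c none) moveLoop)

/-- Restore the tree that was put aside last. -/
def unstash : Prog (Alph I O) := seq backLoop (pop .b)

/-- Delete the top tree of stack `a`. -/
def drop : Prog (Alph I O) := seq (push .c none) dropLoop

/-- Duplicate the top tree of stack `a`. -/
def dup : Prog (Alph I O) := seq stash (seq forkLoop (seq returnLoop unstash))

theorem exec_stash (F : Frame I O) (t : Tree) (a b d) :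
    Exec stash (st F (t.ser ++ a) b [] d) (5 * t.ser.length + 3)
      (st F a (t.ser.reverse ++ none :: b) [] d) := by
  have h : Exec _ _ _ _ := Exec.seq (exec_push_b F (t.ser ++ a) b [] d none)
    (Exec.seq (exec_push_c F _ _ [] d none) (exec_moveLoop F t none a (none :: b) [] d 1 _
      (Exec.loop_done (Γ := Alph I O) (k := .c) rfl)))
  exact h.of_eq rfl (by ring) rfl

theorem exec_unstash (F : Frame I O) (t : Tree) (a b c d) :
    Exec unstash (st F a (t.ser.reverse ++ none :: b) c d) (4 * t.ser.length + 2)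
      (st F (t.ser ++ a) b c d) := by
  have h : Exec _ _ _ _ := Exec.seq
    (exec_backLoop F b c d t.ser.reverse (by simpa using t.none_notMem_ser) a)
    (exec_pop_b F _ b c d none)
  exact h.of_eq rfl (by simp) (by simp)

theorem exec_drop (F : Frame I O) (t : Tree) (a b d) :
    Exec drop (st F (t.ser ++ a) b [] d) (4 * t.ser.length + 2) (st F a b [] d) := by
  have h : Exec _ _ _ _ := Exec.seq (exec_push_c F (t.ser ++ a) b [] d none)
    (exec_dropLoop F t none a b [] d 1 _ (Exec.loop_done (Γ := Alph I O) (k := .c) rfl))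
  exact h.of_eq rfl (by ring) rfl

/-- The tree is reversed onto `b`, from there copied to both `a` and `d`, and the copy on `d` is
brought back to `a` through `b`. `forkLoop` leaves the marker on `b`, so it serves again for the
second passage. -/
theorem exec_dup (F : Frame I O) (t : Tree) (a b) :
    Exec dup (st F (t.ser ++ a) b [] []) (18 * t.ser.length + 7)
      (st F (t.ser ++ (t.ser ++ a)) b [] []) := by
  have h2 := exec_forkLoop F b [] t.ser.reverse (by simpa using t.none_notMem_ser) a []
  simp only [List.reverse_reverse, List.append_nil, List.length_reverse] at h2
  have h : Exec _ _ _ _ := Exec.seq (exec_stash F t a b []) (Exec.seq h2 (Exec.seq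
    (exec_returnLoop F _ [] t.ser t.none_notMem_ser (none :: b)) (exec_unstash F t _ b [] [])))
  exact h.of_eq rfl (by ring) rfl

/-- Push a list of letters on stack `a`. -/
def pushList : List (Option Bool) → Prog (Alph I O)
  | [] => skip
  | x :: w => seq (pushList w) (push .a x)

theorem exec_pushList (F : Frame I O) (w a b c d) :
    Exec (pushList w) (st F a b c d) (w.length + 1) (st F (w ++ a) b c d) := by
  induction w with
  | nil => exact Exec.skip _
  | cons x w ih => exact Exec.seq ih (exec_push_a F _ b c d x)

end Macros

end Prog

end FDShapley

namespace FDShapley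

open Turing Function Prog

/-! ### Functions computed in polynomial time on trees -/

/-- Types whose elements are written as trees. -/
class Enc (α : Type) where
  enc : α → Tree

open Enc (enc)

instance : Enc Unit := ⟨fun _ => .nil⟩

instance : Enc Bool := ⟨fun b => cond b (.node .nil .nil) .nil⟩

instance {α β : Type} [Enc α] [Enc β] : Enc (α × β) := ⟨fun x => .node (Enc.enc x.1) (Enc.enc x.2)⟩

/-- The tree of a list. -/
def encList {α : Type} [Enc α] : List α → Tree
  | [] => .nil
  | x :: l => .node (Enc.enc x) (encList l)

instance {α : Type} [Enc α] : Enc (List α) := ⟨encList⟩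

/-- The length of the code of `x`. -/
def size {α : Type} [Enc α] (x : α) : ℕ := (Enc.enc x).ser.length

/-! ### Lengths of codes -/

section Size

variable {α β : Type} [Enc α] [Enc β]

theorem Tree.length_ser_pos (t : Tree) : 0 < t.ser.length := by
  cases t <;> simp [Tree.ser]

theorem size_pos (x : α) : 0 < size x := Tree.length_ser_pos _

@[simp] theorem size_pair (x : α) (y : β) : size (x, y) = size x + size y + 1 := by
  simp [size, Enc.enc, Tree.ser]

@[simp] theorem size_nil : size ([] : List α) = 1 := rfl

@[simp] theorem size_cons (x : α) (l : List α) : size (x :: l) = size x + size l + 1 := by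
  simp [size, Enc.enc, Tree.ser, encList]

theorem size_bool_le (x : Bool) : size x ≤ 3 := by
  cases x <;> decide

theorem size_append (l m : List α) : size (l ++ m) + 1 = size l + size m := by
  induction l with
  | nil => simp; omega
  | cons x l ih => simp; omega

theorem length_lt_size (l : List α) : l.length < size l := by
  induction l with
  | nil => simp
  | cons x l ih => simp; omega

theorem size_lt_of_mem {x : α} {l : List α} (h : x ∈ l) : size x < size l := by
  induction l with
  | nil => simp at h
  | cons y l ih =>
    rcases List.mem_cons.1 h with rfl | h
    · simp only [size_cons]; omega
    · have := ih h
      simp; omega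

theorem size_le_of_sublist {l m : List α} (h : l.Sublist m) : size l ≤ size m := by
  induction h with
  | slnil => exact le_rfl
  | cons x _ ih => simp; omega
  | cons_cons x _ ih => simp; omega

theorem size_reverse (l : List α) : size l.reverse = size l := by
  induction l with
  | nil => rfl
  | cons x l ih =>
    have := size_append l.reverse [x]
    simp at this ⊢
    omega

theorem size_list_le {l : List α} {n : ℕ} (h : ∀ x ∈ l, size x ≤ n) :
    size l ≤ l.length * (n + 1) + 1 := by
  induction l with
  | nil => simp
  | cons x l ih =>
    have h1 := ih fun y hy => h y (List.mem_cons_of_mem _ hy)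
    have h2 := h x List.mem_cons_self
    simp only [size_cons, List.length_cons]
    linarith

end Size

/-! ### Polynomial bounds -/

theorem eval_mono (P : Polynomial ℕ) {m n : ℕ} (h : m ≤ n) : P.eval m ≤ P.eval n := by
  rw [Polynomial.eval_eq_sum, Polynomial.eval_eq_sum]
  exact Finset.sum_le_sum fun i _ => Nat.mul_le_mul_left _ (Nat.pow_le_pow_left h i)

/-- Bounds that are polynomial in the length of the code. -/
def PolyBound {α : Type} [Enc α] (s : α → ℕ) : Prop :=
  ∃ P : Polynomial ℕ, ∀ x, s x ≤ P.eval (size x)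

namespace PolyBound

variable {α β : Type} [Enc α] [Enc β] {s s' : α → ℕ}

theorem const (n : ℕ) : PolyBound fun _ : α => n := ⟨Polynomial.C n, fun x => by simp⟩

theorem size : PolyBound fun x : α => size x := ⟨Polynomial.X, fun x => by simp⟩

theorem add (h : PolyBound s) (h' : PolyBound s') : PolyBound fun x => s x + s' x := by
  obtain ⟨P, hP⟩ := h
  obtain ⟨Q, hQ⟩ := h'
  exact ⟨P + Q, fun x => by simpa using add_le_add (hP x) (hQ x)⟩

theorem mul (h : PolyBound s) (h' : PolyBound s') : PolyBound fun x => s x * s' x := by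
  obtain ⟨P, hP⟩ := h
  obtain ⟨Q, hQ⟩ := h'
  exact ⟨P * Q, fun x => by simpa using Nat.mul_le_mul (hP x) (hQ x)⟩

theorem mono (h : PolyBound s') (hs : ∀ x, s x ≤ s' x) : PolyBound s := by
  obtain ⟨P, hP⟩ := h
  exact ⟨P, fun x => (hs x).trans (hP x)⟩

theorem comp {s : β → ℕ} {f : α → β} (h : PolyBound s) (hf : PolyBound fun x => FDShapley.size (f x)) :
    PolyBound fun x => s (f x) := by
  obtain ⟨P, hP⟩ := h
  obtain ⟨Q, hQ⟩ := hf
  exact ⟨P.comp Q, fun x => by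
    rw [Polynomial.eval_comp]; exact (hP _).trans (eval_mono P (hQ x))⟩

/-- A polynomial bound for `s` at all points that are polynomially bounded in size. -/
theorem exists_of_size_le {s : β → ℕ} (h : PolyBound s) {n : α → ℕ} (hn : PolyBound n) :
    ∃ t : α → ℕ, PolyBound t ∧ ∀ x y, FDShapley.size y ≤ n x → s y ≤ t x := by
  obtain ⟨P, hP⟩ := h
  obtain ⟨Q, hQ⟩ := hn
  exact ⟨fun x => P.eval (n x), ⟨P.comp Q, fun x => by
    rw [Polynomial.eval_comp]; exact eval_mono P (hQ x)⟩, fun x y hy => (hP y).trans (eval_mono P hy)⟩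

end PolyBound

/-- The function `f` is computed on trees by a program that runs in polynomial time, leaving
everything below its argument unchanged. -/
@[fun_prop]
def PolyFn {α β : Type} [Enc α] [Enc β] (f : α → β) : Prop :=
  ∀ I O : Type, ∃ (p : Prog (Alph I O)) (T : α → ℕ), PolyBound T ∧ ∀ x (F : Frame I O) a b,
    ∃ m ≤ T x, Exec p (st F ((enc x).ser ++ a) b [] []) m (st F ((enc (f x)).ser ++ a) b [] [])

namespace PolyFn

variable {α β γ δ τ : Type} [Enc α] [Enc β] [Enc γ] [Enc δ] [Enc τ]

theorem polyBound_size {f : α → β} (h : PolyFn f) : PolyBound fun x => size (f x) := by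
  obtain ⟨p, T, hT, h⟩ := h Unit Unit
  refine (PolyBound.size.add hT).mono fun x => ?_
  obtain ⟨m, hm, h⟩ := h x ⟨[], [], []⟩ [] []
  have := h.length_le .a
  simp only [st, List.append_nil] at this
  unfold size
  omega

theorem polyBound_comp {f : α → β} (h : PolyFn f) {s : β → ℕ} (hs : PolyBound s) :
    PolyBound fun x => s (f x) := hs.comp h.polyBound_size

/-- Functions that change only the type of the data, not the code, cost nothing; `cons` and
`Nat.bits` are of this kind. -/
theorem of_enc_eq {f : α → β} (h : ∀ x, enc (f x) = enc x) : PolyFn f := fun I O =>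
  ⟨skip, fun _ => 1, PolyBound.const 1, fun x F a b => ⟨1, le_rfl, by rw [h]; exact Exec.skip _⟩⟩

@[fun_prop]
theorem id : PolyFn fun x : α => x := of_enc_eq fun _ => rfl

@[fun_prop]
theorem comp {g : β → γ} {f : α → β} (hg : PolyFn g) (hf : PolyFn f) : PolyFn fun x => g (f x) := by
  intro I O
  obtain ⟨q, U, hU, hq⟩ := hg I O
  obtain ⟨p, T, hT, hp⟩ := hf I O
  refine ⟨seq p q, fun x => T x + U (f x), hT.add (hf.polyBound_comp hU), fun x F a b => ?_⟩
  obtain ⟨m, hm, hp⟩ := hp x F a b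
  obtain ⟨n, hn, hq⟩ := hq (f x) F a b
  exact ⟨m + n, add_le_add hm hn, hp.seq hq⟩

theorem congr {f g : α → β} (hf : PolyFn f) (h : ∀ x, g x = f x) : PolyFn g := by
  rwa [show g = f from funext h]

@[fun_prop]
theorem const (y : β) : PolyFn fun _ : α => y := by
  intro I O
  refine ⟨seq drop (pushList (enc y).ser), fun x => (4 * size x + 2) + (size y + 1),
    (((PolyBound.const 4).mul PolyBound.size).add (PolyBound.const 2)).add (PolyBound.const _),
    fun x F a b => ⟨_, le_rfl, ?_⟩⟩
  exact (exec_drop F (enc x) a b []).seq (exec_pushList F _ a b [] [])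

@[fun_prop]
-- Duplicate the argument, compute `f x` on one copy, put it aside, compute `g x` on the other copy,
-- restore `f x` on top of it and write the node letter. Since programs preserve whatever lies below
-- their data on `a` and `b`, the two computations do not interfere.
theorem pair {f : α → β} {g : α → γ} (hf : PolyFn f) (hg : PolyFn g) :
    PolyFn fun x => (f x, g x) := by
  intro I O
  obtain ⟨p, T, hT, hp⟩ := hf I O
  obtain ⟨q, U, hU, hq⟩ := hg I O
  refine ⟨seq dup (seq p (seq stash (seq q (seq unstash (push .a (some true)))))),
    fun x => (18 * size x + 7) + (T x + ((5 * size (f x) + 3) + (U x + ((4 * size (f x) + 2) + 1)))),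
    ?_, fun x F a b => ?_⟩
  · have := hf.polyBound_size
    exact (((PolyBound.const 18).mul PolyBound.size).add (PolyBound.const 7)).add
      (hT.add ((((PolyBound.const 5).mul this).add (PolyBound.const 3)).add
      (hU.add ((((PolyBound.const 4).mul this).add (PolyBound.const 2)).add (PolyBound.const 1)))))
  · obtain ⟨m, hm, hp⟩ := hp x F ((enc x).ser ++ a) b
    obtain ⟨n, hn, hq⟩ := hq x F a ((enc (f x)).ser.reverse ++ none :: b)
    have h : Exec _ _ _ _ := (exec_dup F (enc x) a b).seq (hp.seq ((exec_stash F _ _ b []).seq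
      (hq.seq ((exec_unstash F _ _ b [] []).seq (exec_push_a F _ b [] [] (some true))))))
    refine ⟨_, ?_, h.of_eq rfl rfl (by simp [Enc.enc, Tree.ser])⟩
    simp only [size]
    omega

@[fun_prop]
theorem fst : PolyFn fun x : α × β => x.1 := by
  intro I O
  refine ⟨seq (pop .a) (seq stash (seq drop unstash)), fun x => 13 * size x + 20,
    ((PolyBound.const 13).mul PolyBound.size).add (PolyBound.const 20), fun x F a b => ?_⟩
  have h : Exec _ _ _ _ := (exec_pop_a F ((enc x.1).ser ++ ((enc x.2).ser ++ a)) b [] [] (some true)).seq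
    ((exec_stash F _ _ b []).seq ((exec_drop F _ a _ []).seq (exec_unstash F _ _ b [] [])))
  refine ⟨_, ?_, h.of_eq (by simp [Enc.enc, Tree.ser]) rfl rfl⟩
  obtain ⟨x, y⟩ := x
  simp only [size_pair]
  simp only [size]
  omega

@[fun_prop]
theorem snd : PolyFn fun x : α × β => x.2 := by
  intro I O
  refine ⟨seq (pop .a) drop, fun x => 4 * size x + 3,
    ((PolyBound.const 4).mul PolyBound.size).add (PolyBound.const 3), fun x F a b => ?_⟩
  have h : Exec _ _ _ _ := (exec_pop_a F ((enc x.1).ser ++ ((enc x.2).ser ++ a)) b [] [] (some true)).seq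
    (exec_drop F _ _ b [])
  refine ⟨_, ?_, h.of_eq (by simp [Enc.enc, Tree.ser]) rfl rfl⟩
  obtain ⟨x, y⟩ := x
  simp only [size_pair]
  simp only [size]
  omega

/-- Case distinction on the root of the code of `f x`. -/
theorem treeCases {f : α → β} {g : α → γ} {h : δ → γ} (hf : PolyFn f) (hg : PolyFn g)
    (hh : PolyFn h) {F : α → γ} (d : α → δ) (h0 : ∀ x, enc (f x) = .nil → F x = g x)
    (h1 : ∀ x, enc (f x) ≠ .nil → enc (d x) = .node (enc (f x)) (enc x) ∧ F x = h (d x)) :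
    PolyFn F := by
  intro I O
  obtain ⟨p, T, hT, hp⟩ := hf.pair id I O
  obtain ⟨q, U, hU, hq⟩ := hg I O
  obtain ⟨r, V, hV, hr⟩ := hh I O
  obtain ⟨W, hW, hVW⟩ := hV.exists_of_size_le (hf.pair id).polyBound_size
  -- The program `p` computes `(f x, x)`. Below its node letter lies the root letter of the code of
  -- `f x`, which is tested. If it is a node, the removed letter is written back and the stack is
  -- read as the code of `d x`.
  refine ⟨seq p (seq (pop .a) (ite .a headTrue (seq (push .a (some true)) r) (seq (pop .a) q))),
    fun x => T x + (1 + (1 + (1 + (U x + W x)))),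
    hT.add ((PolyBound.const 1).add ((PolyBound.const 1).add ((PolyBound.const 1).add (hU.add hW)))),
    fun x F' a b => ?_⟩
  obtain ⟨m, hm, hp⟩ := hp x F' a b
  by_cases hx : enc (f x) = .nil
  · obtain ⟨n, hn, hq⟩ := hq x F' a b
    have h2 : Exec _ _ _ _ := ((exec_pop_a F' ((enc x).ser ++ a) b [] [] (some false)).seq hq)
    have h3 : Exec _ _ _ _ := (exec_pop_a F' (some false :: ((enc x).ser ++ a)) b [] [] (some true)).seq
      (Exec.ite_false (Γ := Alph I O) (k := .a) (P := headTrue)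
        (p := seq (push .a (some true)) r) rfl h2)
    refine ⟨_, ?_, hp.seq (h3.of_eq ?_ rfl ?_)⟩
    · simp only
      omega
    · have : enc (f x, x) = .node (enc (f x)) (enc x) := rfl
      rw [this, hx]
      simp [Tree.ser]
    · rw [h0 x hx]
  · obtain ⟨hd, hF⟩ := h1 x hx
    obtain ⟨n, hn, hr⟩ := hr (d x) F' a b
    have h2 : Exec _ _ _ _ := (exec_push_a F' ((enc (f x)).ser ++ ((enc x).ser ++ a)) b [] []
      (some true)).seq (hr.of_eq (by rw [hd]; simp [Tree.ser]) rfl rfl)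
    have ht : headTrue (st F' ((enc (f x)).ser ++ ((enc x).ser ++ a)) b [] [] .a).head? = true := by
      generalize enc (f x) = t at hx
      obtain _ | ⟨l, r⟩ := t
      · exact absurd rfl hx
      · rfl
    have h3 : Exec _ _ _ _ := (exec_pop_a F' ((enc (f x)).ser ++ ((enc x).ser ++ a)) b [] []
      (some true)).seq (Exec.ite_true (Γ := Alph I O) (k := .a) (P := headTrue)
        (q := seq (pop .a) q) ht h2)
    have hs : V (d x) ≤ W x := hVW x (d x) (by simp only [size, hd]; rfl)
    refine ⟨_, ?_, hp.seq (h3.of_eq ?_ rfl ?_)⟩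
    · simp only
      omega
    · have : enc (f x, x) = .node (enc (f x)) (enc x) := rfl
      rw [this]
      simp [Tree.ser]
    · rw [hF]

/-- Iteration as long as the first component of the state is not the empty list. -/
theorem whileNonempty {step : List β × τ → List β × τ} (hs : PolyFn step)
    {init : α → List β × τ} (hi : PolyFn init) {out : α → τ} (N B : α → ℕ)
    (hN : PolyBound N) (hB : PolyBound B)
    (h : ∀ x, (∀ i < N x, (step^[i] (init x)).1 ≠ []) ∧ step^[N x] (init x) = ([], out x) ∧
      ∀ i ≤ N x, size (step^[i] (init x)) ≤ B x) : PolyFn out := by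
  intro I O
  obtain ⟨p, T, hT, hp⟩ := hs I O
  obtain ⟨q, V, hV, hq⟩ := hi I O
  obtain ⟨U, hU, hTU⟩ := hT.exists_of_size_le hB
  -- Between rounds the node letter of the state pair is removed, so that the top letter is the root
  -- of the list component: `true` exactly for a nonempty list. The final `pop` removes the code of
  -- the empty list.
  refine ⟨seq q (seq (pop .a)
      (seq (loop .a headTrue (seq (push .a (some true)) (seq p (pop .a)))) (pop .a))),
    fun x => V x + (1 + ((N x * (3 + U x) + 1) + 1)),
    hV.add ((PolyBound.const 1).add (((hN.mul ((PolyBound.const 3).add hU)).add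
      (PolyBound.const 1)).add (PolyBound.const 1))), fun x F a b => ?_⟩
  obtain ⟨h0, h1, h2⟩ := h x
  have e : ∀ y : List β × τ, (enc y).ser ++ a =
      some true :: ((enc y.1).ser ++ ((enc y.2).ser ++ a)) := fun y => by
    simp [Enc.enc, Tree.ser]
  -- Induction on the number `j` of rounds still to be done after round `i`.
  have key : ∀ j i, i + j = N x → ∃ m ≤ j * (3 + U x) + 1,
      Exec (loop .a headTrue (seq (push .a (some true)) (seq p (pop .a))))
        (st F ((enc (step^[i] (init x)).1).ser ++ ((enc (step^[i] (init x)).2).ser ++ a)) b [] []) m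
        (st F (some false :: ((enc (out x)).ser ++ a)) b [] []) := by
    intro j
    induction j with
    | zero =>
      intro i hi
      rw [Nat.add_zero] at hi
      rw [hi, h1]
      exact ⟨1, by omega, Exec.loop_done (Γ := Alph I O) (k := .a) rfl⟩
    | succ j ih =>
      intro i hi
      have hi' := h0 i (by omega)
      have hc : headTrue (st F ((enc (step^[i] (init x)).1).ser ++
          ((enc (step^[i] (init x)).2).ser ++ a)) b [] [] .a).head? = true := by
        generalize (step^[i] (init x)).1 = l at hi'
        obtain _ | ⟨y, l⟩ := l
        · exact absurd rfl hi'
        · rfl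
      obtain ⟨m, hm, h3⟩ := hp (step^[i] (init x)) F a b
      obtain ⟨n, hn, h4⟩ := ih (i + 1) (by omega)
      rw [Function.iterate_succ_apply'] at h4
      have h5 := hTU x _ (h2 i (by omega))
      rw [e, e] at h3
      have h6 : Exec _ _ _ _ := (exec_push_a F _ b [] [] (some true)).seq
        (h3.seq (exec_pop_a F _ b [] [] (some true)))
      refine ⟨_, ?_, Exec.loop_step (Γ := Alph I O) (k := .a) hc h6 h4⟩
      rw [Nat.succ_mul]
      omega
  obtain ⟨m, hm, h3⟩ := key (N x) 0 (by omega)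
  obtain ⟨n, hn, hq⟩ := hq x F a b
  rw [e (init x)] at hq
  have h4 : Exec _ _ _ _ := hq.seq ((exec_pop_a F _ b [] [] (some true)).seq
    (h3.seq (exec_pop_a F _ b [] [] (some false))))
  refine ⟨_, ?_, h4⟩
  simp only
  omega

end PolyFn

namespace PolyFn

variable {α β γ δ τ : Type} [Enc α] [Enc β] [Enc γ] [Enc δ] [Enc τ]

/-! ### Case distinctions -/

/-- The code of `b :: l` is also the code of the pair `(b, l)`, so `treeCases` hands head and tail
to `h`. An inhabitant of `β` is needed only to define the unused value for the empty list; if there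
is none, every list is empty. -/
theorem listCases {f : α → List β} {g : α → γ} {h : α → β → List β → γ} (hf : PolyFn f)
    (hg : PolyFn g) (hh : PolyFn fun p : (β × List β) × α => h p.2 p.1.1 p.1.2) {F : α → γ}
    (h0 : ∀ x, f x = [] → F x = g x) (h1 : ∀ x b l, f x = b :: l → F x = h x b l) : PolyFn F := by
  by_cases hβ : Nonempty β
  · obtain ⟨b₀⟩ := hβ
    refine treeCases hf hg hh (fun x => match f x with
      | [] => ((b₀, []), x)
      | b :: l => ((b, l), x)) (fun x hx => h0 x ?_) (fun x hx => ?_)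
    · rcases hfx : f x with _ | ⟨b, l⟩
      · rfl
      · rw [hfx] at hx; cases hx
    · rcases hfx : f x with _ | ⟨b, l⟩
      · rw [hfx] at hx; exact absurd rfl hx
      · exact ⟨rfl, h1 x b l hfx⟩
  · refine hg.congr fun x => h0 x ?_
    rcases f x with _ | ⟨b, l⟩
    · rfl
    · exact absurd ⟨b⟩ hβ

@[fun_prop]
theorem cond {c : α → Bool} {f g : α → β} (hc : PolyFn c) (hf : PolyFn f) (hg : PolyFn g) :
    PolyFn fun x => bif c x then f x else g x := by
  -- The code of `true` is the code of `((), ())`.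
  refine treeCases (h := fun p : (Unit × Unit) × α => f p.2) hc hg (by fun_prop)
    (fun x => (((), ()), x)) (fun x hx => ?_) (fun x hx => ?_)
  · rcases hcx : c x
    · rfl
    · rw [hcx] at hx; cases hx
  · rcases hcx : c x
    · rw [hcx] at hx; exact absurd rfl hx
    · exact ⟨rfl, rfl⟩

@[fun_prop]
theorem and {c d : α → Bool} (hc : PolyFn c) (hd : PolyFn d) : PolyFn fun x => c x && d x :=
  (cond hc hd (const false)).congr fun x => by cases c x <;> rfl

@[fun_prop]
theorem or {c d : α → Bool} (hc : PolyFn c) (hd : PolyFn d) : PolyFn fun x => c x || d x :=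
  (cond hc (const true) hd).congr fun x => by cases c x <;> rfl

@[fun_prop]
theorem not {c : α → Bool} (hc : PolyFn c) : PolyFn fun x => !c x :=
  (cond hc (const false) (const true)).congr fun x => by cases c x <;> rfl

@[fun_prop]
theorem xor {c d : α → Bool} (hc : PolyFn c) (hd : PolyFn d) : PolyFn fun x => Bool.xor (c x) (d x) :=
  (cond hc (not hd) hd).congr fun x => by cases c x <;> cases d x <;> rfl

/-! ### Lists -/

@[fun_prop]
theorem cons {f : α → β} {l : α → List β} (hf : PolyFn f) (hl : PolyFn l) :
    PolyFn fun x => f x :: l x :=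
  (of_enc_eq (f := fun p : β × List β => p.1 :: p.2) fun _ => rfl).comp (hf.pair hl)

@[fun_prop]
theorem tail {l : α → List β} (hl : PolyFn l) : PolyFn fun x => (l x).tail :=
  listCases (h := fun _ _ m => m) hl (const []) (by fun_prop) (fun x hx => by rw [hx]; rfl)
    (fun x b m hx => by rw [hx]; rfl)

theorem headD {l : α → List β} (hl : PolyFn l) (b : β) : PolyFn fun x => (l x).headD b :=
  listCases (h := fun _ b _ => b) hl (const b) (by fun_prop) (fun x hx => by rw [hx]; rfl)
    (fun x b m hx => by rw [hx]; rfl)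

@[fun_prop]
theorem isEmpty {l : α → List β} (hl : PolyFn l) : PolyFn fun x => (l x).isEmpty :=
  listCases (h := fun _ _ _ => false) hl (const true) (const _) (fun x hx => by rw [hx]; rfl)
    (fun x b m hx => by rw [hx]; rfl)

/-- A while loop on the remaining list, the parameter and the accumulator. Polynomial time for one
step does not prevent exponential growth under iteration, so a bound `B` for the accumulators on all
prefixes has to be supplied. -/
theorem foldl {l : α → List β} {init : α → τ} {f : α → τ → β → τ} (hl : PolyFn l)
    (hi : PolyFn init) (hf : PolyFn fun p : (α × τ) × β => f p.1.1 p.1.2 p.2) (B : α → ℕ)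
    (hB : PolyBound B) (h : ∀ x l', l' <+: l x → size (l'.foldl (f x) (init x)) ≤ B x) :
    PolyFn fun x => (l x).foldl (f x) (init x) := by
  set step : List β × α × τ → List β × α × τ := fun s => match s.1 with
    | [] => s
    | b :: m => (m, s.2.1, f s.2.1 s.2.2 b) with hstep
  have hs : PolyFn step := by
    refine listCases (f := fun s : List β × α × τ => s.1) (g := fun s => s)
      (h := fun s b m => (m, s.2.1, f s.2.1 s.2.2 b)) (by fun_prop) (by fun_prop) ?_
      (fun s hx => by simp only [hstep, hx]) (fun s b m hx => by simp only [hstep, hx])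
    exact (by fun_prop : PolyFn fun p : (β × List β) × List β × α × τ => p.1.2).pair
      ((by fun_prop : PolyFn fun p : (β × List β) × List β × α × τ => p.2.2.1).pair
        (hf.comp (by fun_prop : PolyFn fun p : (β × List β) × List β × α × τ =>
          ((p.2.2.1, p.2.2.2), p.1.1))))
  have key : ∀ x i, i ≤ (l x).length → step^[i] (l x, x, init x) =
      ((l x).drop i, x, ((l x).take i).foldl (f x) (init x)) := by
    intro x i
    induction i with
    | zero => simp
    | succ i ih =>
      intro hi
      rw [Function.iterate_succ_apply', ih (by omega)]
      have hd : (l x).drop i = (l x)[i] :: (l x).drop (i + 1) := List.drop_eq_getElem_cons hi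
      have ht : (l x).take (i + 1) = (l x).take i ++ [(l x)[i]] := List.take_succ_eq_append_getElem hi
      simp only [hstep, hd, ht, List.foldl_append, List.foldl_cons, List.foldl_nil]
  have hw : PolyFn fun x => (x, (l x).foldl (f x) (init x)) := by
    refine whileNonempty hs (hl.pair (id.pair hi)) (fun x => (l x).length)
      (fun x => size (l x) + (size x + B x + 1) + 1)
      (hl.polyBound_size.mono fun x => (length_lt_size _).le)
      ((hl.polyBound_size.add ((PolyBound.size.add hB).add (PolyBound.const 1))).add
        (PolyBound.const 1)) fun x => ⟨fun i hi => ?_, ?_, fun i hi => ?_⟩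
    · rw [key x i hi.le]
      simp only [ne_eq, List.drop_eq_nil_iff, not_le]
      exact hi
    · rw [key x _ le_rfl]
      simp
    · rw [key x i hi]
      have h1 := h x _ ((l x).take_prefix i)
      have h2 := size_le_of_sublist ((l x).drop_sublist i)
      simp only [size_pair]
      omega
  exact snd.comp hw

@[fun_prop]
theorem reverse {l : α → List β} (hl : PolyFn l) : PolyFn fun x => (l x).reverse := by
  refine (foldl (f := fun _ acc b => b :: acc) hl (const []) (by fun_prop) (fun x => size (l x))
    hl.polyBound_size fun x l' h' => ?_).congr fun x => ?_
  · rw [List.foldl_flip_cons_eq_append, List.append_nil, List.map_id', size_reverse]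
    exact size_le_of_sublist h'.sublist
  · rw [List.foldl_flip_cons_eq_append, List.append_nil, List.map_id']

theorem foldr {l : α → List β} {init : α → τ} {f : α → β → τ → τ} (hl : PolyFn l)
    (hi : PolyFn init) (hf : PolyFn fun p : (α × τ) × β => f p.1.1 p.2 p.1.2) (B : α → ℕ)
    (hB : PolyBound B) (h : ∀ x l', l' <:+ l x → size (l'.foldr (f x) (init x)) ≤ B x) :
    PolyFn fun x => (l x).foldr (f x) (init x) := by
  refine (foldl (f := fun x acc b => f x b acc) (reverse hl) hi hf B hB fun x l' h' => ?_).congr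
    fun x => ?_
  · have := h x l'.reverse (by simpa using List.reverse_suffix.2 h')
    rwa [List.foldr_reverse] at this
  · rw [List.foldl_reverse]

@[fun_prop]
theorem append {l m : α → List β} (hl : PolyFn l) (hm : PolyFn m) : PolyFn fun x => l x ++ m x := by
  refine (foldr (f := fun _ b acc => b :: acc) hl hm (by fun_prop) (fun x => size (l x) + size (m x))
    (hl.polyBound_size.add hm.polyBound_size) fun x l' h' => ?_).congr fun x => ?_
  · have h1 := size_le_of_sublist h'.sublist
    have h2 := size_append l' (m x)
    rw [List.foldr_cons_eq_append]
    simp only [List.map_id']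
    omega
  · simp

theorem map {l : α → List β} {f : α → β → γ} (hl : PolyFn l)
    (hf : PolyFn fun p : α × β => f p.1 p.2) : PolyFn fun x => (l x).map (f x) := by
  obtain ⟨t, ht, h⟩ := hf.polyBound_size.exists_of_size_le (PolyBound.size.add
    (hl.polyBound_size.add (PolyBound.const 1)))
  refine (foldr (f := fun x b acc => f x b :: acc) hl (const [])
    ((hf.comp (by fun_prop : PolyFn fun p : (α × List γ) × β => (p.1.1, p.2))).cons (by fun_prop))
    (fun x => size (l x) * (t x + 1) + 1)
    ((hl.polyBound_size.mul (ht.add (PolyBound.const 1))).add (PolyBound.const 1))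
    fun x l' h' => ?_).congr fun x => (List.foldr_cons_eq_append (l := l x) (f := f x) (l' := [])).trans
      (List.append_nil _) |>.symm
  rw [List.foldr_cons_eq_append, List.append_nil]
  refine (size_list_le (n := t x) fun c hc => ?_).trans ?_
  · obtain ⟨b, hb, rfl⟩ := List.mem_map.1 hc
    refine h x (x, b) ?_
    have := size_lt_of_mem (h'.subset hb)
    simp only [size_pair]
    omega
  · have h1 := (length_lt_size l').le.trans (size_le_of_sublist h'.sublist)
    rw [List.length_map]
    gcongr

theorem filter {l : α → List β} {f : α → β → Bool} (hl : PolyFn l)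
    (hf : PolyFn fun p : α × β => f p.1 p.2) : PolyFn fun x => (l x).filter (f x) := by
  have e : ∀ x (l' : List β), l'.foldr (fun b acc => bif f x b then b :: acc else acc) [] = l'.filter (f x) := by
    intro x l'
    induction l' with
    | nil => rfl
    | cons b l' ih => cases hb : f x b <;> simp [ih, hb]
  refine (foldr (f := fun x b acc => bif f x b then b :: acc else acc) hl (const [])
    (cond (hf.comp (by fun_prop : PolyFn fun p : (α × List β) × β => (p.1.1, p.2)))
      (by fun_prop) (by fun_prop))
    (fun x => size (l x)) hl.polyBound_size fun x l' h' => ?_).congr fun x => (e x _).symm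
  rw [e]
  exact size_le_of_sublist (List.filter_sublist.trans h'.sublist)

@[fun_prop]
theorem flatten {l : α → List (List β)} (hl : PolyFn l) : PolyFn fun x => (l x).flatten := by
  have e : ∀ l' : List (List β), l'.foldr (fun b acc => b ++ acc) [] = l'.flatten := by
    intro l'
    induction l' with
    | nil => rfl
    | cons b l' ih => simp [ih]
  refine (foldr (f := fun _ b acc => b ++ acc) hl (const []) (by fun_prop)
    (fun x => size (l x)) hl.polyBound_size fun x l' h' => ?_).congr fun x => (e _).symm
  rw [e]
  refine le_trans ?_ (size_le_of_sublist h'.sublist)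
  clear h'
  induction l' with
  | nil => simp
  | cons b l' ih =>
    have := size_append b l'.flatten
    simp only [List.flatten_cons, size_cons]
    omega

theorem flatMap {l : α → List β} {f : α → β → List γ} (hl : PolyFn l)
    (hf : PolyFn fun p : α × β => f p.1 p.2) : PolyFn fun x => (l x).flatMap (f x) :=
  (flatten (map hl hf)).congr fun _ => List.flatMap_def

theorem any {l : α → List β} {f : α → β → Bool} (hl : PolyFn l)
    (hf : PolyFn fun p : α × β => f p.1 p.2) : PolyFn fun x => (l x).any (f x) := by
  have e : ∀ x (l' : List β), l'.foldr (fun b acc => f x b || acc) false = l'.any (f x) := by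
    intro x l'
    induction l' with
    | nil => rfl
    | cons b l' ih => simp [ih]
  refine (foldr (f := fun x b acc => f x b || acc) hl (const false)
    (or (hf.comp (by fun_prop : PolyFn fun p : (α × Bool) × β => (p.1.1, p.2))) (by fun_prop))
    (fun x => 3) (PolyBound.const 3) fun x l' h' => size_bool_le _).congr fun x => (e x _).symm

/-- Dropping as many elements of a list as another list has. -/
theorem drop_length {l : α → List γ} {m : α → List β} (hl : PolyFn l) (hm : PolyFn m) :
    PolyFn fun x => (m x).drop (l x).length := by
  have e : ∀ (l' : List γ) (m' : List β), l'.foldl (fun acc _ => acc.tail) m' = m'.drop l'.length := by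
    intro l'
    induction l' with
    | nil => intro m'; rfl
    | cons b l' ih => intro m'; rw [List.foldl_cons, ih]; simp
  refine (foldl (f := fun _ acc _ => acc.tail) hl hm (by fun_prop)
    (fun x => size (m x)) hm.polyBound_size fun x l' h' => ?_).congr fun x => (e _ _).symm
  rw [e]
  exact size_le_of_sublist (List.drop_sublist _ _)

end PolyFn

/-! ### Equality tests -/

/-- Types with an equality test in polynomial time. -/
class PolyDecEq (α : Type) [Enc α] [DecidableEq α] : Prop where
  polyFn : PolyFn fun p : α × α => decide (p.1 = p.2)

theorem PolyFn.decideEq {α β : Type} [Enc α] [Enc β] [DecidableEq β] [PolyDecEq β] {f g : α → β}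
    (hf : PolyFn f) (hg : PolyFn g) : PolyFn fun x => decide (f x = g x) :=
  PolyDecEq.polyFn.comp (hf.pair hg)

instance : PolyDecEq Unit := ⟨(PolyFn.const true).congr fun _ => rfl⟩

instance : PolyDecEq Bool :=
  ⟨(by fun_prop : PolyFn fun p : Bool × Bool => !(Bool.xor p.1 p.2)).congr
    fun ⟨x, y⟩ => by cases x <;> cases y <;> rfl⟩

instance {α β : Type} [Enc α] [Enc β] [DecidableEq α] [DecidableEq β] [PolyDecEq α] [PolyDecEq β] :
    PolyDecEq (α × β) :=
  ⟨(PolyFn.and (PolyFn.decideEq (f := fun p : (α × β) × α × β => p.1.1) (g := fun p => p.2.1)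
      (by fun_prop) (by fun_prop))
    (PolyFn.decideEq (f := fun p : (α × β) × α × β => p.1.2) (g := fun p => p.2.2)
      (by fun_prop) (by fun_prop))).congr fun ⟨⟨_, _⟩, ⟨_, _⟩⟩ => by
        rw [← Bool.decide_and]; simp only [Prod.mk.injEq]⟩

/-- One pass over the first list consumes the second one and records whether all compared entries
agree. In the end the flag says that the first list is a prefix of the second; they are equal if
moreover nothing is left over. -/
instance {α : Type} [Enc α] [DecidableEq α] [PolyDecEq α] : PolyDecEq (List α) := by
  constructor
  set f : List α × Bool → α → List α × Bool := fun s b => match s.1 with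
    | [] => ([], false)
    | c :: m => (m, s.2 && decide (b = c)) with hf
  have hpf : PolyFn fun p : ((List α × List α) × List α × Bool) × α => f p.1.2 p.2 := by
    refine PolyFn.listCases (f := fun p : ((List α × List α) × List α × Bool) × α => p.1.2.1)
      (g := fun _ => ([], false)) (h := fun p c m => (m, p.1.2.2 && decide (p.2 = c)))
      (by fun_prop) (by fun_prop) ?_ (fun s hx => by simp only [hf, hx])
      (fun s b m hx => by simp only [hf, hx])
    exact PolyFn.pair (by fun_prop) (PolyFn.and (by fun_prop)
      (PolyFn.decideEq (by fun_prop) (by fun_prop)))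
  have e : ∀ (l m : List α) (b : Bool), l.foldl f (m, b) =
      (m.drop l.length, b && decide (l <+: m)) := by
    intro l
    induction l with
    | nil => simp
    | cons c l ih =>
      intro m b
      rcases m with _ | ⟨d, m⟩
      · rw [List.foldl_cons, show f ([], b) c = ([], false) from rfl, ih]; simp
      · simp only [List.foldl_cons]
        rw [show f (d :: m, b) c = (m, b && decide (c = d)) from rfl, ih]
        simp [List.cons_prefix_cons, Bool.and_assoc]
  have h := PolyFn.foldl (f := fun (_ : List α × List α) s b => f s b)
    (l := fun p : List α × List α => p.1) (init := fun p : List α × List α => (p.2, true))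
    (by fun_prop) (by fun_prop) hpf (fun p => size p + 4)
    (PolyBound.size.add (PolyBound.const 4)) fun p l' h' => by
      rw [e]
      have h1 := size_le_of_sublist (List.drop_sublist l'.length p.2)
      have h2 := size_bool_le (true && decide (l' <+: p.2))
      obtain ⟨p, q⟩ := p
      simp only [size_pair] at h1 h2 ⊢
      omega
  refine ((PolyFn.isEmpty (PolyFn.fst.comp h)).and (PolyFn.snd.comp h)).congr fun ⟨l, m⟩ => ?_
  rw [e]
  simp only [Bool.true_and]
  rw [Bool.eq_iff_iff]
  simp only [decide_eq_true_eq, Bool.and_eq_true, List.isEmpty_iff, List.drop_eq_nil_iff]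
  constructor
  · rintro rfl; simp
  · rintro ⟨h1, h2⟩; exact h2.eq_of_length_le h1

namespace PolyFn

variable {α β : Type} [Enc α] [Enc β] [DecidableEq β] [PolyDecEq β]

theorem contains {l : α → List β} {f : α → β} (hl : PolyFn l) (hf : PolyFn f) :
    PolyFn fun x => decide (f x ∈ l x) :=
  (any (f := fun x b => decide (f x = b)) hl (decideEq (by fun_prop) (by fun_prop))).congr fun x => by
    rw [Bool.eq_iff_iff]; simp

theorem dedup {l : α → List β} (hl : PolyFn l) : PolyFn fun x => (l x).dedup := by
  have e : ∀ l' : List β, l'.foldr (fun b acc => bif decide (b ∈ acc) then acc else b :: acc) [] =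
      l'.dedup := by
    intro l'
    induction l' with
    | nil => rfl
    | cons b l' ih =>
      rw [List.foldr_cons, ih, Bool.cond_decide]
      by_cases hb : b ∈ l'
      · rw [List.dedup_cons_of_mem hb, if_pos (List.mem_dedup.2 hb)]
      · rw [List.dedup_cons_of_notMem hb, if_neg (fun h => hb (List.mem_dedup.1 h))]
  refine (foldr (f := fun x b acc => bif decide (b ∈ acc) then acc else b :: acc) hl (const [])
    (cond (contains (by fun_prop) (by fun_prop)) (by fun_prop) (by fun_prop))
    (fun x => size (l x)) hl.polyBound_size fun x l' h' => ?_).congr fun x => (e _).symm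
  rw [e]
  exact size_le_of_sublist ((List.dedup_sublist _).trans h'.sublist)

end PolyFn

/-! ### Binary numbers -/

/-- Numbers are coded in binary, the least significant digit first, so the code of a number below `2
^ k` has length linear in `k`. Quantities that serve as loop lengths are kept in unary instead
(`un`). -/
instance : Enc ℕ := ⟨fun n => enc n.bits⟩

theorem size_nat (n : ℕ) : size n = size n.bits := rfl

theorem size_boolList_le (l : List Bool) : size l ≤ 4 * l.length + 1 := by
  have := size_list_le (l := l) (n := 3) fun b _ => size_bool_le b
  omega

theorem size_nat_le {n k : ℕ} (h : n < 2 ^ k) : size n ≤ 4 * k + 1 := by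
  have h1 := size_boolList_le n.bits
  have h2 := Nat.size_le.2 h
  rw [← Nat.size_eq_bits_len] at h2
  rw [size_nat]
  omega

theorem lt_two_pow_size (n : ℕ) : n < 2 ^ size n := by
  have h1 := length_lt_size n.bits
  exact Nat.size_le.1 ((Nat.size_eq_bits_len n).ge.trans h1.le)

theorem size_nat_mono {m n : ℕ} (h : m ≤ n) : size m ≤ 4 * size n + 1 :=
  size_nat_le (h.trans_lt (lt_two_pow_size n))

/-- The number with given binary digits, the least significant digit first. -/
def ofBitList (l : List Bool) : ℕ := l.foldr Nat.bit 0

theorem ofBitList_bits (n : ℕ) : ofBitList n.bits = n := by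
  induction n using Nat.binaryRec' with
  | zero => simp [ofBitList]
  | bit b n h ih =>
    rw [Nat.bits_append_bit n b h, ofBitList, List.foldr_cons]
    exact congrArg _ ih

theorem ofBitList_lt (l : List Bool) : ofBitList l < 2 ^ l.length := by
  induction l with
  | nil => simp [ofBitList]
  | cons b l ih =>
    have : ofBitList (b :: l) = 2 * ofBitList l + b.toNat := Nat.bit_val b (ofBitList l)
    rw [this, List.length_cons, pow_succ]
    have := Bool.toNat_le b
    omega

/-- Connects the digits used by the algorithm with those prescribed for the output. -/
theorem encodeNat_eq_bits (n : ℕ) : Computability.encodeNat n = n.bits := by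
  have h1 : ∀ p : PosNum, Computability.encodePosNum p = (p : ℕ).bits := by
    intro p
    induction p with
    | one => simp [Computability.encodePosNum]
    | bit0 p ih =>
      rw [Computability.encodePosNum, ih, PosNum.cast_bit0, ← two_mul,
        Nat.bit0_bits _ (PosNum.cast_pos p).ne']
    | bit1 p ih =>
      rw [Computability.encodePosNum, ih, PosNum.cast_bit1, ← two_mul, Nat.bit1_bits]
  unfold Computability.encodeNat
  conv_rhs => rw [← Num.to_of_nat n]
  rcases (n : Num) with _ | p
  · simp [Computability.encodeNum]
  · exact h1 p

namespace PolyFn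

variable {α β : Type} [Enc α] [Enc β]

theorem bits {f : α → ℕ} (hf : PolyFn f) : PolyFn fun x => (f x).bits :=
  (of_enc_eq (f := Nat.bits) fun _ => rfl).comp hf

theorem of_bits {f : α → ℕ} (hf : PolyFn fun x => (f x).bits) : PolyFn f := hf

@[fun_prop]
theorem div2 {f : α → ℕ} (hf : PolyFn f) : PolyFn fun x => (f x).div2 :=
  of_bits ((tail hf.bits).congr fun _ => Nat.div2_bits_eq_tail _)

@[fun_prop]
theorem bodd {f : α → ℕ} (hf : PolyFn f) : PolyFn fun x => (f x).bodd :=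
  (headD hf.bits false).congr fun x => by
    rw [Nat.bodd_eq_bits_head]
    cases (f x).bits <;> rfl

@[fun_prop]
theorem bit {c : α → Bool} {f : α → ℕ} (hc : PolyFn c) (hf : PolyFn f) :
    PolyFn fun x => Nat.bit (c x) (f x) := by
  -- The digits of 0 are the empty list, so a digit `false` must not be put in front of them.
  refine of_bits ((cond (c := fun x => (f x).bits.isEmpty && !(c x)) (and (isEmpty hf.bits) hc.not)
    (const []) (hc.cons hf.bits)).congr fun x => ?_)
  have hz : (f x).bits = [] ↔ f x = 0 := by
    constructor
    · intro h
      rw [← ofBitList_bits (f x), h]; rfl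
    · intro h; rw [h, Nat.zero_bits]
  by_cases h : f x = 0
  · rw [h]
    cases c x <;> simp
  · have h0 : (f x).bits.isEmpty = false := by
      rw [Bool.eq_false_iff, Ne, List.isEmpty_iff, hz]; exact h
    rw [Nat.bits_append_bit _ _ fun h' => absurd h' h, h0]
    rfl

theorem ofBitList {l : α → List Bool} (hl : PolyFn l) : PolyFn fun x => ofBitList (l x) :=
  foldr (f := fun _ b n => Nat.bit b n) hl (const 0) (by fun_prop) (fun x => 4 * size (l x) + 1)
    (((PolyBound.const 4).mul hl.polyBound_size).add (PolyBound.const 1)) fun x l' h' => by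
      refine (size_nat_le (ofBitList_lt l')).trans ?_
      have := (length_lt_size l').le.trans (size_le_of_sublist h'.sublist)
      omega

end PolyFn

/-- One step of binary addition: the state consists of the carry, the remaining summands and the
digits of the sum, the most significant digit first. -/
def addStep (s : (Bool × ℕ × ℕ) × List Bool) : (Bool × ℕ × ℕ) × List Bool :=
  ((bif s.1.1 then s.1.2.1.bodd || s.1.2.2.bodd else s.1.2.1.bodd && s.1.2.2.bodd,
    s.1.2.1.div2, s.1.2.2.div2), Bool.xor s.1.1 (Bool.xor s.1.2.1.bodd s.1.2.2.bodd) :: s.2)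

theorem ofBitList_append (l m : List Bool) :
    ofBitList (l ++ m) = ofBitList l + 2 ^ l.length * ofBitList m := by
  have e : ∀ b (l : List Bool), ofBitList (b :: l) = 2 * ofBitList l + b.toNat := fun b l =>
    Nat.bit_val b (ofBitList l)
  induction l with
  | nil => simp [ofBitList]
  | cons b l ih =>
    rw [List.cons_append, e, e, ih, List.length_cons, pow_succ]
    ring

/-- The invariant of addition: the digits produced so far, plus the carry and the remaining summands
at the current place value. -/
theorem addStep_value (s : (Bool × ℕ × ℕ) × List Bool) :
    ofBitList (addStep s).2.reverse + 2 ^ (addStep s).2.length *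
      ((addStep s).1.1.toNat + (addStep s).1.2.1 + (addStep s).1.2.2) =
    ofBitList s.2.reverse + 2 ^ s.2.length * (s.1.1.toNat + s.1.2.1 + s.1.2.2) := by
  obtain ⟨⟨c, x, y⟩, l⟩ := s
  simp only [addStep, List.reverse_cons, ofBitList_append, List.length_reverse, List.length_cons,
    pow_succ]
  have hx := Nat.bodd_add_div2 x
  have hy := Nat.bodd_add_div2 y
  have h1 : ∀ b, FDShapley.ofBitList [b] = b.toNat := fun b => by cases b <;> rfl
  rw [h1]
  conv_rhs => rw [← hx, ← hy]
  generalize x.div2 = x'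
  generalize y.div2 = y'
  cases c <;> cases x.bodd <;> cases y.bodd <;> simp <;> ring

theorem foldl_addStep {β : Type} (l : List β) (s : (Bool × ℕ × ℕ) × List Bool) :
    let r := l.foldl (fun s _ => addStep s) s
    ofBitList r.2.reverse + 2 ^ r.2.length * (r.1.1.toNat + r.1.2.1 + r.1.2.2) =
      ofBitList s.2.reverse + 2 ^ s.2.length * (s.1.1.toNat + s.1.2.1 + s.1.2.2) ∧
    r.2.length = s.2.length + l.length ∧ r.1.2.1 ≤ s.1.2.1 ∧ r.1.2.2 ≤ s.1.2.2 := by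
  induction l generalizing s with
  | nil => simp
  | cons b l ih =>
    obtain ⟨h1, h2, h3, h4⟩ := ih (addStep s)
    refine ⟨h1.trans (addStep_value s), ?_, h3.trans ?_, h4.trans ?_⟩
    · rw [List.foldl_cons, h2]
      simp [addStep]; ring
    · simp only [addStep, Nat.div2_val]; omega
    · simp only [addStep, Nat.div2_val]; omega

/-- Only the length of the folded list matters: it provides so many rounds, including one for the
last carry, that the place value exceeds `x + y`. By the invariant, carry and remaining summands
must then be 0. -/
theorem ofBitList_foldl_addStep (x y : ℕ) :
    ofBitList ((x.bits ++ y.bits ++ [true]).foldl (fun s _ => addStep s)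
      ((false, x, y), [])).2.reverse = x + y := by
  obtain ⟨h1, h2, -, -⟩ := foldl_addStep (x.bits ++ y.bits ++ [true]) ((false, x, y), [])
  set r := (x.bits ++ y.bits ++ [true]).foldl (fun s _ => addStep s) ((false, x, y), [])
  simp only [List.reverse_nil, List.length_nil, pow_zero, Bool.toNat_false, zero_add, one_mul] at h1 h2
  rw [show ofBitList [] = 0 from rfl, zero_add] at h1
  have hx : x < 2 ^ x.bits.length := by rw [Nat.size_eq_bits_len]; exact Nat.lt_size_self x
  have hy : y < 2 ^ y.bits.length := by rw [Nat.size_eq_bits_len]; exact Nat.lt_size_self y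
  have hlt : x + y < 2 ^ r.2.length := by
    rw [h2, List.length_append, List.length_append, List.length_singleton, pow_succ]
    have h3 : 2 ^ x.bits.length ≤ 2 ^ (x.bits.length + y.bits.length) :=
      Nat.pow_le_pow_right (by norm_num) (by omega)
    have h4 : 2 ^ y.bits.length ≤ 2 ^ (x.bits.length + y.bits.length) :=
      Nat.pow_le_pow_right (by norm_num) (by omega)
    omega
  have h0 : r.1.1.toNat + r.1.2.1 + r.1.2.2 = 0 := by
    by_contra h
    have : 2 ^ r.2.length * 1 ≤ 2 ^ r.2.length * (r.1.1.toNat + r.1.2.1 + r.1.2.2) :=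
      Nat.mul_le_mul_left _ (Nat.pos_of_ne_zero h)
    omega
  rw [h0] at h1
  simpa using h1

namespace PolyFn

variable {α β : Type} [Enc α] [Enc β]

@[fun_prop]
theorem add {f g : α → ℕ} (hf : PolyFn f) (hg : PolyFn g) : PolyFn fun x => f x + g x := by
  have h : PolyFn fun p : ℕ × ℕ => p.1 + p.2 := by
    have hc : PolyFn fun p : ℕ × ℕ => p.1.bits ++ p.2.bits ++ [true] :=
      ((bits fst).append (bits snd)).append (const _)
    refine (ofBitList (reverse (snd.comp (foldl (f := fun _ s _ => addStep s) hc
      (init := fun p : ℕ × ℕ => ((false, p.1, p.2), []))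
      (by fun_prop) (by unfold addStep; fun_prop)
      (fun p => 3 + (4 * size p + 1 + (4 * size p + 1) + 1) + 1 + (4 * size (p.1.bits ++ p.2.bits ++ [true]) + 1) + 1)
      ?_ fun p l' h' => ?_)))).congr fun p => (ofBitList_foldl_addStep p.1 p.2).symm
    · have h1 : PolyBound fun p : ℕ × ℕ => 4 * size p + 1 :=
        ((PolyBound.const 4).mul PolyBound.size).add (PolyBound.const 1)
      exact ((((PolyBound.const 3).add ((h1.add h1).add (PolyBound.const 1))).add (PolyBound.const 1)).add
        (((PolyBound.const 4).mul hc.polyBound_size).add (PolyBound.const 1))).add (PolyBound.const 1)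
    · obtain ⟨-, h2, h3, h4⟩ := foldl_addStep l' ((false, p.1, p.2), [])
      generalize l'.foldl (fun s _ => addStep s) ((false, p.1, p.2), []) = r at h2 h3 h4 ⊢
      obtain ⟨⟨c, x, y⟩, m⟩ := r
      have h5 := size_boolList_le m
      have h6 := (length_lt_size l').le.trans (size_le_of_sublist h'.sublist)
      have h7 := size_nat_mono h3
      have h8 := size_nat_mono h4
      have h9 := size_bool_le c
      obtain ⟨p, q⟩ := p
      simp only [size_pair, List.length_nil] at *
      omega
  exact h.comp (hf.pair hg)

@[fun_prop]
-- Horner's scheme from the most significant digit. The accumulators are products of `g x` with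
-- numbers given by leading digits of `f x`, which bounds them.
theorem mul {f g : α → ℕ} (hf : PolyFn f) (hg : PolyFn g) : PolyFn fun x => f x * g x := by
  have e : ∀ (y : ℕ) (l : List Bool), l.foldr (fun b acc => (bif b then y else 0) + (acc + acc)) 0 =
      FDShapley.ofBitList l * y := by
    intro y l
    induction l with
    | nil => simp [FDShapley.ofBitList]
    | cons b l ih =>
      have : FDShapley.ofBitList (b :: l) = 2 * FDShapley.ofBitList l + b.toNat :=
        Nat.bit_val b (FDShapley.ofBitList l)
      rw [List.foldr_cons, ih, this]
      cases b <;> simp <;> ring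
  refine (foldr (f := fun x b acc => (bif b then g x else 0) + (acc + acc)) (l := fun x => (f x).bits)
    (init := fun _ => 0) hf.bits (const 0)
    (add (cond (by fun_prop) (hg.comp (by fun_prop)) (by fun_prop)) (by fun_prop))
    (fun x => 4 * (size (f x) + size (g x)) + 1)
    (((PolyBound.const 4).mul (hf.polyBound_size.add hg.polyBound_size)).add (PolyBound.const 1))
    fun x l' h' => ?_).congr fun x => by rw [e, ofBitList_bits]
  rw [e]
  refine size_nat_le ?_
  rw [pow_add]
  refine Nat.mul_lt_mul'' ((ofBitList_lt l').trans_le (Nat.pow_le_pow_right (by norm_num) ?_))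
    (lt_two_pow_size _)
  exact (length_lt_size l').le.trans (size_le_of_sublist h'.sublist)

@[fun_prop]
theorem sum {l : α → List ℕ} (hl : PolyFn l) : PolyFn fun x => (l x).sum := by
  refine foldr (f := fun _ b acc => b + acc) (init := fun _ => 0) hl (const 0) (by fun_prop)
    (fun x => 4 * size (l x) + 1)
    (((PolyBound.const 4).mul hl.polyBound_size).add (PolyBound.const 1)) fun x l' h' => ?_
  change size l'.sum ≤ _
  refine (size_nat_le (k := size l') ?_).trans ?_
  · clear h'
    induction l' with
    | nil => simp
    | cons b l' ih =>
      rw [List.sum_cons, size_cons, pow_succ, pow_add]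
      have h1 := lt_two_pow_size b
      have h2 : 1 ≤ 2 ^ size b := Nat.one_le_two_pow
      have h3 : 1 ≤ 2 ^ size l' := Nat.one_le_two_pow
      nlinarith
  · have := size_le_of_sublist h'.sublist
    omega

/-- The argument is given in unary, as a list; `n! ≤ n ^ n` shows that the result has polynomially
many digits. -/
theorem factorial_length {l : α → List β} (hl : PolyFn l) : PolyFn fun x => (l x).length.factorial := by
  have e : ∀ l' : List β, l'.foldl (fun s _ => (s.1 + 1, s.2 * (s.1 + 1))) (0, 1) =
      (l'.length, l'.length.factorial) := by
    intro l'
    induction l' using List.reverseRecOn with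
    | nil => rfl
    | append_singleton l' b ih =>
      rw [List.foldl_append, ih]
      simp [Nat.factorial_succ, Nat.mul_comm]
  refine (snd.comp (foldl (f := fun _ s _ => (s.1 + 1, s.2 * (s.1 + 1))) (init := fun _ => (0, 1)) hl
    (const (0, 1)) (by fun_prop)
    (fun x => (4 * size (l x) + 1) + (4 * (size (l x) * size (l x) + 1) + 1) + 1) ?_
    fun x l' h' => ?_)).congr fun x => by rw [e]
  · have h1 := hl.polyBound_size
    exact ((((PolyBound.const 4).mul h1).add (PolyBound.const 1)).add
      (((PolyBound.const 4).mul ((h1.mul h1).add (PolyBound.const 1))).add (PolyBound.const 1))).add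
      (PolyBound.const 1)
  · rw [e, size_pair]
    have h1 := (length_lt_size l').le.trans (size_le_of_sublist h'.sublist)
    have h2 : size l'.length ≤ 4 * size (l x) + 1 :=
      size_nat_le (lt_of_le_of_lt h1 Nat.lt_two_pow_self)
    have h3 : size l'.length.factorial ≤ 4 * (size (l x) * size (l x) + 1) + 1 := by
      refine size_nat_le (lt_of_le_of_lt (Nat.factorial_le_pow _) ?_)
      calc l'.length ^ l'.length ≤ (2 ^ size (l x)) ^ size (l x) :=
            (Nat.pow_le_pow_left (h1.trans Nat.lt_two_pow_self.le) _).trans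
              (Nat.pow_le_pow_right Nat.one_le_two_pow h1)
        _ = 2 ^ (size (l x) * size (l x)) := (pow_mul _ _ _).symm
        _ < 2 ^ (size (l x) * size (l x) + 1) := Nat.pow_lt_pow_right (by norm_num) (by omega)
    omega

end PolyFn

/-! ### Histograms -/

/-- Unary numbers. -/
def un (n : ℕ) : List Unit := List.replicate n ()

@[simp] theorem length_un (n : ℕ) : (un n).length = n := List.length_replicate

theorem un_length (l : List Unit) : un l.length = l :=
  (List.eq_replicate_iff.2 ⟨rfl, fun _ _ => rfl⟩).symm

theorem un_inj {m n : ℕ} : un m = un n ↔ m = n :=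
  ⟨fun h => by simpa using congrArg List.length h, fun h => by rw [h]⟩

/-- Triples of unary numbers. -/
abbrev Key : Type := List Unit × List Unit × List Unit

/-- The triple of the unary numbers `a`, `b`, `c`. -/
def key (a b c : ℕ) : Key := (un a, un b, un c)

/-- Histograms: lists of keys with multiplicities. -/
abbrev Hist : Type := List (Key × ℕ)

/-- The maximum of two unary numbers. -/
def umax (a b : List Unit) : List Unit := a ++ b.drop a.length

/-- The sum of two keys, where `m` tells whether the last two components are combined by
maximum. -/
def keyOp (m : Bool) (k l : Key) : Key :=
  (k.1 ++ l.1, bif m then (umax k.2.1 l.2.1, umax k.2.2 l.2.2) else (k.2.1 ++ l.2.1, k.2.2 ++ l.2.2))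

/-- Sum or maximum of two numbers. -/
def natOp (m : Bool) (a b : ℕ) : ℕ := bif m then max a b else a + b

theorem keyOp_key (m : Bool) (a b c a' b' c' : ℕ) :
    keyOp m (key a b c) (key a' b' c') = key (a + a') (natOp m b b') (natOp m c c') := by
  have h : ∀ a b, un a ++ un b = un (a + b) := fun a b => by
    rw [← un_length (un a ++ un b)]; simp
  have h' : ∀ a b, umax (un a) (un b) = un (max a b) := fun a b => by
    rw [← un_length (umax (un a) (un b))]
    unfold umax
    simp only [List.length_append, length_un, List.length_drop]
    congr 1; omega
  cases m <;> simp [keyOp, key, natOp, h, h']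

/-- The total value of the weight `w` on a histogram. -/
def ev (d : Hist) (w : Key → ℕ) : ℕ := (d.map fun e => e.2 * w e.1).sum

theorem ev_cons (e : Key × ℕ) (d : Hist) (w : Key → ℕ) : ev (e :: d) w = e.2 * w e.1 + ev d w := by
  simp [ev]

theorem ev_append (d d' : Hist) (w : Key → ℕ) : ev (d ++ d') w = ev d w + ev d' w := by
  simp [ev]

/-- Add a key with multiplicity to a histogram. -/
def insertEntry (e : Key × ℕ) (d : Hist) : Hist :=
  bif d.any fun e' => decide (e'.1 = e.1) then
    d.map fun e' => (e'.1, e'.2 + bif decide (e'.1 = e.1) then e.2 else 0)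
  else e :: d

/-- Collect equal keys. -/
def normalize (d : Hist) : Hist := d.foldr insertEntry []

/-- The product of two histograms. -/
def combine (m : Bool) (d d' : Hist) : Hist :=
  normalize (d.flatMap fun e => d'.map fun e' => (keyOp m e.1 e'.1, e.2 * e'.2))

theorem keys_insertEntry (e : Key × ℕ) (d : Hist) : (insertEntry e d).map Prod.fst =
    if e.1 ∈ d.map Prod.fst then d.map Prod.fst else e.1 :: d.map Prod.fst := by
  unfold insertEntry
  by_cases h : e.1 ∈ d.map Prod.fst
  · have h' : (d.any fun e' => decide (e'.1 = e.1)) = true := by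
      obtain ⟨e', he', h⟩ := List.mem_map.1 h
      exact List.any_eq_true.2 ⟨e', he', by simpa using h⟩
    rw [if_pos h, h', cond_true, List.map_map]
    rfl
  · have h' : (d.any fun e' => decide (e'.1 = e.1)) = false := by
      rw [List.any_eq_false]
      intro e' he' h''
      exact h (List.mem_map.2 ⟨e', he', by simpa using h''⟩)
    rw [if_neg h, h', cond_false, List.map_cons]

theorem nodup_normalize (d : Hist) : ((normalize d).map Prod.fst).Nodup := by
  induction d with
  | nil => exact List.nodup_nil
  | cons e d ih =>
    change ((insertEntry e (normalize d)).map Prod.fst).Nodup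
    rw [keys_insertEntry]
    split_ifs with h
    · exact ih
    · exact List.nodup_cons.2 ⟨h, ih⟩

theorem keys_normalize (d : Hist) (k : Key) : k ∈ (normalize d).map Prod.fst ↔ k ∈ d.map Prod.fst := by
  induction d with
  | nil => rfl
  | cons e d ih =>
    change k ∈ (insertEntry e (normalize d)).map Prod.fst ↔ _
    rw [keys_insertEntry, List.map_cons, List.mem_cons, ← ih]
    split_ifs with h
    · constructor
      · exact Or.inr
      · rintro (rfl | h')
        · exact h
        · exact h'
    · rw [List.mem_cons]

/-- Distinct keys are essential: `insertEntry` adds the multiplicity at every entry with the key, so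
there must be only one. -/
theorem ev_insertEntry (e : Key × ℕ) (d : Hist) (hd : (d.map Prod.fst).Nodup) (w : Key → ℕ) :
    ev (insertEntry e d) w = e.2 * w e.1 + ev d w := by
  have hno : ∀ d : Hist, e.1 ∉ d.map Prod.fst →
      (d.map fun e' => (e'.1, e'.2 + bif decide (e'.1 = e.1) then e.2 else 0)) = d := by
    intro d h
    refine (List.map_congr_left fun e' he' => ?_).trans (List.map_id d)
    have : e'.1 ≠ e.1 := fun h' => h (List.mem_map.2 ⟨e', he', h'⟩)
    simp [this]
  unfold insertEntry
  cases h : d.any fun e' => decide (e'.1 = e.1)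
  · rw [cond_false, ev_cons]
  · rw [cond_true]
    induction d with
    | nil => simp at h
    | cons f d ih =>
      rw [List.map_cons, List.nodup_cons] at hd
      rw [List.map_cons, ev_cons, ev_cons]
      by_cases hf : f.1 = e.1
      · rw [hno d (hf ▸ hd.1)]
        simp only [hf, decide_true, cond_true]
        ring
      · have h' : (d.any fun e' => decide (e'.1 = e.1)) = true := by simpa [hf] using h
        rw [ih hd.2 h']
        simp only [hf, decide_false, cond_false]
        ring

theorem ev_normalize (d : Hist) (w : Key → ℕ) : ev (normalize d) w = ev d w := by
  induction d with
  | nil => rfl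
  | cons e d ih =>
    change ev (insertEntry e (normalize d)) w = _
    rw [ev_insertEntry _ _ (nodup_normalize d), ih, ev_cons]

/-- Testing histograms against all weights hides the order and grouping of entries, and turns the
product of histograms into an iterated sum, as for a convolution of measures. -/
theorem ev_combine (m : Bool) (d d' : Hist) (w : Key → ℕ) :
    ev (combine m d d') w = ev d fun k => ev d' fun k' => w (keyOp m k k') := by
  unfold combine
  rw [ev_normalize]
  induction d with
  | nil => rfl
  | cons e d ih =>
    rw [List.flatMap_cons, ev_append, ih, ev_cons]
    congr 1
    unfold ev
    rw [List.map_map, ← List.sum_map_mul_left]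
    congr 1
    refine List.map_congr_left fun e' _ => ?_
    simp only [comp_apply]
    ring

theorem le_ev_of_mem {d : Hist} {e : Key × ℕ} (h : e ∈ d) : e.2 ≤ ev d fun _ => 1 := by
  have : e.2 * 1 ∈ d.map fun e => e.2 * 1 := List.mem_map.2 ⟨e, h, rfl⟩
  simpa [ev] using List.le_sum_of_mem this

/-- The keys are distinct triples of numbers at most `n`, the total multiplicity is at most
`2 ^ n`. -/
structure Hist.Good (d : Hist) (n : ℕ) : Prop where
  nodup : (d.map Prod.fst).Nodup
  le : ∀ k ∈ d.map Prod.fst, k.1.length ≤ n ∧ k.2.1.length ≤ n ∧ k.2.2.length ≤ n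
  total : (ev d fun _ => 1) ≤ 2 ^ n

theorem keyOp_le {m : Bool} {k l : Key} {a b : ℕ}
    (hk : k.1.length ≤ a ∧ k.2.1.length ≤ a ∧ k.2.2.length ≤ a)
    (hl : l.1.length ≤ b ∧ l.2.1.length ≤ b ∧ l.2.2.length ≤ b) :
    (keyOp m k l).1.length ≤ a + b ∧ (keyOp m k l).2.1.length ≤ a + b ∧
      (keyOp m k l).2.2.length ≤ a + b := by
  cases m <;> simp [keyOp, umax] <;> omega

theorem Hist.Good.combine {d d' : Hist} {a b : ℕ} (hd : d.Good a) (hd' : d'.Good b) (m : Bool) :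
    (combine m d d').Good (a + b) where
  nodup := nodup_normalize _
  le k hk := by
    unfold FDShapley.combine at hk
    rw [keys_normalize] at hk
    obtain ⟨x, hx, rfl⟩ := List.mem_map.1 hk
    obtain ⟨e, he, hx⟩ := List.mem_flatMap.1 hx
    obtain ⟨e', he', rfl⟩ := List.mem_map.1 hx
    exact keyOp_le (hd.le _ (List.mem_map_of_mem he)) (hd'.le _ (List.mem_map_of_mem he'))
  total := by
    rw [ev_combine, pow_add]
    have : (ev d fun _ => ev d' fun _ => 1) = (ev d fun _ => 1) * ev d' fun _ => 1 := by
      conv_lhs => unfold ev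
      conv_rhs => enter [1]; unfold ev
      rw [← List.sum_map_mul_right]
      simp [ev]
    rw [this]
    exact Nat.mul_le_mul hd.total hd'.total

/-- The product of a list of histograms. -/
def combineAll (m : Bool) (ds : List Hist) : Hist := ds.foldr (combine m) [(key 0 0 0, 1)]

/-- The parameters of the factors add up. Since the groups of a list partition it, the parameter of
a histogram never exceeds the number of facts, however deep the recursion. -/
theorem good_combineAll {β : Type} (m : Bool) (l : List β) (D : β → Hist) (n : β → ℕ)
    (h : ∀ b ∈ l, (D b).Good (n b)) : (combineAll m (l.map D)).Good (l.map n).sum := by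
  induction l with
  | nil =>
    refine ⟨by simp [combineAll], ?_, by simp [combineAll, ev]⟩
    intro k hk
    simp only [combineAll, List.map_nil, List.foldr_nil, List.map_cons, List.mem_singleton] at hk
    subst hk
    simp [key]
  | cons b l ih =>
    rw [List.map_cons, List.map_cons, List.sum_cons]
    exact (h b List.mem_cons_self).combine (ih fun c hc => h c (List.mem_cons_of_mem _ hc)) m

theorem Hist.Good.mono {d : Hist} {a b : ℕ} (hd : d.Good a) (h : a ≤ b) : d.Good b :=
  ⟨hd.nodup, fun k hk => by have := hd.le k hk; omega,
    hd.total.trans (Nat.pow_le_pow_right (by norm_num) h)⟩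

theorem size_un (l : List Unit) : size l = 2 * l.length + 1 := by
  induction l with
  | nil => rfl
  | cons x l ih =>
    rw [size_cons, ih, List.length_cons]
    have : size x = 1 := rfl
    omega

theorem size_entry_le {e : Key × ℕ} {a b : ℕ}
    (h : e.1.1.length ≤ a ∧ e.1.2.1.length ≤ a ∧ e.1.2.2.length ≤ a) (h' : e.2 < 2 ^ b) :
    size e ≤ 6 * a + 4 * b + 7 := by
  obtain ⟨⟨x, y, z⟩, c⟩ := e
  have := size_nat_le h'
  simp only [size_pair, size_un] at *
  omega

theorem Hist.Good.length_le {d : Hist} {n : ℕ} (hd : d.Good n) : d.length ≤ (n + 1) ^ 3 := by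
  have h1 : ((d.map Prod.fst).map fun k : Key => (k.1.length, k.2.1.length, k.2.2.length)).Nodup := by
    refine hd.nodup.map ?_
    rintro ⟨x, y, z⟩ ⟨x', y', z'⟩ h
    simp only [Prod.mk.injEq] at h
    rw [← un_length x, ← un_length y, ← un_length z, h.1, h.2.1, h.2.2]
    simp [un_length]
  have h2 := (List.toFinset_card_of_nodup h1).symm
  simp only [List.length_map] at h2
  rw [h2]
  refine (Finset.card_le_card (t := Finset.range (n + 1) ×ˢ Finset.range (n + 1) ×ˢ Finset.range (n + 1))
    fun x hx => ?_).trans (by simp [pow_succ, mul_assoc])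
  obtain ⟨k, hk, rfl⟩ := List.mem_map.1 (List.mem_toFinset.1 hx)
  have := hd.le k hk
  simp only [Finset.mem_product, Finset.mem_range]
  omega

/-- A bound for the size of a good histogram. -/
def histSize (n : ℕ) : ℕ := (n + 1) * ((n + 1) * (n + 1)) * (6 * n + 4 * (n + 1) + 7 + 1) + 1

theorem Hist.Good.size_le {d : Hist} {n : ℕ} (hd : d.Good n) : size d ≤ histSize n := by
  refine (size_list_le (n := 6 * n + 4 * (n + 1) + 7) fun e he => size_entry_le
    (hd.le _ (List.mem_map_of_mem he)) ?_).trans ?_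
  · refine ((le_ev_of_mem he).trans hd.total).trans_lt (Nat.pow_lt_pow_right (by norm_num) (by omega))
  · have := hd.length_le
    unfold histSize
    refine Nat.add_le_add_right (Nat.mul_le_mul_right _ ?_) 1
    calc d.length ≤ (n + 1) ^ 3 := this
      _ = _ := by ring

/-- Holds for arbitrary histograms, as needed for the uncollected product in `combine`: there are no
more entries than before, no new keys, and every multiplicity is at most the old total, which is
below `2 ^ size d`. -/
theorem size_normalize_le (d : Hist) : size (normalize d) ≤ size d * (10 * size d + 8) + 1 := by
  have hev : (ev d fun _ => 1) < 2 ^ size d := by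
    induction d with
    | nil => simp [ev]
    | cons e d ih =>
      rw [ev_cons, size_cons, pow_succ, pow_add]
      have h0 : size e.2 ≤ size e := by
        have := size_pair e.1 e.2
        simp only [Prod.mk.eta] at this
        omega
      have h1 := (lt_two_pow_size e.2).trans_le (Nat.pow_le_pow_right (by norm_num) h0)
      have h2 : 1 ≤ 2 ^ size e := Nat.one_le_two_pow
      have h3 : 1 ≤ 2 ^ size d := Nat.one_le_two_pow
      nlinarith
  have hlen : (normalize d).length ≤ d.length := by
    clear hev
    induction d with
    | nil => exact le_rfl
    | cons e d ih =>
      have := congrArg List.length (keys_insertEntry e (normalize d))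
      change (insertEntry e (normalize d)).length ≤ d.length + 1
      rw [List.length_map] at this
      rw [this]
      split_ifs <;> simp <;> omega
  refine (size_list_le (n := 6 * size d + 4 * size d + 7) fun e he => size_entry_le ?_ ?_).trans ?_
  · have := (keys_normalize d e.1).1 (List.mem_map_of_mem he)
    obtain ⟨e', he', h⟩ := List.mem_map.1 this
    have h1 := size_lt_of_mem he'
    rw [← h]
    obtain ⟨⟨x, y, z⟩, c⟩ := e'
    simp only [size_pair, size_un] at *
    omega
  · exact ((le_ev_of_mem he).trans (ev_normalize d _).le).trans_lt hev
  · have := hlen.trans (length_lt_size d).le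
    refine Nat.add_le_add_right (Nat.mul_le_mul this ?_) 1
    omega

namespace PolyFn

variable {α β : Type} [Enc α] [Enc β]

@[fun_prop]
theorem keyOp (m : Bool) {k l : α → Key} (hk : PolyFn k) (hl : PolyFn l) :
    PolyFn fun x => keyOp m (k x) (l x) := by
  have h : PolyFn fun p : List Unit × List Unit => umax p.1 p.2 :=
    append fst (drop_length fst snd)
  have h' : ∀ {f g : α → List Unit}, PolyFn f → PolyFn g → PolyFn fun x => umax (f x) (g x) :=
    fun hf hg => h.comp (hf.pair hg)
  unfold FDShapley.keyOp
  cases m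
  · simp only [cond_false]
    fun_prop
  · simp only [cond_true]
    exact pair (by fun_prop) (pair (h' (by fun_prop) (by fun_prop)) (h' (by fun_prop) (by fun_prop)))

theorem insertEntry {e : α → Key × ℕ} {d : α → Hist} (he : PolyFn e) (hd : PolyFn d) :
    PolyFn fun x => insertEntry (e x) (d x) := by
  have h : PolyFn fun p : (Key × ℕ) × Hist => FDShapley.insertEntry p.1 p.2 := by
    unfold FDShapley.insertEntry
    refine cond (any (f := fun (p : (Key × ℕ) × Hist) (e' : Key × ℕ) => decide (e'.1 = p.1.1)) snd (decideEq (by fun_prop) (by fun_prop)))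
      (map (f := fun (p : (Key × ℕ) × Hist) (e' : Key × ℕ) => (e'.1, e'.2 + bif decide (e'.1 = p.1.1) then p.1.2 else 0)) snd ?_)
      (by fun_prop)
    exact pair (by fun_prop) (add (by fun_prop)
      (cond (decideEq (by fun_prop) (by fun_prop)) (by fun_prop) (by fun_prop)))
  exact h.comp (he.pair hd)

theorem normalize {d : α → Hist} (hd : PolyFn d) : PolyFn fun x => normalize (d x) := by
  refine foldr (f := fun _ e d => FDShapley.insertEntry e d) (init := fun _ => []) hd (const [])
    (insertEntry (by fun_prop) (by fun_prop)) (fun x => size (d x) * (10 * size (d x) + 8) + 1)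
    ((hd.polyBound_size.mul (((PolyBound.const 10).mul hd.polyBound_size).add
      (PolyBound.const 8))).add (PolyBound.const 1)) fun x l' h' => ?_
  have := size_le_of_sublist h'.sublist
  refine (size_normalize_le l').trans ?_
  gcongr

@[fun_prop]
theorem combine (m : Bool) {d d' : α → Hist} (hd : PolyFn d) (hd' : PolyFn d') :
    PolyFn fun x => combine m (d x) (d' x) := by
  have h : PolyFn fun p : Hist × Hist => FDShapley.combine m p.1 p.2 := by
    unfold FDShapley.combine
    refine normalize (flatMap (f := fun (p : Hist × Hist) (e : Key × ℕ) => p.2.map fun e' =>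
      (FDShapley.keyOp m e.1 e'.1, e.2 * e'.2)) fst ?_)
    exact map (f := fun (q : (Hist × Hist) × (Key × ℕ)) (e' : Key × ℕ) =>
      (FDShapley.keyOp m q.2.1 e'.1, q.2.2 * e'.2)) (by fun_prop) (by fun_prop)
  exact h.comp (hd.pair hd')

/-- The sizes of iterated products could grow exponentially in general. Every partial product is
good for a partial sum of the `n x b`, hence bounded by `histSize (s x)`. -/
theorem combineAll (m : Bool) {l : α → List β} {D : α → β → Hist} (hl : PolyFn l)
    (hD : PolyFn fun p : α × β => D p.1 p.2) (n : α → β → ℕ) (s : α → ℕ) (hs : PolyBound s)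
    (hn : ∀ x, ((l x).map (n x)).sum ≤ s x) (h : ∀ x, ∀ b ∈ l x, (D x b).Good (n x b)) :
    PolyFn fun x => combineAll m ((l x).map (D x)) := by
  refine foldr (f := fun _ d d' => FDShapley.combine m d d') (init := fun _ => [(key 0 0 0, 1)])
    (map hl hD) (const _) (by fun_prop) (fun x => histSize (s x)) ?_ fun x l' h' => ?_
  · have h1 := hs.add (PolyBound.const 1)
    exact (((h1.mul (h1.mul h1)).mul ((((PolyBound.const 6).mul hs).add
      ((PolyBound.const 4).mul h1)).add (PolyBound.const 7) |>.add (PolyBound.const 1)))).add (PolyBound.const 1)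
  · obtain ⟨t, ht⟩ := h'
    obtain ⟨l₁, l₂, h1, rfl, rfl⟩ := List.map_eq_append_iff.1 ht.symm
    refine ((good_combineAll m l₂ (D x) (n x) fun b hb => h x b ?_).mono ?_).size_le
    · rw [h1]; exact List.mem_append_right _ hb
    · refine le_trans ?_ (hn x)
      rw [h1, List.map_append, List.sum_append]
      omega

end PolyFn

/-! ### Histograms of subset values -/

section Represents

variable {φ : Type} [DecidableEq φ]

/-- The key of a set `B` of facts: its cardinality and its value without and with `f`. -/
def stat (f : φ) (v : Finset φ → ℕ) (G B : Finset φ) : Key :=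
  key B.card (v B) (v (B ∪ G ∩ {f}))

/-- The histogram `d` counts the keys of the subsets of `G` without `f`. -/
def Represents (f : φ) (d : Hist) (v : Finset φ → ℕ) (G : Finset φ) : Prop :=
  ∀ w : Key → ℕ, ev d w = ∑ B ∈ (G.erase f).powerset, w (stat f v G B)

/-- Sum or maximum of a list. -/
def agg (m : Bool) (l : List ℕ) : ℕ := l.foldr (natOp m) 0

theorem Represents.congr {f : φ} {d : Hist} {v v' : Finset φ → ℕ} {G : Finset φ}
    (h : Represents f d v G) (hv : ∀ B ⊆ G, v B = v' B) : Represents f d v' G := by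
  intro w
  rw [h w]
  refine Finset.sum_congr rfl fun B hB => ?_
  have hB : B ⊆ G := (Finset.mem_powerset.1 hB).trans (Finset.erase_subset _ _)
  unfold stat
  rw [hv B hB, hv _ (Finset.union_subset hB Finset.inter_subset_left)]

theorem represents_single (f a : φ) : Represents f
    (bif decide (a = f) then [(key 0 0 1, 1)] else [(key 0 0 0, 1), (key 1 1 1, 1)]) Finset.card {a} := by
  intro w
  by_cases h : a = f
  · subst h
    have : ({a} : Finset φ).erase a = ∅ := by simp
    rw [this, Finset.powerset_empty, Finset.sum_singleton]
    simp [ev, stat]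
  · have h1 : ({a} : Finset φ).erase f = {a} := Finset.erase_eq_of_notMem (by simpa using Ne.symm h)
    have h2 : ({a} : Finset φ) ∩ {f} = ∅ := by
      rw [Finset.singleton_inter_of_notMem (by simpa using h)]
    rw [h1, show ({a} : Finset φ) = insert a ∅ from rfl, Finset.sum_powerset_insert (by simp)]
    simp only [decide_eq_false h, cond_false]
    rw [show (insert a ∅ : Finset φ) = {a} from rfl]
    simp [ev, stat, h2]

variable {β : Type}

theorem mem_foldr_union (l : List β) (S : β → Finset φ) (x : φ) :
    x ∈ l.foldr (fun b U => S b ∪ U) ∅ ↔ ∃ b ∈ l, x ∈ S b := by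
  induction l with
  | nil => simp
  | cons b l ih => simp [ih]

/-- A subset of a disjoint union is a family of subsets of the pieces, so counting becomes a
product. The fact `f` lies in at most one piece; in the others `S b ∩ {f}` is empty and the last two
components of the key coincide. This is why `stat` adds `G ∩ {f}` instead of `{f}`. -/
theorem represents_combineAll (f : φ) (m : Bool) (l : List β) (S : β → Finset φ) (D : β → Hist)
    (v : β → Finset φ → ℕ) (hl : l.Pairwise fun b c => Disjoint (S b) (S c))
    (hD : ∀ b ∈ l, Represents f (D b) (v b) (S b)) :
    Represents f (combineAll m (l.map D)) (fun B => agg m (l.map fun b => v b (B ∩ S b)))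
      (l.foldr (fun b U => S b ∪ U) ∅) := by
  induction l with
  | nil =>
    intro w
    simp [combineAll, ev, stat, agg]
  | cons b l ih =>
    rw [List.pairwise_cons] at hl
    have ih := ih hl.2 fun c hc => hD c (List.mem_cons_of_mem _ hc)
    have hb := hD b List.mem_cons_self
    rw [List.foldr_cons, List.map_cons]
    set U := l.foldr (fun b U => S b ∪ U) ∅ with hU
    have hsub : ∀ c ∈ l, S c ⊆ U := fun c hc x hx => (mem_foldr_union l S x).2 ⟨c, hc, hx⟩
    have hdisj : Disjoint (S b) U := by
      rw [Finset.disjoint_left]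
      intro x hx hx'
      obtain ⟨c, hc, h⟩ := (mem_foldr_union l S x).1 hx'
      exact Finset.disjoint_left.1 (hl.1 c hc) hx h
    rw [Finset.disjoint_left] at hdisj
    intro w
    change ev (combine m (D b) (combineAll m (l.map D))) w = _
    rw [ev_combine, hb]
    simp only [ih _]
    rw [← Finset.sum_product']
    refine Finset.sum_nbij' (fun p => p.1 ∪ p.2) (fun B => (B ∩ S b, B ∩ U)) ?_ ?_ ?_ ?_ ?_
    · rintro ⟨B₁, B₂⟩ h
      simp only [Finset.mem_product, Finset.mem_powerset] at h ⊢
      rw [Finset.erase_union_distrib]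
      exact Finset.union_subset_union h.1 h.2
    · intro B h
      simp only [Finset.mem_product, Finset.mem_powerset] at h ⊢
      constructor <;> intro x hx <;> have := h (Finset.mem_inter.1 hx).1 <;>
        simp only [Finset.mem_inter, Finset.mem_erase] at hx this ⊢ <;> tauto
    · rintro ⟨B₁, B₂⟩ h
      simp only [Finset.mem_product, Finset.mem_powerset] at h
      refine Prod.ext ?_ ?_ <;> ext x <;> have h1 := @h.1 x <;> have h2 := @h.2 x <;>
        have h3 := @hdisj x <;> simp only [Finset.mem_inter, Finset.mem_erase, Finset.mem_union] at * <;>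
        tauto
    · intro B h
      rw [Finset.mem_powerset] at h
      ext x
      have := @h x
      simp only [Finset.mem_inter, Finset.mem_erase, Finset.mem_union] at *
      tauto
    · rintro ⟨B₁, B₂⟩ h
      simp only [Finset.mem_product, Finset.mem_powerset] at h
      have h1 := fun x => @h.1 x
      have h2 := fun x => @h.2 x
      simp only [Finset.mem_erase] at h1 h2
      congr 1
      unfold stat
      rw [keyOp_key]
      have hc : (B₁ ∪ B₂).card = B₁.card + B₂.card := by
        refine Finset.card_union_of_disjoint (Finset.disjoint_left.2 fun x hx hx' => ?_)
        exact hdisj (h1 x hx).2 (h2 x hx').2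
      have e1 : (B₁ ∪ B₂) ∩ S b = B₁ := by
        ext x
        have := h1 x; have := h2 x; have := @hdisj x
        simp only [Finset.mem_inter, Finset.mem_union]
        tauto
      have e2 : (B₁ ∪ B₂ ∪ (S b ∪ U) ∩ {f}) ∩ S b = B₁ ∪ S b ∩ {f} := by
        ext x
        have := h1 x; have := h2 x; have := @hdisj x
        simp only [Finset.mem_inter, Finset.mem_union]
        tauto
      have e3 : (l.map fun c => v c ((B₁ ∪ B₂) ∩ S c)) = l.map fun c => v c (B₂ ∩ S c) := by
        refine List.map_congr_left fun c hc => congrArg _ ?_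
        ext x
        have := h1 x; have := h2 x; have := @hdisj x; have := @hsub c hc x
        simp only [Finset.mem_inter, Finset.mem_union]
        tauto
      have e4 : (l.map fun c => v c ((B₁ ∪ B₂ ∪ (S b ∪ U) ∩ {f}) ∩ S c)) =
          l.map fun c => v c ((B₂ ∪ U ∩ {f}) ∩ S c) := by
        refine List.map_congr_left fun c hc => congrArg _ ?_
        ext x
        have := h1 x; have := h2 x; have := @hdisj x; have := @hsub c hc x
        simp only [Finset.mem_inter, Finset.mem_union]
        tauto
      simp only [List.map_cons, hc, e1, e2, e3, e4]
      rfl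

end Represents

/-! ### The recursive algorithm -/

/-- Lists of values, by which facts are grouped. -/
abbrev Vals : Type := List (List Bool)

section Stage

variable {φ : Type}

/-- Combine the histograms of the groups of facts with equal values of `κ`. -/
def stage (m : Bool) (κ : φ → Vals) (D : List φ → Hist) (L : List φ) : Hist :=
  combineAll m ((L.map κ).dedup.map fun k => D (L.filter fun a => decide (κ a = k)))

/-- The sum of `v` over the groups of facts with equal values of `κ`. -/
def sumStage (κ : φ → Vals) (v : Finset φ → ℕ) (B : Finset φ) : ℕ :=
  ∑ k ∈ B.image κ, v (B.filter fun a => κ a = k)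

/-- The maximum of `v` over the groups of facts with equal values of `κ`. -/
def maxStage (κ : φ → Vals) (v : Finset φ → ℕ) (B : Finset φ) : ℕ :=
  (B.image κ).sup fun k => v (B.filter fun a => κ a = k)

/-- Sums over groups of maxima over groups, and so on; the value of the innermost groups is their
cardinality. -/
def chainValue : List ((φ → Vals) × (φ → Vals)) → Finset φ → ℕ
  | [] => Finset.card
  | (κ, μ) :: ls => sumStage κ (maxStage μ (chainValue ls))

/-- The histogram of the values `chainValue ls`. -/
def chainHist [DecidableEq φ] (f : φ) : List ((φ → Vals) × (φ → Vals)) → List φ → Hist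
  | [] => fun L => combineAll false (L.map fun a =>
      bif decide (a = f) then [(key 0 0 1, 1)] else [(key 0 0 0, 1), (key 1 1 1, 1)])
  | (κ, μ) :: ls => stage false κ (stage true μ (chainHist f ls))

theorem chainValue_empty (ls : List ((φ → Vals) × (φ → Vals))) : chainValue ls ∅ = 0 := by
  cases ls <;> simp [chainValue, sumStage]

theorem maxStage_empty (κ : φ → Vals) (v : Finset φ → ℕ) : maxStage κ v ∅ = 0 := by
  simp [maxStage]

theorem sum_length_filter (κ : φ → Vals) (L : List φ) :
    ((L.map κ).dedup.map fun k => (L.filter fun a => decide (κ a = k)).length).sum = L.length := by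
  refine Eq.trans ?_ ((List.sum_map_count_dedup_eq_length (L.map κ)).trans (List.length_map κ))
  congr 1
  refine List.map_congr_left fun k _ => ?_
  unfold List.count
  rw [List.countP_map, List.countP_eq_length_filter]
  refine congrArg List.length (List.filter_congr fun a _ => ?_)
  rw [Bool.eq_iff_iff]
  simp

theorem good_stage (m : Bool) (κ : φ → Vals) (D : List φ → Hist) (L : List φ)
    (hD : ∀ L, (D L).Good L.length) : (stage m κ D L).Good L.length := by
  have := good_combineAll m (L.map κ).dedup (fun k => D (L.filter fun a => decide (κ a = k)))
    (fun k => (L.filter fun a => decide (κ a = k)).length) fun k _ => hD _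
  rwa [sum_length_filter] at this

theorem PolyFn.stage [Enc φ] (m : Bool) {κ : φ → Vals} (hκ : PolyFn κ) {D : φ → List φ → Hist}
    (hD : PolyFn fun p : φ × List φ => D p.1 p.2) (h : ∀ f L, (D f L).Good L.length) :
    PolyFn fun p : φ × List φ => stage m κ (D p.1) p.2 := by
  refine PolyFn.combineAll (l := fun p : φ × List φ => (p.2.map κ).dedup)
    (D := fun p k => D p.1 (p.2.filter fun a => decide (κ a = k))) m
    (dedup (map (f := fun _ a => κ a) snd (hκ.comp snd))) ?_
    (fun p k => (p.2.filter fun a => decide (κ a = k)).length) (fun p => size p) PolyBound.size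
    (fun p => ?_) (fun p k _ => h _ _)
  · exact hD.comp (pair (by fun_prop) (filter (f := fun (q : (φ × List φ) × Vals) a => decide (κ a = q.2))
      (by fun_prop) (decideEq (hκ.comp snd) (by fun_prop))))
  · rw [sum_length_filter]
    have := length_lt_size p.2
    obtain ⟨f, L⟩ := p
    simp only [size_pair] at *
    omega

variable [DecidableEq φ]

theorem represents_stage (f : φ) (m : Bool) (κ : φ → Vals) (D : List φ → Hist) (v : Finset φ → ℕ)
    (L : List φ) (hD : ∀ L' : List φ, L'.Sublist L → Represents f (D L') v L'.toFinset) :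
    Represents f (stage m κ D L)
      (fun B => agg m ((L.map κ).dedup.map fun k => v (B.filter fun a => κ a = k))) L.toFinset := by
  have h := represents_combineAll f m (L.map κ).dedup
    (fun k => (L.filter fun a => decide (κ a = k)).toFinset)
    (fun k => D (L.filter fun a => decide (κ a = k))) (fun _ => v) ?_
    (fun k _ => hD _ List.filter_sublist)
  · have hU : (L.map κ).dedup.foldr
        (fun k U => (L.filter fun a => decide (κ a = k)).toFinset ∪ U) ∅ = L.toFinset := by
      ext x
      simp only [mem_foldr_union, List.mem_dedup, List.mem_toFinset, List.mem_filter,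
        decide_eq_true_eq]
      exact ⟨fun ⟨_, _, h, _⟩ => h, fun h => ⟨κ x, List.mem_map_of_mem h, h, rfl⟩⟩
    rw [hU] at h
    refine h.congr fun B hB => ?_
    congr 1
    refine List.map_congr_left fun k _ => congrArg v ?_
    ext x
    have := @hB x
    simp only [Finset.mem_inter, Finset.mem_filter, List.mem_toFinset, List.mem_filter,
      decide_eq_true_eq] at *
    tauto
  · refine (List.nodup_dedup _).imp fun {k k'} hk => ?_
    rw [Finset.disjoint_left]
    intro x hx hx'
    simp only [List.mem_toFinset, List.mem_filter, decide_eq_true_eq] at hx hx'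
    exact hk (hx.2.symm.trans hx'.2)

theorem agg_false {β : Type} [DecidableEq β] (l : List β) (hl : l.Nodup) (g : β → ℕ) :
    agg false (l.map g) = ∑ b ∈ l.toFinset, g b := by
  rw [List.sum_toFinset g hl]
  rfl

theorem agg_true {β : Type} [DecidableEq β] (l : List β) (g : β → ℕ) :
    agg true (l.map g) = l.toFinset.sup g := by
  induction l with
  | nil => rfl
  | cons b l ih =>
    rw [List.toFinset_cons, Finset.sup_insert, ← ih]
    rfl

theorem toFinset_dedup_map (κ : φ → Vals) (L : List φ) :
    (L.map κ).dedup.toFinset = L.toFinset.image κ := by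
  ext k
  simp

theorem represents_sumStage (f : φ) (κ : φ → Vals) (D : List φ → Hist) (v : Finset φ → ℕ)
    (hv : v ∅ = 0) (L : List φ)
    (hD : ∀ L' : List φ, L'.Sublist L → Represents f (D L') v L'.toFinset) :
    Represents f (stage false κ D L) (sumStage κ v) L.toFinset := by
  refine (represents_stage f false κ D v L hD).congr fun B hB => ?_
  rw [agg_false _ (List.nodup_dedup _), toFinset_dedup_map]
  -- Groups of the list that `B` misses contribute `v ∅ = 0`.
  refine (Finset.sum_subset (Finset.image_subset_image hB) fun k _ hk => ?_).symm
  rw [Finset.filter_eq_empty_iff.2, hv]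
  rintro x hx rfl
  exact hk (Finset.mem_image_of_mem κ hx)

theorem represents_maxStage (f : φ) (κ : φ → Vals) (D : List φ → Hist) (v : Finset φ → ℕ)
    (hv : v ∅ = 0) (L : List φ)
    (hD : ∀ L' : List φ, L'.Sublist L → Represents f (D L') v L'.toFinset) :
    Represents f (stage true κ D L) (maxStage κ v) L.toFinset := by
  refine (represents_stage f true κ D v L hD).congr fun B hB => ?_
  rw [agg_true, toFinset_dedup_map]
  refine le_antisymm (Finset.sup_le fun k _ => ?_) (Finset.sup_mono (Finset.image_subset_image hB))
  by_cases hk : k ∈ B.image κ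
  · exact Finset.le_sup (f := fun k => v (B.filter fun a => κ a = k)) hk
  · rw [Finset.filter_eq_empty_iff.2, hv]
    · exact Nat.zero_le _
    · rintro x hx rfl
      exact hk (Finset.mem_image_of_mem κ hx)

theorem represents_chainHist (f : φ) (ls : List ((φ → Vals) × (φ → Vals))) (L : List φ)
    (hL : L.Nodup) : Represents f (chainHist f ls L) (chainValue ls) L.toFinset := by
  induction ls generalizing L with
  | nil =>
    have h := represents_combineAll f false L (fun a => {a}) _ (fun _ => Finset.card)
      (hL.imp fun h => by simpa using h) (fun a _ => represents_single f a)
    have hU : L.foldr (fun a U => {a} ∪ U) ∅ = L.toFinset := by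
      clear h hL
      induction L with
      | nil => rfl
      | cons a L ih => rw [List.foldr_cons, ih, List.toFinset_cons, Finset.insert_eq]
    rw [hU] at h
    refine h.congr fun B hB => ?_
    rw [agg_false _ hL]
    have : ∀ a, (B ∩ {a}).card = if a ∈ B then 1 else 0 := by
      intro a
      split_ifs with ha
      · rw [Finset.inter_singleton_of_mem ha, Finset.card_singleton]
      · rw [Finset.inter_singleton_of_notMem ha, Finset.card_empty]
    simp only [this, Finset.sum_ite_mem]
    rw [Finset.inter_eq_right.2 hB]
    simp [chainValue]
  | cons l ls ih =>
    obtain ⟨κ, μ⟩ := l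
    refine represents_sumStage f κ _ _ (maxStage_empty _ _) L fun L' h' => ?_
    refine represents_maxStage f μ _ _ (chainValue_empty _) L' fun L'' h'' => ?_
    exact ih L'' (hL.sublist (h''.trans h'))

theorem good_single (f a : φ) : Hist.Good
    (bif decide (a = f) then [(key 0 0 1, 1)] else [(key 0 0 0, 1), (key 1 1 1, 1)]) 1 := by
  by_cases h : a = f
  · simp only [h, decide_true, cond_true]
    refine ⟨by simp, fun k hk => ?_, by simp [ev]⟩
    simp only [List.map_cons, List.map_nil, List.mem_singleton] at hk
    subst hk
    simp [key]
  · simp only [h, decide_false, cond_false]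
    refine ⟨by decide, fun k hk => ?_, by simp [ev]⟩
    simp only [List.map_cons, List.map_nil, List.mem_cons, List.not_mem_nil, or_false] at hk
    rcases hk with rfl | rfl <;> simp [key]

theorem good_chainHist (f : φ) (ls : List ((φ → Vals) × (φ → Vals))) (L : List φ) :
    (chainHist f ls L).Good L.length := by
  induction ls generalizing L with
  | nil =>
    have := good_combineAll false L _ (fun _ => 1) fun a _ => good_single f a
    rwa [List.map_const', List.sum_replicate, smul_eq_mul, mul_one] at this
  | cons l ls ih =>
    exact good_stage _ _ _ _ fun L' => good_stage _ _ _ _ fun L'' => ih L''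

theorem PolyFn.chainHist [Enc φ] [PolyDecEq φ] (ls : List ((φ → Vals) × (φ → Vals)))
    (hls : ∀ l ∈ ls, PolyFn l.1 ∧ PolyFn l.2) :
    PolyFn fun p : φ × List φ => chainHist p.1 ls p.2 := by
  induction ls with
  | nil =>
    refine PolyFn.combineAll (l := fun p : φ × List φ => p.2) (D := fun p a =>
      bif decide (a = p.1) then [(key 0 0 1, 1)] else [(key 0 0 0, 1), (key 1 1 1, 1)]) false snd
      (cond (decideEq (by fun_prop) (by fun_prop)) (const _) (const _))
      (fun _ _ => 1) (fun p => size p) PolyBound.size (fun p => ?_) (fun p a _ => good_single _ _)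
    have := length_lt_size p.2
    obtain ⟨f, L⟩ := p
    simp only [size_pair, List.map_const', List.sum_replicate, smul_eq_mul, mul_one] at *
    omega
  | cons l ls ih =>
    obtain ⟨κ, μ⟩ := l
    have h := hls _ List.mem_cons_self
    exact PolyFn.stage false h.1 (PolyFn.stage true h.2 (ih fun l hl => hls l (List.mem_cons_of_mem _ hl))
      fun f L => good_chainHist f ls L) fun f L => good_stage _ _ _ _ fun L => good_chainHist f ls L

end Stage

/-! ### The Shapley value as a sum over sets -/

section Shapley

variable {α : Type} (L : Finset α) (a : L)

theorem mem_playersBefore (π : L ≃ Fin L.card) (b : α) :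
    b ∈ playersBefore L π a ↔ ∃ h : b ∈ L, π ⟨b, h⟩ < π a := by
  simp [playersBefore]

theorem playersBefore_subset [DecidableEq α] (π : L ≃ Fin L.card) :
    playersBefore L π a ⊆ L.erase a := by
  intro b hb
  obtain ⟨h, hlt⟩ := (mem_playersBefore L a π b).1 hb
  refine Finset.mem_erase.2 ⟨?_, h⟩
  rintro rfl
  exact lt_irrefl _ hlt

theorem card_playersBefore (π : L ≃ Fin L.card) : (playersBefore L π a).card = π a := by
  unfold playersBefore
  rw [Finset.card_map, ← Finset.card_map π.toEmbedding]
  have : (Finset.univ.filter fun b : L => π b < π a).map π.toEmbedding = Finset.Iio (π a) := by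
    ext i
    simp only [Finset.mem_map_equiv, Finset.mem_filter, Finset.mem_univ, true_and,
      Equiv.apply_symm_apply, Finset.mem_Iio]
  rw [this, Fin.card_Iio]

variable [DecidableEq α]

/-- Facts before, at, and after the place of `a`. -/
def place (B : Finset α) (b : L) : Fin 3 := if (b : α) ∈ B then 0 else if b = a then 1 else 2

theorem place_eq_zero {B : Finset α} {b : L} : place L a B b = 0 ↔ (b : α) ∈ B := by
  unfold place
  split_ifs <;> simp_all

theorem place_eq_one {B : Finset α} (ha : (a : α) ∉ B) {b : L} : place L a B b = 1 ↔ b = a := by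
  unfold place
  split_ifs with h1 h2
  · refine iff_of_false (by decide) ?_
    rintro rfl
    exact ha h1
  · exact iff_of_true rfl h2
  · exact iff_of_false (by decide) h2

theorem place_eq_two {B : Finset α} {b : L} : place L a B b = 2 ↔ (b : α) ∉ B ∧ b ≠ a := by
  unfold place
  split_ifs <;> simp_all

/-- Sort the players by `place`: first those in `B`, then `a`, then the others. -/
theorem exists_playersBefore_eq {B : Finset α} (hB : B ⊆ L.erase a) :
    ∃ π : L ≃ Fin L.card, playersBefore L π a = B := by
  set e := L.equivFin
  set g : Fin L.card → Fin 3 := fun i => place L a B (e.symm i)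
  refine ⟨e.trans (Tuple.sort g).symm, ?_⟩
  have hmono := Tuple.monotone_sort g
  have hg : ∀ b, g ((Tuple.sort g) ((e.trans (Tuple.sort g).symm) b)) = place L a B b := by
    intro b; simp [g]
  set π := e.trans (Tuple.sort g).symm
  have key : ∀ b c, π b ≤ π c → place L a B b ≤ place L a B c := by
    intro b c h
    rw [← hg b, ← hg c]
    exact hmono h
  have haB : (a : α) ∉ B := fun h => (Finset.mem_erase.1 (hB h)).1 rfl
  have ha : place L a B a = 1 := by simp [place, haB]
  ext b
  rw [mem_playersBefore]
  constructor
  · rintro ⟨h, hlt⟩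
    by_contra hb
    have hne : (⟨b, h⟩ : L) ≠ a := by rintro rfl; exact lt_irrefl _ hlt
    have := key _ _ hlt.le
    rw [ha] at this
    simp [place, hb, hne] at this
  · intro hb
    have h := (Finset.mem_erase.1 (hB hb)).2
    refine ⟨h, ?_⟩
    by_contra hle
    have := key _ _ (not_lt.1 hle)
    rw [ha] at this
    simp [place, hb] at this

/-- Relative to a fixed `π₀`, the orders with the same predecessors of `a` correspond to the
permutations of the players that preserve the three-colouring `place`. This reduces their number to
the order of a stabilizer: the product of the factorials of the colour class sizes `|B|`, 1 and `|L|
- 1 - |B|`. -/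
theorem playersBefore_eq_iff (π₀ π : L ≃ Fin L.card) :
    playersBefore L π a = playersBefore L π₀ a ↔
      place L a (playersBefore L π₀ a) ∘ (π.trans π₀.symm) = place L a (playersBefore L π₀ a) := by
  have hp : ∀ b : L, place L a (playersBefore L π₀ a) b =
      if π₀ b < π₀ a then 0 else if b = a then 1 else 2 := by
    intro b
    simp [place, mem_playersBefore]
  constructor
  · intro h
    have ha : π a = π₀ a := by
      have h1 := card_playersBefore L a π
      rw [h, card_playersBefore] at h1
      exact (Fin.ext h1).symm
    funext b
    have hb : π b < π a ↔ π₀ b < π₀ a := by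
      have := congrArg (fun s => (b : α) ∈ s) h
      simpa [mem_playersBefore] using this
    have hb' : π₀.symm (π b) = a ↔ b = a := by
      rw [Equiv.symm_apply_eq, ← ha, π.injective.eq_iff]
    simp only [comp_apply, Equiv.trans_apply, hp, Equiv.apply_symm_apply, ← ha, hb']
    simp only [ha ▸ hb, ha]
  · intro h
    have h1 : ∀ b, (π b < π₀ a ↔ π₀ b < π₀ a) ∧ (π₀.symm (π b) = a ↔ b = a) := by
      intro b
      have h2 := congrFun h b
      simp only [comp_apply, Equiv.trans_apply, hp, Equiv.apply_symm_apply, Equiv.symm_apply_eq] at h2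
      rw [Equiv.symm_apply_eq]
      by_cases hba : b = a
      · subst hba
        simp only [lt_irrefl, if_false, if_true] at h2 ⊢
        split_ifs at h2 <;> simp_all
      · simp only [hba, if_false] at h2
        rcases lt_trichotomy (π b) (π₀ a) with h3 | h3 | h3
        · rw [if_pos h3] at h2
          refine ⟨iff_of_true h3 ?_, iff_of_false h3.ne hba⟩
          by_contra h4
          rw [if_neg h4] at h2
          exact absurd h2 (by decide)
        · rw [if_neg h3.not_lt, if_pos h3] at h2
          split_ifs at h2 <;> exact absurd h2 (by decide)
        · rw [if_neg h3.not_gt, if_neg h3.ne'] at h2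
          refine ⟨iff_of_false h3.not_gt fun h4 => ?_, iff_of_false h3.ne' hba⟩
          rw [if_pos h4] at h2
          exact absurd h2 (by decide)
    have ha : π a = π₀ a := by
      have := (h1 a).2.2 rfl
      rwa [Equiv.symm_apply_eq] at this
    ext b
    rw [mem_playersBefore, mem_playersBefore, ha]
    exact exists_congr fun hb => (h1 ⟨b, hb⟩).1

theorem card_playersBefore_eq {B : Finset α} (hB : B ⊆ L.erase a) :
    (Finset.univ.filter fun π : L ≃ Fin L.card => playersBefore L π a = B).card =
      B.card.factorial * (L.card - 1 - B.card).factorial := by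
  obtain ⟨π₀, rfl⟩ := exists_playersBefore_eq L a hB
  set B := playersBefore L π₀ a with hBdef
  have h1 : (Finset.univ.filter fun π : L ≃ Fin L.card => playersBefore L π a = B).card =
      Fintype.card {g : Equiv.Perm L // place L a B ∘ g = place L a B} := by
    rw [Fintype.card_subtype]
    refine Finset.card_nbij' (fun π => π.trans π₀.symm) (fun g => Equiv.trans g π₀) ?_ ?_ ?_ ?_
    · intro π hπ
      simp only [Finset.coe_filter, Finset.mem_univ, true_and, Set.mem_ofPred_eq] at hπ ⊢
      exact (playersBefore_eq_iff L a π₀ π).1 hπ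
    · intro g hg
      simp only [Finset.coe_filter, Finset.mem_univ, true_and, Set.mem_ofPred_eq] at hg ⊢
      refine (playersBefore_eq_iff L a π₀ _).2 ?_
      rw [← hBdef]
      convert hg using 2
      ext b; simp
    · intro π _
      ext b; simp
    · intro g _
      ext b; simp
  rw [h1, DomMulAct.stabilizer_card, Fin.prod_univ_three]
  have haB : (a : α) ∉ B := fun h => (Finset.mem_erase.1 (hB h)).1 rfl
  have hBL : B ⊆ L := hB.trans (Finset.erase_subset _ _)
  have c0 : Fintype.card {b : L // place L a B b = 0} = B.card := by
    rw [Fintype.card_subtype, ← Finset.card_map (Function.Embedding.subtype _)]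
    congr 1
    ext b
    simp only [Finset.mem_map, Finset.mem_filter, Finset.mem_univ, true_and, place_eq_zero]
    exact ⟨fun ⟨x, hx, h⟩ => h ▸ hx, fun h => ⟨⟨b, hBL h⟩, h, rfl⟩⟩
  have c1 : Fintype.card {b : L // place L a B b = 1} = 1 := by
    rw [Fintype.card_subtype, Finset.card_eq_one]
    refine ⟨a, ?_⟩
    ext b
    simp only [Finset.mem_filter, Finset.mem_univ, true_and, Finset.mem_singleton,
      place_eq_one L a haB]
  have c2 : Fintype.card {b : L // place L a B b = 2} = L.card - 1 - B.card := by
    have hcard := Finset.card_sdiff_of_subset hB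
    rw [Finset.card_erase_of_mem a.2] at hcard
    rw [← hcard, Fintype.card_subtype, ← Finset.card_map (Function.Embedding.subtype _)]
    congr 1
    ext b
    simp only [Finset.mem_map, Finset.mem_filter, Finset.mem_univ, true_and, place_eq_two,
      Finset.mem_sdiff, Finset.mem_erase]
    constructor
    · rintro ⟨x, ⟨h1, h2⟩, rfl⟩
      exact ⟨⟨fun h => h2 (Subtype.ext h), x.2⟩, h1⟩
    · rintro ⟨⟨hne, h⟩, hb⟩
      exact ⟨⟨b, h⟩, ⟨hb, fun h' => hne (congrArg Subtype.val h')⟩, rfl⟩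
  rw [c0, c1, c2]
  simp

theorem sum_playersBefore (F : Finset α → ℝ) :
    ∑ π : L ≃ Fin L.card, F (playersBefore L π a) =
      ∑ B ∈ (L.erase a).powerset, ((B.card.factorial * (L.card - 1 - B.card).factorial : ℕ) : ℝ) * F B := by
  rw [← Finset.sum_fiberwise_of_maps_to (t := (L.erase a).powerset)
    (g := fun π => playersBefore L π a)
    fun π _ => Finset.mem_powerset.2 (playersBefore_subset L a π)]
  refine Finset.sum_congr rfl fun B hB => ?_
  rw [Finset.sum_congr rfl fun π hπ => by rw [(Finset.mem_filter.1 hπ).2], Finset.sum_const,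
    card_playersBefore_eq L a (Finset.mem_powerset.1 hB), nsmul_eq_mul]

theorem shapley_eq (G : Finset α → ℝ) :
    shapley L G a = (∑ B ∈ (L.erase a).powerset,
      ((B.card.factorial * (L.card - 1 - B.card).factorial : ℕ) : ℝ) * (G (insert (a : α) B) - G B)) /
        (L.card.factorial : ℝ) := by
  -- The definition of `shapley` inserts with classical decidability of equality; here it is
  -- exchanged for the given instance.
  have h : ∀ B : Finset α, @Insert.insert α (Finset α)
      (@Finset.instInsert α fun b c => Classical.propDecidable (b = c)) (a : α) B = insert (a : α) B := by
    intro B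
    ext b
    simp
  rw [← sum_playersBefore L a fun B => G (insert (a : α) B) - G B]
  unfold shapley
  simp only [h]
  rw [one_div, mul_comm, ← div_eq_mul_inv]
  refine congrArg₂ HDiv.hDiv (Finset.sum_congr ?_ fun _ _ => rfl) rfl
  exact congrArg (fun i => @Finset.univ (L ≃ Fin L.card) i) (Subsingleton.elim _ _)

end Shapley

/-! ### Largest consistent subsets -/

section IsMax

variable {φ : Type}

/-- `v B` is the maximal cardinality of a subset of `B` with the property `Sat`. -/
def IsMax (Sat : Finset φ → Prop) (v : Finset φ → ℕ) : Prop :=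
  ∀ B, (∃ C ⊆ B, Sat C ∧ C.card = v B) ∧ ∀ C ⊆ B, Sat C → C.card ≤ v B

theorem isMax_card : IsMax (fun _ : Finset φ => True) Finset.card :=
  fun B => ⟨⟨B, subset_rfl, trivial, rfl⟩, fun _ h _ => Finset.card_le_card h⟩

/-- A nonempty set on which `μ` is constant lies in a single group, so the best group decides. -/
theorem IsMax.maxStage {Sat : Finset φ → Prop} {v : Finset φ → ℕ} (h : IsMax Sat v) (h0 : Sat ∅)
    (μ : φ → Vals) : IsMax (fun C => (∀ a ∈ C, ∀ b ∈ C, μ a = μ b) ∧ Sat C) (maxStage μ v) := by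
  intro B
  constructor
  · rcases B.eq_empty_or_nonempty with rfl | hB
    · exact ⟨∅, subset_rfl, ⟨by simp, h0⟩, by simp [FDShapley.maxStage]⟩
    · obtain ⟨k, hk, he⟩ := Finset.exists_mem_eq_sup _ (hB.image μ)
        (fun k => v (B.filter fun a => μ a = k))
      obtain ⟨C, hC, hs, hc⟩ := (h (B.filter fun a => μ a = k)).1
      refine ⟨C, hC.trans (Finset.filter_subset _ _), ⟨fun a ha b hb => ?_, hs⟩, hc.trans he.symm⟩
      rw [(Finset.mem_filter.1 (hC ha)).2, (Finset.mem_filter.1 (hC hb)).2]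
  · rintro C hC ⟨hμ, hs⟩
    rcases C.eq_empty_or_nonempty with rfl | ⟨c, hc⟩
    · simp
    · refine ((h (B.filter fun a => μ a = μ c)).2 C (fun x hx => ?_) hs).trans
        (Finset.le_sup (f := fun k => v (B.filter fun a => μ a = k)) (Finset.mem_image_of_mem μ (hC hc)))
      exact Finset.mem_filter.2 ⟨hC hx, hμ x hx c hc⟩

/-- The condition concerns each group separately, so optimal subsets of the groups can be chosen
independently and united. -/
theorem IsMax.sumStage {Sat : Finset φ → Prop} {v : Finset φ → ℕ} (h : IsMax Sat v) (h0 : Sat ∅)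
    (κ : φ → Vals) : IsMax (fun C => ∀ k, Sat (C.filter fun a => κ a = k)) (sumStage κ v) := by
  classical
  intro B
  constructor
  · choose C hC hs hc using fun k => (h (B.filter fun a => κ a = k)).1
    have hCκ : ∀ k, ∀ x ∈ C k, κ x = k := fun k x hx => (Finset.mem_filter.1 (hC k hx)).2
    refine ⟨(B.image κ).biUnion C, ?_, fun k => ?_, ?_⟩
    · exact Finset.biUnion_subset.2 fun k _ => (hC k).trans (Finset.filter_subset _ _)
    · by_cases hk : k ∈ B.image κ
      · have : ((B.image κ).biUnion C).filter (fun a => κ a = k) = C k := by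
          ext x
          rw [Finset.mem_filter, Finset.mem_biUnion]
          constructor
          · rintro ⟨⟨k', _, hx⟩, rfl⟩
            rwa [hCκ k' x hx]
          · exact fun hx => ⟨⟨k, hk, hx⟩, hCκ k x hx⟩
        rw [this]
        exact hs k
      · rw [Finset.filter_eq_empty_iff.2]
        · exact h0
        · intro x hx hxk
          obtain ⟨k', hk', hx⟩ := Finset.mem_biUnion.1 hx
          rw [hCκ k' x hx] at hxk
          exact hk (hxk ▸ hk')
    · rw [Finset.card_biUnion]
      · exact Finset.sum_congr rfl fun k _ => hc k
      · intro k _ k' _ hkk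
        refine Finset.disjoint_left.2 ?_
        exact fun x hx hx' => hkk ((hCκ k x hx).symm.trans (hCκ k' x hx'))
  · intro C hC hs
    rw [Finset.card_eq_sum_card_image κ C]
    refine (Finset.sum_le_sum_of_subset (Finset.image_subset_image hC)).trans
      (Finset.sum_le_sum fun k _ => ?_)
    exact (h _).2 _ (Finset.filter_subset_filter _ hC) (hs k)

/-- The facts that agree on the first component of a level agree on the second one. -/
def ChainSat (ls : List ((φ → Vals) × (φ → Vals))) (C : Finset φ) : Prop :=
  ∀ l ∈ ls, ∀ a ∈ C, ∀ b ∈ C, l.1 a = l.1 b → l.2 a = l.2 b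

/-- The hypothesis expresses the chain: agreement on a later left-hand side implies agreement on
every earlier one. Hence violations at all levels happen inside the groups of the first `κ`, and
consistency means that in each of them `μ` is constant and the remaining levels hold. -/
theorem isMax_chainValue (ls : List ((φ → Vals) × (φ → Vals)))
    (h : ls.Pairwise fun l l' => ∀ a b, l'.1 a = l'.1 b → l.1 a = l.1 b) :
    IsMax (ChainSat ls) (chainValue ls) := by
  induction ls with
  | nil =>
    have : ChainSat ([] : List ((φ → Vals) × (φ → Vals))) = fun _ => True := by
      funext C
      simp [ChainSat]
    rw [this]
    exact isMax_card
  | cons l ls ih =>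
    obtain ⟨κ, μ⟩ := l
    rw [List.pairwise_cons] at h
    have h1 := ((ih h.2).maxStage (by simp [ChainSat]) μ).sumStage ⟨by simp, by simp [ChainSat]⟩ κ
    refine (congrArg (fun Sat => IsMax Sat _) (funext fun C => ?_)).mpr h1
    rw [eq_iff_iff]
    constructor
    · intro hC k
      refine ⟨fun a ha b hb => ?_, fun l hl a ha b hb => ?_⟩
      · rw [Finset.mem_filter] at ha hb
        exact hC _ List.mem_cons_self a ha.1 b hb.1 (ha.2.trans hb.2.symm)
      · rw [Finset.mem_filter] at ha hb
        exact hC _ (List.mem_cons_of_mem _ hl) a ha.1 b hb.1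
    · intro hC l hl a ha b hb hab
      rcases List.mem_cons.1 hl with rfl | hl
      · exact (hC (κ b)).1 a (Finset.mem_filter.2 ⟨ha, hab⟩) b (Finset.mem_filter.2 ⟨hb, rfl⟩)
      -- Agreement on the later left-hand side puts `a` into the `κ`-group of `b`.
      · exact (hC (κ b)).2 l hl a (Finset.mem_filter.2 ⟨ha, h.1 l hl a b hab⟩) b
          (Finset.mem_filter.2 ⟨hb, rfl⟩) hab

/-- Removing `a` from an optimal set for `insert a B` costs at most one element and leaves a
consistent subset of `B`. -/
theorem IsMax.bounds_insert [DecidableEq φ] {Sat : Finset φ → Prop} {v : Finset φ → ℕ} (h : IsMax Sat v)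
    (hmono : ∀ C C', C ⊆ C' → Sat C' → Sat C) (a : φ) (B : Finset φ) :
    v B ≤ v (insert a B) ∧ v (insert a B) ≤ v B + 1 := by
  constructor
  · obtain ⟨C, hC, hs, hc⟩ := (h B).1
    rw [← hc]
    exact (h _).2 C (hC.trans (Finset.subset_insert _ _)) hs
  · obtain ⟨C, hC, hs, hc⟩ := (h (insert a B)).1
    have hCa : C.erase a ⊆ B := by
      intro x hx
      rw [Finset.mem_erase] at hx
      exact (Finset.mem_insert.1 (hC hx.2)).resolve_left hx.1
    have h1 := (h B).2 (C.erase a) hCa (hmono _ _ (Finset.erase_subset _ _) hs)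
    have h2 := Finset.pred_card_le_card_erase (s := C) (a := a)
    omega

theorem IsMax.le_card {Sat : Finset φ → Prop} {v : Finset φ → ℕ} (h : IsMax Sat v) (B : Finset φ) :
    v B ≤ B.card := by
  obtain ⟨C, hC, -, hc⟩ := (h B).1
  rw [← hc]
  exact Finset.card_le_card hC

theorem chainValue_image {ψ : Type} [DecidableEq ψ] (ι : φ → ψ) (hι : Injective ι)
    (ls : List ((ψ → Vals) × (ψ → Vals))) (B : Finset φ) :
    chainValue ls (B.image ι) = chainValue (ls.map fun l => (l.1 ∘ ι, l.2 ∘ ι)) B := by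
  induction ls generalizing B with
  | nil => exact Finset.card_image_of_injective B hι
  | cons l ls ih =>
    obtain ⟨κ, μ⟩ := l
    simp only [chainValue, List.map_cons, FDShapley.sumStage, FDShapley.maxStage, Finset.image_image,
      Finset.filter_image, ih]
    rfl

end IsMax

/-! ### The repair measure through largest consistent subsets -/

theorem repairMeasure_eq {S : Schema} {Val : Type} (Δ : Set (FD S)) {v : Database S Val → ℕ}
    (h : IsMax (fun C => Satisfies C Δ) v) (D : Database S Val) :
    repairMeasure D Δ = D.card - v D := by
  classical
  have hle := h.le_card D
  unfold repairMeasure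
  refine le_antisymm (Nat.sInf_le ?_) (le_csInf ⟨D.card, D, subset_rfl, ?_, rfl⟩ ?_)
  · obtain ⟨C, hC, hs, hc⟩ := (h D).1
    refine ⟨D \ C, Finset.sdiff_subset, ?_, ?_⟩
    · convert hs using 1
      ext x
      have := @hC x
      simp only [Finset.mem_sdiff]
      tauto
    · rw [Finset.card_sdiff_of_subset hC, hc]
  · rw [show D \ D = ∅ by simp]
    intro φ _ v w hv
    simp at hv
  · rintro n ⟨E, hE, hs, rfl⟩
    have h1 := (h D).2 _ Finset.sdiff_subset hs
    have h2 : (D \ E).card = D.card - E.card := by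
      convert Finset.card_sdiff_of_subset hE using 2
    omega

/-! ### Facts as data -/

/-- Facts as data: the number of the relation symbol and the codes of the values. -/
abbrev RawFact : Type := List Unit × Vals

/-- The values of a fact at the positions that a table lists for its relation symbol, preceded by
the relation symbol. -/
def lookup (tbl : List (List (List Unit))) (a : RawFact) : Vals :=
  (a.1.map fun _ => true) ::
    ((tbl.drop a.1.length).headD []).map fun i => (a.2.drop i.length).headD []

theorem PolyFn.lookup (tbl : List (List (List Unit))) : PolyFn (lookup tbl) := by
  refine PolyFn.cons (map (f := fun _ _ => true) fst (const _)) (map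
    (f := fun (a : RawFact) (i : List Unit) => (a.2.drop i.length).headD [])
    (headD (drop_length fst (const tbl)) []) (headD (drop_length snd (by fun_prop)) []))

section Levels

variable {S : Schema} {Val : Type}

instance : Fintype S.Rel := S.finRel

/-- The numbering of the relation symbols. -/
noncomputable def relIndex (R : S.Rel) : Fin (Fintype.card S.Rel) := Fintype.equivFin S.Rel R

/-- A fact as data. -/
noncomputable def rawFact (code : Val → List Bool) (f : Fact S Val) : RawFact :=
  (un (relIndex f.rel), (List.finRange (S.arity f.rel)).map fun i => code (f.val i))

theorem rawFact_injective {code : Val → List Bool} (hc : Injective code) :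
    Injective (rawFact (S := S) code) := by
  rintro ⟨R, v⟩ ⟨R', w⟩ h
  simp only [rawFact, Prod.mk.injEq, un_inj] at h
  obtain rfl : R = R' := (Fintype.equivFin S.Rel).injective (Fin.ext h.1)
  have : v = w := funext fun i => hc (List.map_inj_left.1 h.2 i (List.mem_finRange i))
  rw [this]

/-- The table of a family of sets of positions. -/
noncomputable def table (X : ∀ R : S.Rel, Finset (Fin (S.arity R))) : List (List (List Unit)) :=
  (List.finRange (Fintype.card S.Rel)).map fun j =>
    (X ((Fintype.equivFin S.Rel).symm j)).toList.map fun i : Fin _ => un i.val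

theorem headD_drop {α : Type} (l : List α) (d : α) (n : ℕ) (h : n < l.length) :
    (l.drop n).headD d = l[n] := by
  rw [List.drop_eq_getElem_cons h]
  rfl

theorem lookup_table (code : Val → List Bool) (X : ∀ R : S.Rel, Finset (Fin (S.arity R)))
    (f : Fact S Val) : lookup (table X) (rawFact code f) =
      ((un (relIndex f.rel)).map fun _ => true) :: (X f.rel).toList.map fun i => code (f.val i) := by
  obtain ⟨R, v⟩ := f
  unfold lookup
  congr 1
  have h1 : ((table X).drop (rawFact code ⟨R, v⟩).1.length).headD [] = (X R).toList.map fun i : Fin _ => un i.val := by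
    have hlt : (relIndex R : ℕ) < (table X).length := by
      simp [table, (relIndex R).2]
    simp only [rawFact, length_un]
    rw [headD_drop _ _ _ hlt]
    have h : (List.finRange (Fintype.card S.Rel))[(relIndex R : ℕ)]'(by simp) =
        Fintype.equivFin S.Rel R := by simp [relIndex]
    simp only [table, List.getElem_map]
    rw [h, Equiv.symm_apply_apply]
  rw [h1, List.map_map]
  refine List.map_congr_left fun i _ => ?_
  simp only [rawFact, comp_apply, length_un]
  rw [headD_drop _ _ _ (by simp)]
  simp

/-- The leading entry of `lookup` encodes the relation symbol, so facts over different relation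
symbols never agree. This allows one list of levels to serve all relation symbols. -/
theorem lookup_table_eq_iff {code : Val → List Bool} (hc : Injective code)
    (X : ∀ R : S.Rel, Finset (Fin (S.arity R))) (a b : Fact S Val) :
    lookup (table X) (rawFact code a) = lookup (table X) (rawFact code b) ↔
      ∃ (R : S.Rel) (v w : Fin (S.arity R) → Val), a = ⟨R, v⟩ ∧ b = ⟨R, w⟩ ∧ ∀ i ∈ X R, v i = w i := by
  rw [lookup_table, lookup_table, List.cons.injEq]
  constructor
  · rintro ⟨h1, h2⟩
    obtain ⟨R, v⟩ := a
    obtain ⟨R', w⟩ := b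
    have h3 := congrArg List.length h1
    simp only [List.length_map, length_un] at h3
    obtain rfl : R = R' := (Fintype.equivFin S.Rel).injective (Fin.ext h3)
    exact ⟨R, v, w, rfl, rfl, fun i hi => hc (List.map_inj_left.1 h2 i (Finset.mem_toList.2 hi))⟩
  · rintro ⟨R, v, w, rfl, rfl, h⟩
    exact ⟨rfl, List.map_congr_left fun i hi => congrArg code (h i (Finset.mem_toList.1 hi))⟩

/-- The dependencies over a relation symbol, listed by increasing left-hand side. -/
theorem exists_sorted_list {Δ : Set (FD S)} (hΔ : HasLhsChain Δ) (R : S.Rel) :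
    ∃ l : List (Finset (Fin (S.arity R)) × Finset (Fin (S.arity R))),
      (l.Pairwise fun p q => p.1 ⊆ q.1) ∧ ∀ p, p ∈ l ↔ FD.mk R p.1 p.2 ∈ Δ := by
  set T : Set (Finset (Fin (S.arity R)) × Finset (Fin (S.arity R))) := {p | FD.mk R p.1 p.2 ∈ Δ} with hT
  set l := T.toFinite.toFinset.toList.insertionSort fun p q => p.1.card ≤ q.1.card with hl
  have hmem : ∀ p, p ∈ l ↔ FD.mk R p.1 p.2 ∈ Δ := by
    intro p
    rw [hl, List.mem_insertionSort, Finset.mem_toList, Set.Finite.mem_toFinset, hT]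
    rfl
  have : Std.Total (fun p q : Finset (Fin (S.arity R)) × Finset (Fin (S.arity R)) => p.1.card ≤ q.1.card) :=
    ⟨fun p q => le_total _ _⟩
  have : IsTrans _ (fun p q : Finset (Fin (S.arity R)) × Finset (Fin (S.arity R)) => p.1.card ≤ q.1.card) :=
    ⟨fun p q r => le_trans⟩
  refine ⟨l, ?_, hmem⟩
  have hsort := List.pairwise_insertionSort
    (fun p q : Finset (Fin (S.arity R)) × Finset (Fin (S.arity R)) => p.1.card ≤ q.1.card)
    T.toFinite.toFinset.toList
  -- For comparable sets, ordering by cardinality is ordering by inclusion.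
  refine hsort.imp_of_mem fun {p q} hp hq hpq => ?_
  rcases hΔ R p.1 p.2 q.1 q.2 ((hmem p).1 hp) ((hmem q).1 hq) with h | h
  · exact h
  · exact (Finset.eq_of_subset_of_card_le h hpq).ge

/-- For dependencies with a left-hand-side chain, the maximal cardinality of a consistent subset
is computed by sums and maxima over groups. -/
theorem exists_levels {code : Val → List Bool} (hc : Injective code) {Δ : Set (FD S)}
    (hΔ : HasLhsChain Δ) : ∃ ls : List ((RawFact → Vals) × (RawFact → Vals)),
      (∀ l ∈ ls, PolyFn l.1 ∧ PolyFn l.2) ∧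
      IsMax (fun C : Database S Val => Satisfies C Δ) fun C => chainValue ls (C.image (rawFact code)) := by
  choose fds hsort hmem using exists_sorted_list hΔ
  set N := ∑ R : S.Rel, (fds R).length
  have hN : ∀ R, (fds R).length ≤ N := fun R =>
    Finset.single_le_sum (f := fun R => (fds R).length) (fun _ _ => Nat.zero_le _) (Finset.mem_univ R)
  -- Relation symbols with fewer than `N` dependencies are padded with the trivial dependency of the
  -- empty set on all attributes, whose left-hand side contains all others and thus prolongs the
  -- chain.
  set fd : ℕ → ∀ R : S.Rel, Finset (Fin (S.arity R)) × Finset (Fin (S.arity R)) :=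
    fun j R => (fds R).getD j (Finset.univ, ∅)
  set ls : List ((RawFact → Vals) × (RawFact → Vals)) := (List.range N).map fun j =>
    (lookup (table fun R => (fd j R).1), lookup (table fun R => (fd j R).2)) with hls
  refine ⟨ls, fun l hl => ?_, ?_⟩
  · obtain ⟨j, -, rfl⟩ := List.mem_map.1 hl
    exact ⟨PolyFn.lookup _, PolyFn.lookup _⟩
  · simp only [chainValue_image _ (rawFact_injective hc)]
    have hpw : (ls.map fun l => (l.1 ∘ rawFact (S := S) code, l.2 ∘ rawFact (S := S) code)).Pairwise
        fun l l' => ∀ a b, l'.1 a = l'.1 b → l.1 a = l.1 b := by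
      rw [hls, List.map_map, List.pairwise_map]
      refine List.pairwise_lt_range.imp fun {i j} hij a b h => ?_
      simp only [comp_apply] at h ⊢
      rw [lookup_table_eq_iff hc] at h ⊢
      obtain ⟨R, v, w, rfl, rfl, h⟩ := h
      refine ⟨R, v, w, rfl, rfl, fun x hx => h x ?_⟩
      by_cases hj : j < (fds R).length
      · have hi : i < (fds R).length := hij.trans hj
        have := List.pairwise_iff_getElem.1 (hsort R) i j hi hj hij
        simp only [fd, List.getD_eq_getElem _ _ hi, List.getD_eq_getElem _ _ hj] at hx ⊢
        exact this hx
      · simp only [fd, List.getD_eq_default _ _ (not_lt.1 hj), Finset.mem_univ]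
    have h := isMax_chainValue _ hpw
    refine (congrArg (fun Sat => IsMax Sat _) (funext fun C => ?_)).mpr h
    rw [eq_iff_iff]
    constructor
    · intro hC l hl a ha b hb hab
      rw [hls, List.map_map] at hl
      obtain ⟨j, -, rfl⟩ := List.mem_map.1 hl
      simp only [comp_apply] at hab ⊢
      rw [lookup_table_eq_iff hc] at hab ⊢
      obtain ⟨R, v, w, rfl, rfl, h⟩ := hab
      refine ⟨R, v, w, rfl, rfl, ?_⟩
      by_cases hj : j < (fds R).length
      · simp only [fd, List.getD_eq_getElem _ _ hj] at h ⊢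
        exact hC _ ((hmem R _).1 (List.getElem_mem hj)) v w ha hb h
      · simp only [fd, List.getD_eq_default _ _ (not_lt.1 hj)]
        simp
    · rintro hC ⟨R, X, Y⟩ hφ v w hv hw h
      obtain ⟨j, hj, he⟩ := List.mem_iff_getElem.1 ((hmem R (X, Y)).2 hφ)
      have hfd : fd j R = (X, Y) := by
        simp only [fd, List.getD_eq_getElem _ _ hj, he]
      have h1 := hC (lookup (table fun R => (fd j R).1) ∘ rawFact code,
        lookup (table fun R => (fd j R).2) ∘ rawFact code) (by
          rw [hls, List.map_map]
          exact List.mem_map.2 ⟨j, List.mem_range.2 (hj.trans_le (hN R)), rfl⟩) ⟨R, v⟩ hv ⟨R, w⟩ hw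
          (by
            simp only [comp_apply]
            rw [lookup_table_eq_iff hc]
            exact ⟨R, v, w, rfl, rfl, by rw [hfd]; exact h⟩)
      simp only [comp_apply] at h1
      rw [lookup_table_eq_iff hc] at h1
      obtain ⟨R', v', w', hv', hw', h2⟩ := h1
      cases hv'
      cases hw'
      rw [hfd] at h2
      exact h2

end Levels

/-! ### The numerator of the Shapley value -/

/-- The numerator of the Shapley value of a fact in a list of facts. -/
def shapleyNum (ls : List ((RawFact → Vals) × (RawFact → Vals))) (p : RawFact × List RawFact) : ℕ :=
  ev (chainHist p.1 ls p.2) fun k => bif decide (k.2.1 = k.2.2) then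
    k.1.length.factorial * (p.2.tail.drop k.1.length).length.factorial else 0

theorem PolyFn.shapleyNum (ls : List ((RawFact → Vals) × (RawFact → Vals)))
    (h : ∀ l ∈ ls, PolyFn l.1 ∧ PolyFn l.2) : PolyFn (shapleyNum ls) := by
  refine sum (map (f := fun (p : RawFact × List RawFact) (e : Key × ℕ) =>
    e.2 * bif decide (e.1.2.1 = e.1.2.2) then
      e.1.1.length.factorial * (p.2.tail.drop e.1.1.length).length.factorial else 0)
    (PolyFn.chainHist ls h) (mul (by fun_prop) (cond (decideEq (by fun_prop) (by fun_prop))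
      (mul (factorial_length (by fun_prop)) (factorial_length (drop_length (by fun_prop) (by fun_prop))))
      (const 0))))

/-- With `p` and `q` the values of `B` without and with the fact, the marginal contribution is `(|B|
+ 1 - q) - (|B| - p)`, and `q` is `p` or `p + 1`. It is therefore the indicator of `q = p`, the
weight used in `shapleyNum`. -/
theorem shapleyRepair_eq {S : Schema} {Val : Type} {code : Val → List Bool} (hc : Injective code)
    (Δ : Set (FD S)) {ls : List ((RawFact → Vals) × (RawFact → Vals))}
    (h : IsMax (fun C : Database S Val => Satisfies C Δ) fun C => chainValue ls (C.image (rawFact code)))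
    (x : Input S Val) :
    shapleyRepair Δ x = (shapleyNum ls (rawFact code x.fact, x.facts.map (rawFact code)) : ℝ) /
      (x.facts.length.factorial : ℝ) := by
  classical
  have hι := rawFact_injective (S := S) hc
  have hcard : x.db.card = x.facts.length := rfl
  unfold shapleyRepair
  rw [shapley_eq, hcard]
  refine congrArg₂ HDiv.hDiv ?_ rfl
  unfold shapleyNum
  rw [represents_chainHist _ ls _ (x.nodup.map hι)]
  push_cast
  have himg : ((x.facts.map (rawFact code)).toFinset.erase (rawFact code x.fact)).powerset =
      (x.db.erase x.fact).powerset.image fun B => B.image (rawFact code) := by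
    rw [← Finset.powerset_image, Finset.image_erase hι]
    congr 2
  rw [himg, Finset.sum_image fun B _ B' _ hBB => Finset.image_injective hι hBB]
  refine Finset.sum_congr rfl fun B hB => ?_
  rw [Finset.mem_powerset] at hB
  have hins : B.image (rawFact code) ∪ (x.facts.map (rawFact code)).toFinset ∩ {rawFact code x.fact} =
      (insert x.fact B).image (rawFact code) := by
    rw [Finset.image_insert, Finset.inter_singleton_of_mem, Finset.union_comm, ← Finset.insert_eq]
    exact List.mem_toFinset.2 (List.mem_map_of_mem x.mem)
  -- Dropping from the tail realises the number `|D| - 1 - |B|` in unary.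
  have hlen : ((x.facts.map (rawFact code)).tail.drop B.card).length = x.facts.length - 1 - B.card := by
    simp
    omega
  have hn : x.fact ∉ B := fun h => (Finset.mem_erase.1 (hB h)).1 rfl
  have hBc : (B.image (rawFact code)).card = B.card := Finset.card_image_of_injective B hι
  rw [repairMeasure_eq Δ h, repairMeasure_eq Δ h]
  simp only [stat, key, length_un, un_inj, hins, hlen, hBc]
  have h1 := h.bounds_insert (fun C C' hCC hs φ hφ v w hv hw => hs φ hφ v w (hCC hv) (hCC hw)) x.fact B
  have h2 := h.le_card B
  have h3 := h.le_card (insert x.fact B)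
  rw [Nat.cast_sub h3, Nat.cast_sub h2, Finset.card_insert_of_notMem hn]
  set p := chainValue ls (B.image (rawFact code))
  set q := chainValue ls ((insert x.fact B).image (rawFact code))
  rcases (by omega : q = p ∨ q = p + 1) with hq | hq
  · rw [hq]
    simp
  · rw [hq]
    simp

/-! ### Reading the input and writing the output -/

namespace Prog

section CaseProg

variable {K : Type} {Γ : K → Type}

open scoped Classical in
/-- Case distinction on the top letter of stack `k`. -/
noncomputable def caseProg (k : K) (f : Γ k → Prog Γ) : List (Γ k) → Prog Γ
  | [] => skip
  | x :: l => ite k (fun o => decide (o = some x)) (f x) (caseProg k f l)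

/-- Programs have no variables for letters: a letter is handled by comparing it with each letter of
the finite alphabet, at constant cost. -/
theorem exec_caseProg [DecidableEq K] {k : K} {f : Γ k → Prog Γ} {x : Γ k} {S S' : ∀ k, List (Γ k)} {t : ℕ}
    (hx : (S k).head? = some x) (h : Exec (f x) S t S') (l : List (Γ k)) (hl : x ∈ l) :
    ∃ m ≤ l.length + t, Exec (caseProg k f l) S m S' := by
  induction l with
  | nil => simp at hl
  | cons y l ih =>
    by_cases hxy : x = y
    · subst hxy
      exact ⟨1 + t, by simp, Exec.ite_true (by simp [hx]) h⟩
    · obtain ⟨m, hm, h'⟩ := ih ((List.mem_cons.1 hl).resolve_left hxy)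
      exact ⟨1 + m, by simp; omega, Exec.ite_false (by simp [hx, hxy]) h'⟩

end CaseProg

section InputOutput

variable {I O : Type} (i t : List I) (o : List O) (a b c d : List (Option Bool))

theorem exec_pop_inp (x : I) : Exec (pop (Γ := Alph I O) .inp) (st ⟨x :: i, t, o⟩ a b c d) 1
    (st ⟨i, t, o⟩ a b c d) := by
  have : st ⟨i, t, o⟩ a b c d = update (st ⟨x :: i, t, o⟩ a b c d) .inp i := by
    funext k; cases k <;> rfl
  rw [this]; exact Exec.pop (Γ := Alph I O) _ .inp

theorem exec_pop_tmp (x : I) : Exec (pop (Γ := Alph I O) .tmp) (st ⟨i, x :: t, o⟩ a b c d) 1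
    (st ⟨i, t, o⟩ a b c d) := by
  have : st ⟨i, t, o⟩ a b c d = update (st ⟨i, x :: t, o⟩ a b c d) .tmp t := by
    funext k; cases k <;> rfl
  rw [this]; exact Exec.pop (Γ := Alph I O) _ .tmp

theorem exec_push_tmp (x : I) : Exec (push (Γ := Alph I O) .tmp x) (st ⟨i, t, o⟩ a b c d) 1
    (st ⟨i, x :: t, o⟩ a b c d) := by
  have : st ⟨i, x :: t, o⟩ a b c d = update (st ⟨i, t, o⟩ a b c d) .tmp (x :: t) := by
    funext k; cases k <;> rfl
  rw [this]; exact Exec.push (Γ := Alph I O) _ .tmp x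

theorem exec_push_out (x : O) : Exec (push (Γ := Alph I O) .out x) (st ⟨i, t, o⟩ a b c d) 1
    (st ⟨i, t, x :: o⟩ a b c d) := by
  have : st ⟨i, t, x :: o⟩ a b c d = update (st ⟨i, t, o⟩ a b c d) .out (x :: o) := by
    funext k; cases k <;> rfl
  rw [this]; exact Exec.push (Γ := Alph I O) _ .out x

/-- Move the input to the copy stack. -/
noncomputable def copyLoop [Fintype I] : Prog (Alph I O) :=
  loop .inp Option.isSome
    (caseProg .inp (fun x => seq (pop .inp) (push .tmp x)) (Finset.univ : Finset I).toList)

theorem exec_copyLoop [Fintype I] : ∀ t : List I, ∃ m ≤ i.length * (Fintype.card I + 3) + 1,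
    Exec copyLoop (st ⟨i, t, o⟩ a b c d) m (st ⟨[], i.reverse ++ t, o⟩ a b c d) := by
  induction i with
  | nil => exact fun t => ⟨1, by simp, Exec.loop_done (Γ := Alph I O) (k := .inp) rfl⟩
  | cons x i ih =>
    intro t
    have h1 : Exec _ _ _ _ := (exec_pop_inp i t o a b c d x).seq (exec_push_tmp i t o a b c d x)
    obtain ⟨m, hm, h2⟩ := exec_caseProg (Γ := Alph I O) (k := .inp) (x := x)
      (f := fun x => seq (pop .inp) (push .tmp x)) rfl h1 (Finset.univ : Finset I).toList (by simp)
    obtain ⟨n, hn, h3⟩ := ih (x :: t)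
    refine ⟨1 + m + n, ?_, ?_⟩
    · have : (Finset.univ : Finset I).toList.length = Fintype.card I := by simp [Finset.card_univ]
      rw [List.length_cons, Nat.succ_mul]
      omega
    · exact (Exec.loop_step (Γ := Alph I O) (k := .inp) rfl h2 h3).of_eq rfl rfl (by simp)

/-- Write a list of data on stack `a`, an entry for every letter of the copy stack. -/
noncomputable def dataLoop [Fintype I] {β : Type} [Enc β] (δ : I → β) : Prog (Alph I O) :=
  loop .tmp Option.isSome
    (caseProg .tmp (fun x : I => seq (pop .tmp) (pushList (some true :: (enc (δ x)).ser)))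
      (Finset.univ : Finset I).toList)

/-- Each round puts one more entry in front of the list. As the copy stack holds the reversed input,
the entries end up in input order. -/
theorem exec_dataLoop [Fintype I] {β : Type} [Enc β] (δ : I → β) (M : ℕ) (hM : ∀ x, size (δ x) ≤ M) :
    ∀ l : List β, ∃ m ≤ t.length * (Fintype.card I + M + 5) + 1,
      Exec (dataLoop δ) (st ⟨i, t, o⟩ ((enc l).ser ++ a) b c d) m
        (st ⟨i, [], o⟩ ((enc ((t.map δ).reverse ++ l)).ser ++ a) b c d) := by
  induction t with
  | nil => exact fun l => ⟨1, by simp, Exec.loop_done (Γ := Alph I O) (k := .tmp) rfl⟩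
  | cons x t ih =>
    intro l
    have h1 : Exec _ _ _ _ := (exec_pop_tmp i t o ((enc l).ser ++ a) b c d x).seq
      (exec_pushList ⟨i, t, o⟩ (some true :: (enc (δ x)).ser) _ b c d)
    obtain ⟨m, hm, h2⟩ := exec_caseProg (Γ := Alph I O) (k := .tmp) (x := x)
      (f := fun x => seq (pop .tmp) (pushList (some true :: (enc (δ x)).ser))) rfl h1
      (Finset.univ : Finset I).toList (by simp)
    obtain ⟨n, hn, h3⟩ := ih (δ x :: l)
    refine ⟨1 + m + n, ?_, ?_⟩
    · have : (Finset.univ : Finset I).toList.length = Fintype.card I := by simp [Finset.card_univ]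
      have hx := hM x
      unfold size at hx
      rw [List.length_cons] at hm
      rw [List.length_cons, Nat.succ_mul]
      omega
    · have e : (enc (δ x :: l)).ser ++ a = some true :: (enc (δ x)).ser ++ ((enc l).ser ++ a) := by
        simp [Enc.enc, encList, Tree.ser]
      rw [e] at h3
      exact (Exec.loop_step (Γ := Alph I O) (k := .tmp) rfl h2 h3).of_eq rfl rfl (by simp)

/-- Read a truth value from stack `a`. -/
def readBool (f : Bool → Prog (Alph I O)) : Prog (Alph I O) :=
  ite .a headTrue (seq (pop .a) (seq (pop .a) (seq (pop .a) (f true)))) (seq (pop .a) (f false))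

theorem exec_readBool {F : Frame I O} {f : Bool → Prog (Alph I O)} {x : Bool} {n m : ℕ} {S}
    (h : Exec (f x) (st F a b c d) n S) (hm : n ≤ m) :
    ∃ k ≤ m + 4, Exec (readBool f) (st F ((enc x).ser ++ a) b c d) k S := by
  cases x with
  | false =>
    exact ⟨_, by omega, Exec.ite_false (Γ := Alph I O) (k := .a) rfl
      ((exec_pop_a F a b c d (some false)).seq h)⟩
  | true =>
    exact ⟨_, by omega, Exec.ite_true (Γ := Alph I O) (k := .a) rfl
      ((exec_pop_a F (some false :: some false :: a) b c d (some true)).seq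
        ((exec_pop_a F (some false :: a) b c d (some false)).seq
          ((exec_pop_a F a b c d (some false)).seq h)))⟩

/-- Write the list on stack `a` to the output. -/
def printLoop (ω : Bool × Bool → O) : Prog (Alph I O) :=
  loop .a headTrue (seq (pop .a) (seq (pop .a)
    (readBool fun x => readBool fun y => push .out (ω (x, y)))))

/-- Printing onto a stack reverses the list, which `fractionData` compensates by a reversal. -/
theorem exec_printLoop (ω : Bool × Bool → O) (l : List (Bool × Bool)) : ∀ o : List O,
    ∃ m ≤ l.length * 12 + 1, Exec (printLoop ω) (st ⟨i, t, o⟩ ((enc l).ser ++ a) b c d) m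
      (st ⟨i, t, (l.map ω).reverse ++ o⟩ (some false :: a) b c d) := by
  induction l with
  | nil => exact fun o => ⟨1, by simp, Exec.loop_done (Γ := Alph I O) (k := .a) rfl⟩
  | cons p l ih =>
    obtain ⟨x, y⟩ := p
    intro o
    obtain ⟨n, hn, h⟩ := ih (ω (x, y) :: o)
    obtain ⟨m, hm, h1⟩ := exec_readBool (x := y) (f := fun y => push .out (ω (x, y)))
      ((enc l).ser ++ a) b c d (exec_push_out i t o _ b c d (ω (x, y))) le_rfl
    obtain ⟨m', hm', h2⟩ := exec_readBool (x := x)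
      (f := fun x => readBool fun y => push .out (ω (x, y))) _ b c d h1 hm
    have h3 : Exec _ _ _ _ := (exec_pop_a ⟨i, t, o⟩ (some true :: ((enc x).ser ++ ((enc y).ser ++
      ((enc l).ser ++ a)))) b c d (some true)).seq ((exec_pop_a ⟨i, t, o⟩ _ b c d (some true)).seq h2)
    refine ⟨_, ?_, (Exec.loop_step (Γ := Alph I O) (k := .a) (P := headTrue) rfl h3 h).of_eq ?_ rfl ?_⟩
    · rw [List.length_cons, Nat.succ_mul]
      omega
    · simp [Enc.enc, encList, Tree.ser]
    · simp

end InputOutput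

end Prog

/-- A function that is computed on lists of data in polynomial time is computed by a polynomial
time machine, if inputs and outputs are translated letter by letter. -/
theorem PolyFn.nonempty_tm2ComputableInPolyTime {X Y I O β : Type} [Fintype I] [Fintype O] [Enc β]
    {ea : X → List I} {eb : Y → List O} {g : X → Y} (δ : I → β) (ω : Bool × Bool → O)
    {f : List β → List (Bool × Bool)} (hf : PolyFn f)
    (h : ∀ x, ((f ((ea x).map δ)).map ω).reverse = eb (g x)) :
    Nonempty (TM2ComputableInPolyTime ea eb g) := by
  obtain ⟨p, T, ⟨P, hP⟩, hp⟩ := hf I O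
  obtain ⟨Q, hQ⟩ := hf.polyBound_size
  obtain ⟨M, hM⟩ : ∃ M, ∀ x, size (δ x) ≤ M :=
    ⟨Finset.univ.sup fun x => size (δ x), fun x =>
      Finset.le_sup (f := fun x => size (δ x)) (Finset.mem_univ x)⟩
  -- Bounds the size of the input as a list of data, whose entries have size at most `M`.
  set R : Polynomial ℕ := Polynomial.X * Polynomial.C (M + 1) + 1 with hR
  refine Prog.nonempty_tm2ComputableInPolyTime (Γ := Alph I O) .inp .out
    (seq copyLoop (seq (push .a (some false)) (seq (dataLoop δ) (seq p (seq (printLoop ω) (pop .a))))))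
    (Polynomial.X * Polynomial.C (Fintype.card I + 3) + 1 + (1 + (Polynomial.X *
      Polynomial.C (Fintype.card I + M + 5) + 1 + (P.comp R + (Q.comp R * 12 + 1 + 1))))) fun x => ?_
  obtain ⟨m₁, hm₁, h₁⟩ := exec_copyLoop (O := O) (ea x) [] [] [] [] [] []
  obtain ⟨m₂, hm₂, h₂⟩ := exec_dataLoop (O := O) [] (ea x).reverse [] [] [] [] [] δ M hM []
  obtain ⟨m₃, hm₃, h₃⟩ := hp ((ea x).map δ) ⟨[], [], []⟩ [] []
  obtain ⟨m₄, hm₄, h₄⟩ := exec_printLoop (I := I) [] [] [] [] [] [] ω (f ((ea x).map δ)) []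
  have hs : size ((ea x).map δ) ≤ R.eval (ea x).length := by
    refine (size_list_le (n := M) fun y hy => ?_).trans (by simp [hR])
    obtain ⟨z, -, rfl⟩ := List.mem_map.1 hy
    exact hM z
  have h5 := (hP ((ea x).map δ)).trans (eval_mono P hs)
  have h6 : size (f ((ea x).map δ)) ≤ _ := (hQ ((ea x).map δ)).trans (eval_mono Q hs)
  have h7 := length_lt_size (f ((ea x).map δ))
  have e : (((ea x).reverse.map δ).reverse ++ [] : List β) = (ea x).map δ := by simp
  rw [e] at h₂
  have h8 : Exec _ _ _ _ := h₁.seq ((exec_push_a ⟨[], _, []⟩ [] [] [] [] (some false)).seq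
    ((h₂.of_eq (by simp; rfl) rfl rfl).seq (h₃.seq (h₄.seq
      (exec_pop_a ⟨[], [], _⟩ [] [] [] [] (some false))))))
  refine ⟨_, ?_, h8.of_eq ?_ rfl ?_⟩
  · rw [List.length_reverse] at hm₂
    simp only [Polynomial.eval_add, Polynomial.eval_mul, Polynomial.eval_X, Polynomial.eval_C,
      Polynomial.eval_one, Polynomial.eval_comp, Polynomial.eval_ofNat]
    omega
  · funext k; cases k <;> rfl
  · rw [List.append_nil, h]
    funext k; cases k <;> rfl

/-! ### Parsing -/

/-- Letters as data: the kind of the letter (relation symbol or not, which bit), and a list that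
is a number for relation symbols and empty for end markers. -/
abbrev LetterData : Type := (Bool × Bool) × List Unit

/-- One step of the parser, which reads from right to left. The state consists of the values that
are not yet assigned to a fact, and the facts. -/
def parseStep (c : LetterData) (s : Vals × List RawFact) : Vals × List RawFact :=
  bif c.1.1 then ([], (c.2, s.1) :: s.2)
  else bif c.2.isEmpty then ([] :: s.1, s.2)
  else ((c.1.2 :: s.1.headD []) :: s.1.tail, s.2)

/-- The facts in a list of letters. -/
def parse (l : List LetterData) : List RawFact := (l.foldr parseStep ([], [])).2

/-- The growth per letter is additive, so the parser state stays linear in the input. -/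
theorem size_parseStep_le (c : LetterData) (s : Vals × List RawFact) :
    size (parseStep c s) ≤ size s + size c + 4 := by
  obtain ⟨⟨r, b⟩, u⟩ := c
  obtain ⟨v, t⟩ := s
  have hb := size_bool_le b
  cases r
  · cases u
    · simp [parseStep]
      omega
    · cases v
      · simp [parseStep]
        omega
      · simp [parseStep]
        omega
  · simp [parseStep]
    omega

theorem PolyFn.parse : PolyFn parse := by
  refine snd.comp (foldr (f := fun (_ : List LetterData) c s => parseStep c s) id (const ([], []))
    ?_ (fun l => 5 * size l + 3)
    (((PolyBound.const 5).mul PolyBound.size).add (PolyBound.const 3)) fun l l' h => ?_)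
  · have := headD (l := fun p : (List LetterData × (Vals × List RawFact)) × LetterData => p.1.2.1)
      (by fun_prop) []
    unfold parseStep
    fun_prop
  · have h1 : ∀ m : List LetterData, size (m.foldr parseStep ([], [])) ≤ 5 * size m + 3 := by
      intro m
      induction m with
      | nil => simp
      | cons c m ih =>
        have h2 := size_parseStep_le c (m.foldr parseStep ([], []))
        have h3 := size_pos c
        simp only [List.foldr_cons, size_cons]
        omega
    have h2 := h1 l'
    have h3 := size_le_of_sublist h.sublist
    exact h2.trans (by omega)

section Letters

variable {S : Schema} {Val : Type}

instance {ρ : Type} [Finite ρ] : Finite (Letter ρ) := by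
  let f : Letter ρ → Option (ρ ⊕ Bool) := fun
    | .rel R => some (Sum.inl R)
    | .bit b => some (Sum.inr b)
    | .endMark => none
  refine Finite.of_injective f fun x y h => ?_
  cases x <;> cases y <;> simp_all [f]

/-- Letters as data. -/
noncomputable def letterData : Letter S.Rel → LetterData
  | .rel R => ((true, false), un (relIndex R))
  | .bit b => ((false, b), [()])
  | .endMark => ((false, false), [])

theorem foldr_parseStep_bits (v : List Bool) (w : List Bool) (s : Vals) (t : List RawFact) :
    ((v.map Letter.bit).map (letterData (S := S))).foldr parseStep (w :: s, t) = ((v ++ w) :: s, t) := by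
  induction v with
  | nil => rfl
  | cons b v ih =>
    simp only [List.map_cons, List.foldr_cons, ih]
    rfl

theorem foldr_parseStep_values {ι : Type} (c : ι → List Bool) (l : List ι) (s : Vals)
    (t : List RawFact) :
    ((l.flatMap fun i => (c i).map Letter.bit ++ [Letter.endMark]).map
      (letterData (S := S))).foldr parseStep (s, t) = (l.map c ++ s, t) := by
  induction l with
  | nil => rfl
  | cons i l ih =>
    simp only [List.flatMap_cons, List.map_append, List.foldr_append, ih, List.map_cons,
      List.map_nil, List.foldr_cons, List.foldr_nil]
    have := foldr_parseStep_bits (S := S) (c i) [] (l.map c ++ s) t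
    rw [List.append_nil] at this
    exact this

/-- Read from the right, the values of a fact come before its relation symbol, which collects them
and leaves no pending values. Hence facts can be parsed one after another. -/
theorem foldr_parseStep_fact (code : Val → List Bool) (f : Fact S Val) (t : List RawFact) :
    ((encodeFact code f).map letterData).foldr parseStep ([], t) = ([], rawFact code f :: t) := by
  unfold encodeFact
  rw [List.map_cons, List.foldr_cons, foldr_parseStep_values, List.append_nil]
  rfl

theorem parse_encodeInput (code : Val → List Bool) (x : Input S Val) :
    parse ((encodeInput code x).map letterData) =
      rawFact code x.fact :: x.facts.map (rawFact code) := by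
  have h : ∀ l : List (Fact S Val), ((l.flatMap (encodeFact code)).map letterData).foldr parseStep
      ([], []) = ([], l.map (rawFact code)) := by
    intro l
    induction l with
    | nil => rfl
    | cons f l ih =>
      rw [List.flatMap_cons, List.map_append, List.foldr_append, ih, foldr_parseStep_fact]
      rfl
  unfold parse encodeInput
  rw [List.map_append, List.foldr_append, h, foldr_parseStep_fact]

end Letters

/-! ### The algorithm -/

/-- The fraction `n / d` as a list of letters of the output, reversed. -/
def fractionData (n d : ℕ) : List (Bool × Bool) :=
  ((false, false) :: (n.bits.map fun b => (false, b)) ++ d.bits.map fun b => (true, b)).reverse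

/-- Letters of the output. -/
def outLetter (p : Bool × Bool) : Bool ⊕ Bool := bif p.1 then Sum.inr p.2 else Sum.inl p.2

/-- The numerator is a natural number, so its sign bit, the first letter, is always `false`. -/
theorem encode_fraction (n d : ℕ) :
    ((fractionData n d).map outLetter).reverse = encodingFraction.encode ((n : ℤ), d) := by
  have h : encodingFraction.encode ((n : ℤ), d) = ((false :: Computability.encodeNat n).map Sum.inl) ++
      (Computability.encodeNat d).map Sum.inr := by
    have h0 : decide ((n : ℤ) < 0) = false := by simp
    simp only [encodingFraction, Computability.encodingProd, encodingInt, h0, Int.natAbs_natCast]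
    rfl
  rw [h, encodeNat_eq_bits, encodeNat_eq_bits]
  simp [fractionData, outLetter, Function.comp_def]

/-- The Shapley value of the first of the facts in a list of letters, in the database that consists
of the remaining entries, as letters of the output. -/
def shapleyData (ls : List ((RawFact → Vals) × (RawFact → Vals))) (l : List LetterData) :
    List (Bool × Bool) :=
  fractionData (shapleyNum ls ((parse l).headD ([], []), (parse l).tail)) (parse l).tail.length.factorial

theorem PolyFn.shapleyData (ls : List ((RawFact → Vals) × (RawFact → Vals)))
    (h : ∀ l ∈ ls, PolyFn l.1 ∧ PolyFn l.2) : PolyFn (shapleyData ls) := by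
  have h1 := PolyFn.parse
  have h2 : PolyFn fun l => (FDShapley.parse l).tail := by fun_prop
  have h3 := (PolyFn.shapleyNum ls h).comp ((headD h1 ([], [])).pair h2)
  have h4 := factorial_length h2
  exact reverse (append (cons (const (false, false))
    (map (f := fun _ b => (false, b)) (bits h3) (by fun_prop)))
    (map (f := fun _ b => (true, b)) (bits h4) (by fun_prop)))

end FDShapley

/-! ### The theorem -/

theorem mainTheorem7 (S : FDShapley.Schema) (Val : Type) [Infinite Val]
    (code : Computability.Encoding Val Bool) (Δ : Set (FDShapley.FD S))
    (hΔ : ∃ Δ' : Set (FDShapley.FD S),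
      FDShapley.EquivalentFDs Val Δ Δ' ∧ FDShapley.HasLhsChain Δ') :
    FDShapley.InFP (FDShapley.encodeInput (S := S) code.encode)
      (FDShapley.shapleyRepair (Val := Val) Δ) := by
  obtain ⟨Δ', heq, hΔ'⟩ := hΔ
  obtain ⟨ls, hls, hmax⟩ := FDShapley.exists_levels code.encode_injective hΔ'
  have hmax' : FDShapley.IsMax (fun C : FDShapley.Database S Val => FDShapley.Satisfies C Δ)
      fun C => FDShapley.chainValue ls (C.image (FDShapley.rawFact code.encode)) := by
    -- Equivalent sets of dependencies have the same consistent databases, so the levels built for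
    -- `Δ'` also compute the value for `Δ`.
    simpa only [heq _] using hmax
  refine ⟨fun x => ((FDShapley.shapleyNum ls (FDShapley.rawFact code.encode x.fact,
    x.facts.map (FDShapley.rawFact code.encode)) : ℤ), x.facts.length.factorial),
    fun x => ⟨Nat.factorial_ne_zero _, ?_⟩, ?_⟩
  · simpa using FDShapley.shapleyRepair_eq code.encode_injective Δ hmax' x
  · have : Fintype (FDShapley.Letter S.Rel) := Fintype.ofFinite _
    refine (FDShapley.PolyFn.shapleyData ls hls).nonempty_tm2ComputableInPolyTime
      FDShapley.letterData FDShapley.outLetter fun x => ?_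
    unfold FDShapley.shapleyData
    rw [FDShapley.parse_encodeInput, FDShapley.encode_fraction]
    simp
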